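/- Let $\gamma:[0,L]\to\mathbb{R}^2$, $L>0$, be a simple closed curve ($\gamma(0)=\gamma(L)$, no other self-intersections), parametrized by arc length, of class $C^1([0,L])$ and piecewise $C^2([0,L])$, with signed curvature $k$ changing sign only finitely many times, positively oriented (i.e. the unit normal $\mathbf n$, which is $\gamma'$ rotated counterclockwise by $\pi/2$, points into the bounded region $\Omega_\gamma$ enclosed by $\gamma$; $k=\gamma''\cdot\mathbf n$). Let $\mathcal K$ be the set of such curves with $\gamma'(0)=\gamma'(L)$, and $\mathcal C$ the set of such curves with an external cusp at $\gamma(0)$: $\gamma'(0)=-\gamma'(L)$ and $\gamma'(L)$ points outside $\Omega_\gamma$. For points $a,b$ of $\gamma$, $\wideparen{ab}$ is the arc run through from $a$ to $b$ in the direction of $\gamma$, $\overline{ab}$ the closed segment, and $\int_{\wideparen{ab}}k\,ds$ the total curvature of the arc. An arc is convex (concave) if $k\ge 0$ ($k\le 0$) on it and $k$ does not vanish identically on it; for $\gamma\in\mathcal C$ convex and concave arcs are not allowed to run through the cusp, which may however be an endpoint. A convex (concave) arc is maximal if no convex (concave) arc containing it has total curvature of larger absolute value. Let $\mathcal K_\pi$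 be the set of $\gamma\in\mathcal K$ all of whose maximal convex arcs satisfy $\int k\,ds>\pi$ and all of whose maximal concave arcs satisfy $-\pi<\int k\,ds<0$. Let $\mathcal C_\pi$ be the set of $\gamma\in\mathcal C$ with the same two properties, where the first one is only required of maximal convex arcs that do not have the cusp as an endpoint. Let $\gamma\in\mathcal K_\pi$ or $\gamma\in\mathcal C_\pi$, and let the arc $\wideparen{qq'}$ be nested into the arc $\wideparen{p'p}$, that is: $\wideparen{pq}$ is a maximal concave arc (where, if $\gamma\in\mathcal C_\pi$, neither $p$ nor $q$ is the cusp), $\wideparen{p'p}$ and $\wideparen{qq'}$ are convex arcs of total curvature $\pi$, and $\wideparen{qq'}$ intersects the segment $\overline{pp'}$. Then $\wideparen{qq'}$ holds a convex set: there is an open convex set $K\subseteq\Omega_\gamma$ with $\partial K=\overline{qq'}\cup\wideparen{qq'}$, and the tangents to $\wideparen{qq'}$ at $q$ and $q'$ are parallel. In particular $\overline{qq'}\subseteq\overline{\Omega_\gamma}$ (the closure of $\Omega_\gamma$). -/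

import Mathlib

open Set Filter Topology

/-! Plane curves parametrized by arc length. The Euclidean plane is the complex plane `ℂ`, so the
counterclockwise rotation by a right angle is multiplication by `Complex.I`. A closed curve
`[0, L] → ℂ` is given by its `L`-periodic extension `γ : ℝ → ℂ`. -/

namespace PlaneCurve

/-- The trace of the curve. -/
def trace (γ : ℝ → ℂ) (L : ℝ) : Set ℂ := γ '' Icc 0 L

/-- The region `Ω_γ` enclosed by the curve: the points off the curve whose connected component in
the complement of the curve is bounded. -/
def region (γ : ℝ → ℂ) (L : ℝ) : Set ℂ :=
  {z | z ∉ trace γ L ∧ Bornology.IsBounded (connectedComponentIn (trace γ L)ᶜ z)}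

/-- The signed curvature: `k = ⟨γ'', n⟩`, where the unit normal `n` is the unit tangent `γ'` rotated
counterclockwise by a right angle. (It takes the harmless value `0` at the finitely many points of a
piecewise `C²` curve at which `γ''` does not exist.) -/
noncomputable def curvature (γ : ℝ → ℂ) (s : ℝ) : ℝ :=
  inner ℝ (deriv (deriv γ) s) (Complex.I * deriv γ s)

/-- The total curvature of the arc of `γ` from the parameter `s` to the parameter `t`. -/
noncomputable def totalCurvature (γ : ℝ → ℂ) (s t : ℝ) : ℝ := ∫ u in s..t, curvature γ u

/-- `[0, L]` can be cut into finitely many intervals `[a, b]` each of which satisfies `P a b`. -/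
def Piecewise (L : ℝ) (P : ℝ → ℝ → Prop) : Prop :=
  ∃ (n : ℕ) (a : ℕ → ℝ), a 0 = 0 ∧ a n = L ∧
    (∀ i < n, a i < a (i + 1)) ∧ ∀ i < n, P (a i) (a (i + 1))

/-- Simple closed curves of length `L`, parametrized by arc length, of class `C¹([0, L])` and
piecewise `C²([0, L])`, whose curvature changes sign finitely often, and which are positively
oriented (the normal points into the enclosed region). The one-sided tangents at `0` and `L` are not
related to each other here. -/
structure IsAdmissible (γ : ℝ → ℂ) (L : ℝ) : Prop where
  length_pos : 0 < L
  periodic : Function.Periodic γ L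
  simple : InjOn γ (Ico 0 L)
  contDiffOn : ContDiffOn ℝ 1 γ (Icc 0 L)
  unit_speed : ∀ s ∈ Icc 0 L, ‖derivWithin γ (Icc 0 L) s‖ = 1
  piecewise_C2 : Piecewise L fun a b => ContDiffOn ℝ 2 γ (Icc a b)
  finite_sign_changes : Piecewise L fun a b =>
    (∀ s ∈ Ioo a b, 0 ≤ curvature γ s) ∨ (∀ s ∈ Ioo a b, curvature γ s ≤ 0)
  positively_oriented : ∀ s ∈ Ioo 0 L,
    ∀ᶠ t : ℝ in 𝓝[>] 0, γ s + t • (Complex.I * deriv γ s) ∈ region γ L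

/-- The class `𝒦` of closed smooth curves: `γ(0) = γ(L)` and `γ'(0) = γ'(L)`. -/
def ClassK (γ : ℝ → ℂ) (L : ℝ) : Prop :=
  IsAdmissible γ L ∧ derivWithin γ (Icc 0 L) 0 = derivWithin γ (Icc 0 L) L

/-- The class `𝒞` of curves with an external cusp at `γ(0) = γ(L)`: `γ'(0) = -γ'(L)`, and `γ'(L)`
points outside the enclosed region. -/
def ClassC (γ : ℝ → ℂ) (L : ℝ) : Prop :=
  IsAdmissible γ L ∧ derivWithin γ (Icc 0 L) 0 = -derivWithin γ (Icc 0 L) L ∧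
    ∀ᶠ t : ℝ in 𝓝[>] 0, γ L + t • derivWithin γ (Icc 0 L) L ∉ region γ L

/-- Parameter intervals of the arcs of a closed smooth curve: at most one turn around the curve, and
the arc may run through `γ(0)`. -/
def SmoothArc (L s t : ℝ) : Prop := s < t ∧ t ≤ s + L

/-- Parameter intervals of the arcs of a curve with a cusp that do not run through the cusp
`γ(0) = γ(L)` (which may still be an endpoint). -/
def CuspFreeArc (L s t : ℝ) : Prop := 0 ≤ s ∧ s < t ∧ t ≤ L

section Arcs

/-! In this section `A s t` says which parameter intervals `[s, t]` are allowed as arcs. It is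
`SmoothArc L` for closed smooth curves and `CuspFreeArc L` for curves with a cusp. -/

/-- Convex arcs: the curvature is nonnegative and not identically vanishing. -/
def IsConvexArc (A : ℝ → ℝ → Prop) (γ : ℝ → ℂ) (s t : ℝ) : Prop :=
  A s t ∧ (∀ u ∈ Ioo s t, 0 ≤ curvature γ u) ∧ ∃ u ∈ Ioo s t, curvature γ u ≠ 0

/-- Concave arcs: the curvature is nonpositive and not identically vanishing. -/
def IsConcaveArc (A : ℝ → ℝ → Prop) (γ : ℝ → ℂ) (s t : ℝ) : Prop :=
  A s t ∧ (∀ u ∈ Ioo s t, curvature γ u ≤ 0) ∧ ∃ u ∈ Ioo s t, curvature γ u ≠ 0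

/-- Maximal convex arcs: no convex arc containing it has larger absolute total curvature. -/
def IsMaximalConvexArc (A : ℝ → ℝ → Prop) (γ : ℝ → ℂ) (s t : ℝ) : Prop :=
  IsConvexArc A γ s t ∧ ¬ ∃ s' t', IsConvexArc A γ s' t' ∧ s' ≤ s ∧ t ≤ t' ∧
    |totalCurvature γ s t| < |totalCurvature γ s' t'|

/-- Maximal concave arcs: no concave arc containing it has larger absolute total curvature. -/
def IsMaximalConcaveArc (A : ℝ → ℝ → Prop) (γ : ℝ → ℂ) (s t : ℝ) : Prop :=
  IsConcaveArc A γ s t ∧ ¬ ∃ s' t', IsConcaveArc A γ s' t' ∧ s' ≤ s ∧ t ≤ t' ∧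
    |totalCurvature γ s t| < |totalCurvature γ s' t'|

/-- The arc `q q'` is nested into the arc `p' p`: the arc `p q` is a maximal concave arc, the arcs
`p' p` and `q q'` are convex of total curvature `π`, and the arc `q q'` meets the segment `p p'`.
The points are given by their parameters. For `A = CuspFreeArc L` the shared parameters `p` and `q`
are automatically different from `0` and `L`, so the points `p` and `q` are not the cusp. -/
def IsNested (A : ℝ → ℝ → Prop) (γ : ℝ → ℂ) (p' p q q' : ℝ) : Prop :=
  IsMaximalConcaveArc A γ p q ∧
    IsConvexArc A γ p' p ∧ totalCurvature γ p' p = Real.pi ∧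
    IsConvexArc A γ q q' ∧ totalCurvature γ q q' = Real.pi ∧
    (γ '' Icc q q' ∩ segment ℝ (γ p) (γ p')).Nonempty

end Arcs

/-- The class `𝒦_π`. -/
def ClassKPi (γ : ℝ → ℂ) (L : ℝ) : Prop :=
  ClassK γ L ∧
    (∀ s t, IsMaximalConvexArc (SmoothArc L) γ s t → Real.pi < totalCurvature γ s t) ∧
    ∀ s t, IsMaximalConcaveArc (SmoothArc L) γ s t →
      -Real.pi < totalCurvature γ s t ∧ totalCurvature γ s t < 0

/-- The class `𝒞_π`; the condition on maximal convex arcs is only imposed on those which do not have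
the cusp as an endpoint. -/
def ClassCPi (γ : ℝ → ℂ) (L : ℝ) : Prop :=
  ClassC γ L ∧
    (∀ s t, IsMaximalConvexArc (CuspFreeArc L) γ s t → s ≠ 0 → t ≠ L →
      Real.pi < totalCurvature γ s t) ∧
    ∀ s t, IsMaximalConcaveArc (CuspFreeArc L) γ s t →
      -Real.pi < totalCurvature γ s t ∧ totalCurvature γ s t < 0

/-- The arc of `γ` from the parameter `s` to the parameter `t` holds the open convex set `K`: `K` is
contained in the enclosed region, is bounded by the arc and its chord, and the tangents to the arc
at its two endpoints are parallel. -/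
def Holds (γ : ℝ → ℂ) (L s t : ℝ) (K : Set ℂ) : Prop :=
  IsOpen K ∧ Convex ℝ K ∧ K ⊆ region γ L ∧
    frontier K = segment ℝ (γ s) (γ t) ∪ γ '' Icc s t ∧
    ∃ c : ℝ, c ≠ 0 ∧ derivWithin γ (Icc s t) t = c • derivWithin γ (Icc s t) s

end PlaneCurve

/-! The proof rests on one quantitative fact: no arc of the curve turns right by `π` or more
(`neg_pi_lt_totalCurvature`). In a shortest counterexample every convex piece could be cut off, or
compensates by turning left by more than `π`; so the counterexample would be concave, and the
maximal concave arcs turn too little for that. At an external cusp the tangent jumps left by `π` and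
not right (`ClassC.cusp_jump`), so the bound also holds for arcs through the cusp.

The topology of the closed curve enters through a continuous argument `Θ s t` of the secant from `g
s` to `g t`, as in Hopf's proof of the theorem on turning tangents. Its limits at the diagonal are
the tangent angles, and `Θ t (s + L) = Θ s t + π` (`TurningLoop.antipodal`). An angle confined to a
half-plane or a slit plane cannot change its branch, so comparing secant angles shows which
positions of points on the curve exclude each other.

A rigid motion places `q` at `-ℓ` and `q'` at `0`, with the inner arc below the real axis. The set
`K` is the cap between the arc and its chord: the points below the axis and to the left of all
tangents of the arc. Since the arc turns by exactly `π`, this is an open convex set with the right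
frontier (`CapArc.frontier_cap`). What has to be shown is that the curve does not enter the cap.

Because the inner arc meets the chord `p p'`, the outer arc crosses the axis upwards at a point `g
e` to the right of `0`, with tangent angle below `-π`, and the curve stays in the closed upper
half-plane from `e` to `q` (`NestedArcs.exists_crossing`). Suppose that the remaining arc from `q'`
to `e + L` enters the cap. It can cross the frontier only through the chord. It can neither come
from nor go to the axis left of `-ℓ`, since it would then be interlaced with the arc from `e` to `q`
(`TurningLoop.not_interlaced`). So it comes from the right and returns to the right, and at its
lowest point its tangent angle turns out to be at least `2π` (`TurningLoop.lowest_point`). At `e +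
L` the angle is below `π`, so a right turn by more than `π` lies in between: a contradiction
(`TurningLoop.not_mem_cap`).

Finally the cap is connected, avoids the curve and contains points just to the left of it, so it
lies in the enclosed region. -/

namespace PlaneCurve

/-! ### Angles confined to half-planes and slit planes -/

section Angles

variable {X : Type*} [TopologicalSpace X] {S : Set X} {φ : X → ℝ}

/-- A continuous function on a preconnected set that omits two values stays between them. -/
theorem mem_Ioo_of_isPreconnected (hS : IsPreconnected S) (hφ : ContinuousOn φ S) {c d : ℝ}
    (hc : ∀ x ∈ S, φ x ≠ c) (hd : ∀ x ∈ S, φ x ≠ d) {x₀ : X} (hx₀ : x₀ ∈ S)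
    (h₀ : φ x₀ ∈ Ioo c d) {x : X} (hx : x ∈ S) : φ x ∈ Ioo c d := by
  have hO : OrdConnected (φ '' S) := (hS.image φ hφ).ordConnected
  by_contra hcon
  rw [mem_Ioo, not_and_or, not_lt, not_lt] at hcon
  rcases hcon with h | h
  · obtain ⟨y, hy, hyc⟩ := hO.out (mem_image_of_mem φ hx) (mem_image_of_mem φ hx₀) ⟨h, h₀.1.le⟩
    exact hc y hy hyc
  · obtain ⟨y, hy, hyc⟩ := hO.out (mem_image_of_mem φ hx₀) (mem_image_of_mem φ hx) ⟨h₀.2.le, h⟩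
    exact hd y hy hyc

theorem sin_two_pi_int_add (k : ℤ) (x : ℝ) : Real.sin (2 * Real.pi * k + x) = Real.sin x := by
  rw [add_comm, mul_comm, Real.sin_add_int_mul_two_pi]

theorem cos_two_pi_int_add (k : ℤ) (x : ℝ) : Real.cos (2 * Real.pi * k + x) = Real.cos x := by
  rw [add_comm, mul_comm, Real.cos_add_int_mul_two_pi]

/-- An angle moving in the closed upper half-plane stays in an interval of length `π`. -/
theorem mem_Icc_of_sin_nonneg (hS : IsPreconnected S) (hφ : ContinuousOn φ S)
    (h : ∀ x ∈ S, 0 ≤ Real.sin (φ x)) {k : ℤ} {x₀ : X} (hx₀ : x₀ ∈ S)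
    (h₀ : φ x₀ ∈ Icc (2 * Real.pi * k) (2 * Real.pi * k + Real.pi)) {x : X} (hx : x ∈ S) :
    φ x ∈ Icc (2 * Real.pi * k) (2 * Real.pi * k + Real.pi) := by
  have hpi := Real.pi_pos
  -- The barriers are the two neighbouring angles with sine `-1`. They cannot be reached, and
  -- between them the sign of the sine gives the sharp interval.
  have key := mem_Ioo_of_isPreconnected hS hφ (c := 2 * Real.pi * k + -(Real.pi / 2))
    (d := 2 * Real.pi * k + (Real.pi / 2 + Real.pi)) (fun y hy e => by
      have := h y hy
      rw [e, sin_two_pi_int_add, Real.sin_neg, Real.sin_pi_div_two] at this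
      linarith) (fun y hy e => by
      have := h y hy
      rw [e, sin_two_pi_int_add, Real.sin_add_pi, Real.sin_pi_div_two] at this
      linarith) hx₀ ⟨by linarith [h₀.1], by linarith [h₀.2]⟩ hx
  have hs := h x hx
  set y := φ x - 2 * Real.pi * k with hy
  have e : φ x = 2 * Real.pi * k + y := by rw [hy]; ring
  rw [e, sin_two_pi_int_add] at hs
  rw [e] at key ⊢
  constructor
  · by_contra hlt
    have := Real.sin_neg_of_neg_of_neg_pi_lt (x := y) (by linarith) (by linarith [key.1])
    linarith
  · by_contra hlt
    have := Real.sin_pos_of_pos_of_lt_pi (x := y - Real.pi) (by linarith) (by linarith [key.2])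
    rw [Real.sin_sub_pi] at this
    linarith

/-- An angle moving in the closed lower half-plane stays in an interval of length `π`. -/
theorem mem_Icc_of_sin_nonpos (hS : IsPreconnected S) (hφ : ContinuousOn φ S)
    (h : ∀ x ∈ S, Real.sin (φ x) ≤ 0) {k : ℤ} {x₀ : X} (hx₀ : x₀ ∈ S)
    (h₀ : φ x₀ ∈ Icc (2 * Real.pi * k - Real.pi) (2 * Real.pi * k)) {x : X} (hx : x ∈ S) :
    φ x ∈ Icc (2 * Real.pi * k - Real.pi) (2 * Real.pi * k) := by
  have := mem_Icc_of_sin_nonneg (φ := fun x => φ x + Real.pi) hS (hφ.add continuousOn_const)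
    (fun y hy => by rw [Real.sin_add_pi]; linarith [h y hy]) (k := k) hx₀
    ⟨by linarith [h₀.1], by linarith [h₀.2]⟩ hx
  exact ⟨by linarith [this.1], by linarith [this.2]⟩

/-- An angle moving in the plane without the negative real axis. -/
theorem mem_Ioo_of_cos_pos (hS : IsPreconnected S) (hφ : ContinuousOn φ S)
    (h : ∀ x ∈ S, Real.sin (φ x) = 0 → 0 < Real.cos (φ x)) {k : ℤ} {x₀ : X} (hx₀ : x₀ ∈ S)
    (h₀ : φ x₀ ∈ Ioo (2 * Real.pi * k - Real.pi) (2 * Real.pi * k + Real.pi))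
    {x : X} (hx : x ∈ S) :
    φ x ∈ Ioo (2 * Real.pi * k - Real.pi) (2 * Real.pi * k + Real.pi) := by
  refine mem_Ioo_of_isPreconnected hS hφ (fun y hy e => ?_) (fun y hy e => ?_) hx₀ h₀ hx
  · have := h y hy
    rw [e, sub_eq_add_neg, sin_two_pi_int_add, cos_two_pi_int_add, Real.sin_neg, Real.cos_neg] at this
    simp at this
    linarith
  · have := h y hy
    rw [e, sin_two_pi_int_add, cos_two_pi_int_add] at this
    simp at this
    linarith

/-- An angle moving in the plane without the positive real axis. -/
theorem mem_Ioo_of_cos_neg (hS : IsPreconnected S) (hφ : ContinuousOn φ S)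
    (h : ∀ x ∈ S, Real.sin (φ x) = 0 → Real.cos (φ x) < 0) {k : ℤ} {x₀ : X} (hx₀ : x₀ ∈ S)
    (h₀ : φ x₀ ∈ Ioo (2 * Real.pi * k - 2 * Real.pi) (2 * Real.pi * k))
    {x : X} (hx : x ∈ S) :
    φ x ∈ Ioo (2 * Real.pi * k - 2 * Real.pi) (2 * Real.pi * k) := by
  have := mem_Ioo_of_cos_pos (φ := fun x => φ x + Real.pi) hS (hφ.add continuousOn_const)
    (fun y hy => by
      rw [Real.sin_add_pi, Real.cos_add_pi]
      intro e
      linarith [h y hy (by linarith)]) (k := k) hx₀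
    ⟨by linarith [h₀.1], by linarith [h₀.2]⟩ hx
  exact ⟨by linarith [this.1], by linarith [this.2]⟩

theorem exists_int_mem_Ico (x : ℝ) :
    ∃ k : ℤ, x ∈ Ico (2 * Real.pi * k) (2 * Real.pi * k + 2 * Real.pi) := by
  have hpi := Real.two_pi_pos
  refine ⟨⌊x / (2 * Real.pi)⌋, ?_, ?_⟩
  · have := Int.floor_le (x / (2 * Real.pi))
    rw [le_div_iff₀ hpi] at this
    linarith
  · have := Int.lt_floor_add_one (x / (2 * Real.pi))
    rw [div_lt_iff₀ hpi] at this
    linarith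

theorem exists_int_mem_Icc_of_sin_nonneg {x : ℝ} (h : 0 ≤ Real.sin x) :
    ∃ k : ℤ, x ∈ Icc (2 * Real.pi * k) (2 * Real.pi * k + Real.pi) := by
  obtain ⟨k, hk⟩ := exists_int_mem_Ico x
  refine ⟨k, hk.1, ?_⟩
  by_contra hlt
  have h1 := Real.sin_pos_of_pos_of_lt_pi (x := x - 2 * Real.pi * k - Real.pi) (by linarith)
    (by linarith [hk.2])
  have e : x = 2 * Real.pi * k + (x - 2 * Real.pi * k) := by ring
  rw [Real.sin_sub_pi] at h1
  rw [e, sin_two_pi_int_add] at h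
  linarith

theorem exists_int_mem_Icc_of_sin_nonpos {x : ℝ} (h : Real.sin x ≤ 0) :
    ∃ k : ℤ, x ∈ Icc (2 * Real.pi * k - Real.pi) (2 * Real.pi * k) := by
  obtain ⟨k, hk⟩ := exists_int_mem_Icc_of_sin_nonneg (x := x + Real.pi)
    (by rw [Real.sin_add_pi]; linarith)
  exact ⟨k, by linarith [hk.1], by linarith [hk.2]⟩

theorem mem_Ioo_of_mem_Icc_of_sin_ne_zero {x c : ℝ} {k : ℤ} (hs : Real.sin x ≠ 0)
    (hx : x ∈ Icc (2 * Real.pi * k + c) (2 * Real.pi * k + c + Real.pi)) (hc : Real.sin c = 0) :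
    x ∈ Ioo (2 * Real.pi * k + c) (2 * Real.pi * k + c + Real.pi) := by
  refine ⟨lt_of_le_of_ne hx.1 fun e => hs ?_, lt_of_le_of_ne hx.2 fun e => hs ?_⟩
  · rw [← e, sin_two_pi_int_add, hc]
  · rw [e, Real.sin_add_pi, sin_two_pi_int_add, hc, neg_zero]

end Angles

/-! ### Arguments of complex numbers and of secants -/

/-- `φ` is an argument of `z`. -/
def IsArg (z : ℂ) (φ : ℝ) : Prop := z = ‖z‖ * Complex.exp (φ * Complex.I)

namespace IsArg

variable {z w : ℂ} {φ ψ : ℝ}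

theorem re (h : IsArg z φ) : z.re = ‖z‖ * Real.cos φ := by
  have := congrArg Complex.re h
  simpa [Complex.exp_ofReal_mul_I_re] using this

theorem im (h : IsArg z φ) : z.im = ‖z‖ * Real.sin φ := by
  have := congrArg Complex.im h
  simpa [Complex.exp_ofReal_mul_I_im] using this

theorem sin_nonneg (h : IsArg z φ) (hz : z ≠ 0) (hi : 0 ≤ z.im) : 0 ≤ Real.sin φ := by
  rw [h.im] at hi
  exact nonneg_of_mul_nonneg_right hi (norm_pos_iff.2 hz)

theorem sin_nonpos (h : IsArg z φ) (hz : z ≠ 0) (hi : z.im ≤ 0) : Real.sin φ ≤ 0 := by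
  rw [h.im] at hi
  exact nonpos_of_mul_nonpos_right hi (norm_pos_iff.2 hz)

theorem im_eq_zero (h : IsArg z φ) (hs : Real.sin φ = 0) : z.im = 0 := by rw [h.im, hs, mul_zero]

theorem sin_eq_zero (h : IsArg z φ) (hz : z ≠ 0) (hi : z.im = 0) : Real.sin φ = 0 := by
  rw [h.im] at hi
  exact (mul_eq_zero.1 hi).resolve_left (norm_ne_zero_iff.2 hz)

theorem cos_pos (h : IsArg z φ) (hi : 0 < z.re) : 0 < Real.cos φ := by
  rw [h.re] at hi
  exact pos_of_mul_pos_right hi (norm_nonneg z)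

theorem cos_neg (h : IsArg z φ) (hi : z.re < 0) : Real.cos φ < 0 := by
  rw [h.re] at hi
  exact neg_of_mul_neg_right hi (norm_nonneg z)

theorem exp_eq (h : IsArg z φ) (hz : z ≠ 0) : Complex.exp (φ * Complex.I) = z / ‖z‖ := by
  have : (‖z‖ : ℂ) ≠ 0 := by exact_mod_cast norm_ne_zero_iff.2 hz
  rw [eq_div_iff this, mul_comm]
  exact h.symm

theorem neg (h : IsArg z φ) : IsArg (-z) (φ + Real.pi) := by
  unfold IsArg at *
  rw [norm_neg]
  push_cast
  rw [add_mul, Complex.exp_add, Complex.exp_pi_mul_I]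
  conv_lhs => rw [h]
  ring

theorem mul_exp (h : IsArg z φ) (ψ : ℝ) :
    IsArg (z * Complex.exp (ψ * Complex.I)) (φ + ψ) := by
  unfold IsArg at *
  rw [norm_mul, Complex.norm_exp_ofReal_mul_I, mul_one]
  push_cast
  rw [add_mul, Complex.exp_add]
  conv_lhs => rw [h]
  ring

theorem exists_int (h : IsArg z φ) (h' : IsArg z ψ) (hz : z ≠ 0) :
    ∃ n : ℤ, φ = ψ + n * (2 * Real.pi) := by
  have e : Complex.exp (φ * Complex.I) = Complex.exp (ψ * Complex.I) := by
    rw [h.exp_eq hz, h'.exp_eq hz]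
  obtain ⟨n, hn⟩ := Complex.exp_eq_exp_iff_exists_int.1 e
  refine ⟨n, ?_⟩
  have := congrArg Complex.im hn
  simpa using this

end IsArg

/-- The pairs of parameters of distinct points in one turn around a closed curve of length `L`. -/
def strip (L : ℝ) : Set (ℝ × ℝ) := {x | x.1 < x.2 ∧ x.2 < x.1 + L}

theorem isOpen_strip (L : ℝ) : IsOpen (strip L) :=
  (isOpen_lt continuous_fst continuous_snd).inter
    (isOpen_lt continuous_snd (continuous_fst.add continuous_const))

theorem convex_strip (L : ℝ) : Convex ℝ (strip L) := by
  rintro ⟨a, b⟩ ⟨h1, h2⟩ ⟨c, d⟩ ⟨h3, h4⟩ u v hu hv huv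
  simp only [strip, mem_ofPred_eq, Prod.smul_mk, Prod.mk_add_mk, smul_eq_mul] at *
  obtain rfl : v = 1 - u := by linarith
  rcases hu.eq_or_lt with rfl | hu
  · constructor <;> nlinarith
  · constructor <;> nlinarith

/-- A continuous argument of the secants of a closed curve. -/
theorem exists_secant_arg {g : ℝ → ℂ} {L : ℝ} (hL : 0 < L) (hg : Continuous g)
    (hinj : ∀ s t, s < t → t < s + L → g s ≠ g t) :
    ∃ Θ : ℝ → ℝ → ℝ, ContinuousOn (fun x : ℝ × ℝ => Θ x.1 x.2) (strip L) ∧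
      ∀ s t, s < t → t < s + L → IsArg (g t - g s) (Θ s t) := by
  have hne : (strip L).Nonempty := ⟨(0, L / 2), by constructor <;> simp <;> linarith⟩
  -- On a simply connected domain the nowhere vanishing secant has a continuous logarithm; its
  -- imaginary part is the required argument.
  have hsc : IsSimplyConnected (strip L) := by
    have := (convex_strip L).contractibleSpace hne
    exact SimplyConnectedSpace.ofContractible (strip L)
  obtain ⟨f, hf, hexp⟩ := Complex.exists_continuousOn_eqOn_exp_comp hsc (isOpen_strip L)
    (g := fun x : ℝ × ℝ => g x.2 - g x.1) (by fun_prop) (by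
      rintro ⟨x, hx, e⟩
      exact hinj x.1 x.2 hx.1 hx.2 (sub_eq_zero.1 e).symm)
  refine ⟨fun s t => (f (s, t)).im, Complex.continuous_im.comp_continuousOn hf, fun s t h1 h2 => ?_⟩
  have e : Complex.exp (f (s, t)) = g t - g s := hexp (show (s, t) ∈ strip L from ⟨h1, h2⟩)
  unfold IsArg
  rw [← e, Complex.norm_exp]
  push_cast
  rw [← Complex.exp_add, Complex.re_add_im]

/-- A simple closed curve `g` of length `L` together with a continuous argument `Θ s t` of its
secants. -/
structure SecantLoop (g : ℝ → ℂ) (L : ℝ) (Θ : ℝ → ℝ → ℝ) : Prop where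
  length_pos : 0 < L
  periodic : ∀ s, g (s + L) = g s
  continuous : Continuous g
  injective : ∀ s t, s < t → t < s + L → g s ≠ g t
  arg_continuousOn : ContinuousOn (fun x : ℝ × ℝ => Θ x.1 x.2) (strip L)
  isArg : ∀ s t, s < t → t < s + L → IsArg (g t - g s) (Θ s t)

/-- A simple closed curve with one-sided tangent angles `θm`, `θp`, such that the tangent jumps at
most by a left turn by `π` and no arc turns right by `π` or more. -/
structure TurningLoop (g : ℝ → ℂ) (L : ℝ) (Θ : ℝ → ℝ → ℝ) (θm θp : ℝ → ℝ) : Prop extends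
    SecantLoop g L Θ where
  tendsto_left : ∀ c, Tendsto (fun s => Θ s c) (𝓝[<] c) (𝓝 (θm c))
  tendsto_right : ∀ c, Tendsto (fun t => Θ c t) (𝓝[>] c) (𝓝 (θp c))
  jump : ∀ c, θp c = θm c ∨ θp c = θm c + Real.pi
  turning : ∀ s t, s < t → t ≤ s + L → -Real.pi < θm t - θp s

/-- The directions along the positive real axis are the multiples of `2π`, and the open window of
radius `2π` around one of them contains no other. This reads off the exact argument of a horizontal
secant from a rough bound. -/
theorem eq_of_sin_eq_zero_of_cos_pos {φ : ℝ} {k : ℤ} (hs : Real.sin φ = 0) (hc : 0 < Real.cos φ)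
    (h : φ ∈ Ioo (2 * Real.pi * k - 2 * Real.pi) (2 * Real.pi * k + 2 * Real.pi)) :
    φ = 2 * Real.pi * k := by
  have hpi := Real.pi_pos
  obtain ⟨n, hn⟩ := Real.sin_eq_zero_iff.1 hs
  rcases Int.even_or_odd' n with ⟨i, rfl | rfl⟩
  · push_cast at hn
    have h1 : i - k < 1 := by
      have := h.2
      rw [← hn] at this
      have h3 : ((i - k : ℤ) : ℝ) < 1 := by push_cast; nlinarith
      exact_mod_cast h3
    have h2 : -1 < i - k := by
      have := h.1
      rw [← hn] at this
      have h3 : (-1 : ℝ) < ((i - k : ℤ) : ℝ) := by push_cast; nlinarith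
      exact_mod_cast h3
    obtain rfl : i = k := by omega
    rw [← hn]; ring
  · rw [← hn] at hc
    push_cast at hc
    have e : (2 * (i : ℝ) + 1) * Real.pi = 2 * Real.pi * i + Real.pi := by ring
    rw [e, cos_two_pi_int_add, Real.cos_pi] at hc
    linarith

theorem eq_of_sin_eq_zero_of_cos_neg {φ : ℝ} {k : ℤ} (hs : Real.sin φ = 0) (hc : Real.cos φ < 0)
    (h : φ ∈ Ioo (2 * Real.pi * k - Real.pi) (2 * Real.pi * k + 3 * Real.pi)) :
    φ = 2 * Real.pi * k + Real.pi := by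
  have := eq_of_sin_eq_zero_of_cos_pos (φ := φ - Real.pi) (k := k)
    (by rw [Real.sin_sub_pi, hs, neg_zero]) (by rw [Real.cos_sub_pi]; linarith)
    ⟨by linarith [h.1], by linarith [h.2]⟩
  linarith

namespace SecantLoop

variable {g : ℝ → ℂ} {L : ℝ} {Θ : ℝ → ℝ → ℝ} (H : SecantLoop g L Θ)
include H

theorem ne_zero {s t : ℝ} (h1 : s < t) (h2 : t < s + L) : g t - g s ≠ 0 :=
  sub_ne_zero.2 (H.injective s t h1 h2).symm

/-- The antipodal secant differs by a fixed odd multiple of `π`. -/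
theorem exists_antipodal :
    ∃ n : ℤ, ∀ s t, s < t → t < s + L → Θ t (s + L) = Θ s t + (Real.pi + 2 * Real.pi * n) := by
  have hL := H.length_pos
  have hpi := Real.pi_pos
  have hpt : ∀ s t, s < t → t < s + L →
      ∃ n : ℤ, Θ t (s + L) = Θ s t + (Real.pi + 2 * Real.pi * n) := by
    intro s t h1 h2
    have a1 := H.isArg t (s + L) h2 (by linarith)
    have a2 := (H.isArg s t h1 h2).neg
    rw [H.periodic s] at a1
    rw [neg_sub] at a2
    obtain ⟨n, hn⟩ := a1.exists_int a2 (sub_ne_zero.2 (H.injective s t h1 h2))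
    exact ⟨n, by rw [hn]; ring⟩
  have hcont : ContinuousOn (fun x : ℝ × ℝ => Θ x.2 (x.1 + L) - Θ x.1 x.2) (strip L) := by
    refine ContinuousOn.sub ?_ H.arg_continuousOn
    exact H.arg_continuousOn.comp (f := fun x : ℝ × ℝ => (x.2, x.1 + L)) (by fun_prop)
      fun x hx => ⟨hx.2, by have := hx.1; simp only; linarith⟩
  have hbase : ((0, L / 2) : ℝ × ℝ) ∈ strip L := by constructor <;> simp <;> linarith
  obtain ⟨n, hn⟩ := hpt 0 (L / 2) hbase.1 hbase.2
  refine ⟨n, fun s t h1 h2 => ?_⟩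
  -- The difference is pointwise an odd multiple of `π`. It never meets the even ones, so on the
  -- connected strip the odd multiple is constant.
  have havoid : ∀ i : ℤ, ∀ x ∈ strip L, Θ x.2 (x.1 + L) - Θ x.1 x.2 ≠ 2 * Real.pi * i := by
    intro i x hx e
    obtain ⟨j, hj⟩ := hpt x.1 x.2 hx.1 hx.2
    have h3 : (2 * i : ℝ) * Real.pi = (1 + 2 * j) * Real.pi := by linarith
    have h4 := mul_right_cancel₀ hpi.ne' h3
    have h5 : 2 * i = 1 + 2 * j := by exact_mod_cast h4
    omega
  have := mem_Ioo_of_isPreconnected (convex_strip L).isPreconnected hcont (havoid n)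
    (havoid (n + 1)) hbase (by push_cast; constructor <;> linarith)
    (show (s, t) ∈ strip L from ⟨h1, h2⟩)
  obtain ⟨j, hj⟩ := hpt s t h1 h2
  simp only [hj] at this
  have h3 := this.1
  have h4 := this.2
  push_cast at h4
  have h5 : ((n : ℤ) : ℝ) < j + 1 := by nlinarith
  have h6 : ((j : ℤ) : ℝ) < n + 1 := by nlinarith
  have h7 : n < j + 1 := by exact_mod_cast h5
  have h8 : j < n + 1 := by exact_mod_cast h6
  obtain rfl : n = j := by omega
  exact hj

end SecantLoop

/-! ### Hopf's theorem on turning tangents, and interlaced arcs -/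

namespace TurningLoop

variable {g : ℝ → ℂ} {L : ℝ} {Θ : ℝ → ℝ → ℝ} {θm θp : ℝ → ℝ} (H : TurningLoop g L Θ θm θp)
include H

theorem continuousOn_left {c : ℝ} {S : Set ℝ} (hS : S ⊆ Ioo (c - L) c) :
    ContinuousOn (fun s => Θ s c) S :=
  H.arg_continuousOn.comp (f := fun s : ℝ => (s, c)) (by fun_prop)
    fun s hs => ⟨(hS hs).2, by have := (hS hs).1; simp only; linarith⟩

theorem continuousOn_right {c : ℝ} {S : Set ℝ} (hS : S ⊆ Ioo c (c + L)) :
    ContinuousOn (fun t => Θ c t) S :=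
  H.arg_continuousOn.comp (f := fun t : ℝ => (c, t)) (by fun_prop)
    fun s hs => ⟨(hS hs).1, (hS hs).2⟩

/-- Secants from a point to points that are not lower have directions in the closed upper
half-plane, so their continuous argument stays in one half turn. The gain is that one integer `k`
serves all of `S`. -/
theorem right_up {c : ℝ} {S : Set ℝ} (hS : S ⊆ Ioo c (c + L)) (hc : IsPreconnected S)
    (h : ∀ t ∈ S, (g c).im ≤ (g t).im) :
    ∃ k : ℤ, ∀ t ∈ S, Θ c t ∈ Icc (2 * Real.pi * k) (2 * Real.pi * k + Real.pi) := by
  rcases S.eq_empty_or_nonempty with rfl | ⟨x, hx⟩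
  · exact ⟨0, by simp⟩
  have hs : ∀ t ∈ S, 0 ≤ Real.sin (Θ c t) := fun t ht =>
    (H.isArg c t (hS ht).1 (hS ht).2).sin_nonneg (H.ne_zero (hS ht).1 (hS ht).2)
      (by rw [Complex.sub_im]; linarith [h t ht])
  obtain ⟨k, hk⟩ := exists_int_mem_Icc_of_sin_nonneg (hs x hx)
  exact ⟨k, fun t ht => mem_Icc_of_sin_nonneg hc (H.continuousOn_right hS) hs hx hk ht⟩

theorem left_arg {c s : ℝ} {S : Set ℝ} (hS : S ⊆ Ioo (c - L) c) (hs : s ∈ S) :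
    IsArg (g c - g s) (Θ s c) ∧ g c - g s ≠ 0 :=
  ⟨H.isArg s c (hS hs).2 (by linarith [(hS hs).1]), H.ne_zero (hS hs).2 (by linarith [(hS hs).1])⟩

theorem left_down {c : ℝ} {S : Set ℝ} (hS : S ⊆ Ioo (c - L) c) (hc : IsPreconnected S)
    (h : ∀ s ∈ S, (g c).im ≤ (g s).im) :
    ∃ k : ℤ, ∀ s ∈ S, Θ s c ∈ Icc (2 * Real.pi * k - Real.pi) (2 * Real.pi * k) := by
  rcases S.eq_empty_or_nonempty with rfl | ⟨x, hx⟩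
  · exact ⟨0, by simp⟩
  have hs : ∀ s ∈ S, Real.sin (Θ s c) ≤ 0 := fun s hs =>
    (H.left_arg hS hs).1.sin_nonpos (H.left_arg hS hs).2
      (by rw [Complex.sub_im]; linarith [h s hs])
  obtain ⟨k, hk⟩ := exists_int_mem_Icc_of_sin_nonpos (hs x hx)
  exact ⟨k, fun t ht => mem_Icc_of_sin_nonpos hc (H.continuousOn_left hS) hs hx hk ht⟩

theorem right_mem {c d : ℝ} (hcd : c < d) {C : Set ℝ} (hC : IsClosed C)
    (h : ∀ t ∈ Ioo c d, Θ c t ∈ C) : θp c ∈ C :=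
  hC.mem_of_tendsto (H.tendsto_right c) (by
    filter_upwards [Ioo_mem_nhdsGT hcd] with t ht using h t ht)

theorem left_mem {c d : ℝ} (hcd : c < d) {C : Set ℝ} (hC : IsClosed C)
    (h : ∀ s ∈ Ioo c d, Θ s d ∈ C) : θm d ∈ C :=
  hC.mem_of_tendsto (H.tendsto_left d) (by
    filter_upwards [Ioo_mem_nhdsLT hcd] with t ht using h t ht)

theorem le_jump (c : ℝ) : θm c ≤ θp c := by
  rcases H.jump c with h | h <;> linarith [Real.pi_pos]

theorem exists_lowest : ∃ x, ∀ t, (g x).im ≤ (g t).im := by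
  have hL := H.length_pos
  obtain ⟨x, -, hx⟩ := (isCompact_Icc (a := (0 : ℝ)) (b := L)).exists_isMinOn
    (nonempty_Icc.2 hL.le) (f := fun t => (g t).im)
    (Complex.continuous_im.comp H.continuous).continuousOn
  refine ⟨x, fun t => ?_⟩
  have hp : Function.Periodic g L := H.periodic
  obtain ⟨y, hy, e⟩ := hp.exists_mem_Ico₀ hL t
  rw [e]
  exact hx ⟨hy.1, hy.2.le⟩

/-- Hopf's theorem on turning tangents: the curve turns once around. -/
theorem antipodal {s t : ℝ} (h1 : s < t) (h2 : t < s + L) : Θ t (s + L) = Θ s t + Real.pi := by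
  have hL := H.length_pos
  have hpi := Real.pi_pos
  obtain ⟨n, hn⟩ := H.exists_antipodal
  obtain ⟨x, hx⟩ := H.exists_lowest
  obtain ⟨k, hk⟩ := H.right_up (c := x) (S := Ioo x (x + L)) subset_rfl isPreconnected_Ioo
    fun t _ => hx t
  have e1 := H.right_mem (c := x) (d := x + L) (by linarith) isClosed_Icc hk
  have e2 : θm (x + L) ∈ Icc (2 * Real.pi * k + (Real.pi + 2 * Real.pi * n))
      (2 * Real.pi * k + Real.pi + (Real.pi + 2 * Real.pi * n)) := by
    refine H.left_mem (c := x) (by linarith) isClosed_Icc fun t ht => ?_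
    rw [hn x t ht.1 ht.2]
    exact ⟨by linarith [(hk t ht).1], by linarith [(hk t ht).2]⟩
  -- Two applications of the antipodal relation shift both parameters by a whole period.
  have e3 : θm (x + L) = θm x + 2 * (Real.pi + 2 * Real.pi * n) := by
    have t1 : Tendsto (fun s => Θ (s + L) (x + L)) (𝓝[<] x) (𝓝 (θm (x + L))) := by
      refine (H.tendsto_left (x + L)).comp (tendsto_nhdsWithin_iff.2 ⟨?_, ?_⟩)
      · exact ((continuous_id.add continuous_const).tendsto x).mono_left nhdsWithin_le_nhds
      · filter_upwards [self_mem_nhdsWithin] with s hs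
        simpa using hs
    have t2 : Tendsto (fun s => Θ (s + L) (x + L)) (𝓝[<] x)
        (𝓝 (θm x + 2 * (Real.pi + 2 * Real.pi * n))) := by
      refine ((H.tendsto_left x).add_const _).congr' ?_
      filter_upwards [Ioo_mem_nhdsLT (show x - L < x by linarith)] with s hs
      rw [hn x (s + L) (by linarith [hs.1]) (by linarith [hs.2]),
        hn s x hs.2 (by linarith [hs.1])]
      ring
    exact tendsto_nhds_unique t1 t2
  have e4 := H.turning x (x + L) (by linarith) le_rfl
  -- The turning bound excludes `n ≤ -1`, that is, a clockwise curve. For `n ≥ 1` the turn in `e3`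
  -- would be larger than the half turns `e1` and `e2` at the lowest point allow.
  have hn0 : n = 0 := by
    have a1 : -1 < n := by
      have : (-1 : ℝ) < n := by
        rcases H.jump x with h | h <;> nlinarith
      exact_mod_cast this
    have a2 : n < 1 := by
      have : (n : ℝ) < 1 := by
        rcases H.jump x with h | h <;> nlinarith [e1.1, e1.2, e2.1, e2.2]
      exact_mod_cast this
    omega
  rw [hn s t h1 h2, hn0]
  simp

theorem shift {s t : ℝ} (h1 : s < t) (h2 : t < s + L) :
    Θ (s + L) (t + L) = Θ s t + 2 * Real.pi := by
  rw [H.antipodal h2 (by linarith), H.antipodal h1 h2]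
  ring

theorem left_shift (x : ℝ) : θm (x + L) = θm x + 2 * Real.pi := by
  have hL := H.length_pos
  have t1 : Tendsto (fun s => Θ (s + L) (x + L)) (𝓝[<] x) (𝓝 (θm (x + L))) := by
    refine (H.tendsto_left (x + L)).comp (tendsto_nhdsWithin_iff.2 ⟨?_, ?_⟩)
    · exact ((continuous_id.add continuous_const).tendsto x).mono_left nhdsWithin_le_nhds
    · filter_upwards [self_mem_nhdsWithin] with s hs
      simpa using hs
  refine tendsto_nhds_unique t1 (((H.tendsto_left x).add_const _).congr' ?_)
  filter_upwards [Ioo_mem_nhdsLT (show x - L < x by linarith)] with s hs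
  rw [H.shift hs.2 (by linarith [hs.1])]

theorem right_shift (x : ℝ) : θp (x + L) = θp x + 2 * Real.pi := by
  have hL := H.length_pos
  have t1 : Tendsto (fun s => Θ (x + L) (s + L)) (𝓝[>] x) (𝓝 (θp (x + L))) := by
    refine (H.tendsto_right (x + L)).comp (tendsto_nhdsWithin_iff.2 ⟨?_, ?_⟩)
    · exact ((continuous_id.add continuous_const).tendsto x).mono_left nhdsWithin_le_nhds
    · filter_upwards [self_mem_nhdsWithin] with s hs
      simpa using hs
  refine tendsto_nhds_unique t1 (((H.tendsto_right x).add_const _).congr' ?_)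
  filter_upwards [Ioo_mem_nhdsGT (show x < x + L by linarith)] with s hs
  rw [H.shift hs.1 hs.2]

theorem arg_eq_of_re_pos {s t : ℝ} (h1 : s < t) (h2 : t < s + L) (hi : (g s).im = (g t).im)
    (hr : (g s).re < (g t).re) {k : ℤ}
    (h : Θ s t ∈ Ioo (2 * Real.pi * k - 2 * Real.pi) (2 * Real.pi * k + 2 * Real.pi)) :
    Θ s t = 2 * Real.pi * k :=
  eq_of_sin_eq_zero_of_cos_pos
    ((H.isArg s t h1 h2).sin_eq_zero (H.ne_zero h1 h2) (by rw [Complex.sub_im]; linarith))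
    ((H.isArg s t h1 h2).cos_pos (by rw [Complex.sub_re]; linarith)) h

theorem arg_eq_of_re_neg {s t : ℝ} (h1 : s < t) (h2 : t < s + L) (hi : (g s).im = (g t).im)
    (hr : (g t).re < (g s).re) {k : ℤ}
    (h : Θ s t ∈ Ioo (2 * Real.pi * k - Real.pi) (2 * Real.pi * k + 3 * Real.pi)) :
    Θ s t = 2 * Real.pi * k + Real.pi :=
  eq_of_sin_eq_zero_of_cos_neg
    ((H.isArg s t h1 h2).sin_eq_zero (H.ne_zero h1 h2) (by rw [Complex.sub_im]; linarith))
    ((H.isArg s t h1 h2).cos_neg (by rw [Complex.sub_re]; linarith)) h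

/-- Two disjoint arcs in the closed upper half-plane have no interlaced endpoints. -/
theorem not_interlaced {e q s₁ s₂ : ℝ} (heq : e < q) (hs : uIcc s₁ s₂ ⊆ Ioo q (e + L))
    (hup : ∀ t ∈ Icc e q, 0 ≤ (g t).im) (hup' : ∀ s ∈ uIcc s₁ s₂, 0 ≤ (g s).im)
    (he : (g e).im = 0) (hq : (g q).im = 0) (h₁ : (g s₁).im = 0) (h₂ : (g s₂).im = 0)
    (hq1 : (g q).re < (g s₁).re) (h1e : (g s₁).re < (g e).re) (h2q : (g s₂).re < (g q).re) :
    False := by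
  have hpi := Real.pi_pos
  have m₁ : s₁ ∈ uIcc s₁ s₂ := left_mem_uIcc
  have m₂ : s₂ ∈ uIcc s₁ s₂ := right_mem_uIcc
  have me : e ∈ Icc e q := ⟨le_rfl, heq.le⟩
  have mq : q ∈ Icc e q := ⟨heq.le, le_rfl⟩
  have b₁ := hs m₁
  have b₂ := hs m₂
  obtain ⟨k, hk⟩ := H.left_down (c := s₁) (S := Icc e q)
    (fun t ht => ⟨by linarith [ht.1, b₁.2], by linarith [ht.2, b₁.1]⟩) isPreconnected_Icc
    (fun t ht => by rw [h₁]; exact hup t ht)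
  obtain ⟨j, hj⟩ := H.left_down (c := s₂) (S := Icc e q)
    (fun t ht => ⟨by linarith [ht.1, b₂.2], by linarith [ht.2, b₂.1]⟩) isPreconnected_Icc
    (fun t ht => by rw [h₂]; exact hup t ht)
  obtain ⟨i, hi⟩ := H.right_up (c := e) (S := uIcc s₁ s₂)
    (fun t ht => ⟨by linarith [(hs ht).1], (hs ht).2⟩) isPreconnected_uIcc
    (fun t ht => by rw [he]; exact hup' t ht)
  obtain ⟨l, hl⟩ := H.right_up (c := q) (S := uIcc s₁ s₂)
    (fun t ht => ⟨(hs ht).1, by linarith [(hs ht).2]⟩) isPreconnected_uIcc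
    (fun t ht => by rw [hq]; exact hup' t ht)
  -- The four secants are horizontal, and each is evaluated from both of its ends. The results are
  -- `Θ q s₁ = Θ e s₁ + π` and `Θ q s₂ = Θ e s₂` from `v1` to `v4`, and `Θ e s₁ = Θ e s₂` and `Θ q
  -- s₂ = Θ q s₁ + π` from `v5` to `v8`. Going around this square gives `2π = 0`.
  have v1 := H.arg_eq_of_re_neg (k := k - 1) (by linarith [b₁.1] : e < s₁) b₁.2 (by rw [he, h₁]) h1e
    (by push_cast; constructor <;> linarith [(hk e me).1, (hk e me).2])
  have v2 := H.arg_eq_of_re_pos (k := k) b₁.1 (by linarith [b₁.2]) (by rw [hq, h₁]) hq1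
    (by constructor <;> linarith [(hk q mq).1, (hk q mq).2])
  have v3 := H.arg_eq_of_re_neg (k := j - 1) (by linarith [b₂.1] : e < s₂) b₂.2 (by rw [he, h₂])
    (by linarith) (by push_cast; constructor <;> linarith [(hj e me).1, (hj e me).2])
  have v4 := H.arg_eq_of_re_neg (k := j - 1) b₂.1 (by linarith [b₂.2]) (by rw [hq, h₂]) h2q
    (by push_cast; constructor <;> linarith [(hj q mq).1, (hj q mq).2])
  have v5 := H.arg_eq_of_re_neg (k := i) (by linarith [b₁.1] : e < s₁) b₁.2 (by rw [he, h₁]) h1e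
    (by constructor <;> linarith [(hi s₁ m₁).1, (hi s₁ m₁).2])
  have v6 := H.arg_eq_of_re_neg (k := i) (by linarith [b₂.1] : e < s₂) b₂.2 (by rw [he, h₂])
    (by linarith) (by constructor <;> linarith [(hi s₂ m₂).1, (hi s₂ m₂).2])
  have v7 := H.arg_eq_of_re_pos (k := l) b₁.1 (by linarith [b₁.2]) (by rw [hq, h₁]) hq1
    (by constructor <;> linarith [(hl s₁ m₁).1, (hl s₁ m₁).2])
  have v8 := H.arg_eq_of_re_neg (k := l) b₂.1 (by linarith [b₂.2]) (by rw [hq, h₂]) h2q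
    (by constructor <;> linarith [(hl s₂ m₂).1, (hl s₂ m₂).2])
  push_cast at v1 v3 v4
  nlinarith

end TurningLoop

/-! ### The complementary arc stays out of the cap -/

namespace TurningLoop

variable {g : ℝ → ℂ} {L : ℝ} {Θ : ℝ → ℝ → ℝ} {θm θp : ℝ → ℝ} (H : TurningLoop g L Θ θm θp)
include H

/-- Suppose that a path starts and ends on the real axis to the right of `(-ℓ, 0)`, crosses the real
axis in between only inside `(-ℓ, 0)`, and dips below it. If it does not turn right by `π`, then it
starts with an angle that is too large. -/
theorem lowest_point {a b : ℝ} (hab : a < b) (hbL : b < a + L)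
    (ha : (g a).im = 0) (hb : (g b).im = 0) (ha0 : 0 ≤ (g a).re) (hb0 : 0 < (g b).re)
    (hcross : ∀ t ∈ Ioo a b, (g t).im = 0 → (g t).re < 0)
    (hdip : ∃ s ∈ Ioo a b, (g s).im < 0) (hendb : ∀ᶠ t in 𝓝[<] b, 0 < (g t).im) :
    ∃ m ∈ Ioo a b, ∃ k : ℤ, 2 * Real.pi * k ≤ θp m ∧ θp a ≤ 2 * Real.pi * k ∧
      ((∀ᶠ t in 𝓝[>] a, 0 < (g t).im) → θp a ≤ 2 * Real.pi * k - Real.pi) := by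
  have hpi := Real.pi_pos
  have hL := H.length_pos
  obtain ⟨s₀, hs₀, hs₀'⟩ := hdip
  obtain ⟨m, hm, hmin⟩ := (isCompact_Icc (a := a) (b := b)).exists_isMinOn
    (nonempty_Icc.2 hab.le) (f := fun t => (g t).im)
    (Complex.continuous_im.comp H.continuous).continuousOn
  have hmin' : ∀ t ∈ Icc a b, (g m).im ≤ (g t).im := fun t ht => hmin ht
  have hmneg : (g m).im < 0 := (hmin' s₀ ⟨hs₀.1.le, hs₀.2.le⟩).trans_lt hs₀'
  have ham : a < m := lt_of_le_of_ne hm.1 fun e => by rw [← e, ha] at hmneg; exact hmneg.false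
  have hmb : m < b := lt_of_le_of_ne hm.2 fun e => by rw [e, hb] at hmneg; exact hmneg.false
  -- angles seen from the lowest point
  obtain ⟨k, hk⟩ := H.right_up (c := m) (S := Ioc m b)
    (fun t ht => ⟨ht.1, by linarith [ht.2]⟩) isPreconnected_Ioc
    (fun t ht => hmin' t ⟨ham.le.trans ht.1.le, ht.2⟩)
  obtain ⟨j, hj⟩ := H.left_down (c := m) (S := Ico a m)
    (fun t ht => ⟨by linarith [ht.1], ht.2⟩) isPreconnected_Ico
    (fun t ht => hmin' t ⟨ht.1, ht.2.le.trans hmb.le⟩)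
  have hpm : θp m ∈ Icc (2 * Real.pi * k) (2 * Real.pi * k + Real.pi) :=
    H.right_mem hmb isClosed_Icc fun t ht => hk t ⟨ht.1, ht.2.le⟩
  have hmm : θm m ∈ Icc (2 * Real.pi * j - Real.pi) (2 * Real.pi * j) :=
    H.left_mem ham isClosed_Icc fun t ht => hj t ⟨ht.1.le, ht.2⟩
  -- the angle at which the path arrives at its end
  have hmbne : Real.sin (Θ m b) ≠ 0 := fun e => by
    have := (H.isArg m b hmb (by linarith)).im_eq_zero e
    rw [Complex.sub_im, hb] at this
    linarith
  have hmb1 := mem_Ioo_of_mem_Icc_of_sin_ne_zero (c := 0) (k := k) hmbne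
    (by simpa using hk b ⟨hmb, le_rfl⟩) Real.sin_zero
  -- All crossings of the axis are to the left of `g b`, so a secant arriving at `b` never points in
  -- the negative real direction.
  have hb1 : ∀ s ∈ Ico m b, Θ s b ∈ Ioo (2 * Real.pi * k - Real.pi) (2 * Real.pi * k + Real.pi) := by
    intro s hs
    have hS : Ico m b ⊆ Ioo (b - L) b := fun t ht => ⟨by linarith [ht.1], ht.2⟩
    refine mem_Ioo_of_cos_pos (S := Ico m b) (φ := fun s => Θ s b) isPreconnected_Ico
      (H.continuousOn_left hS) (fun x hx e => ?_) (x₀ := m) ⟨le_rfl, hmb⟩ ?_ hs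
    · have h1 := (H.left_arg hS hx).1
      have h2 := h1.im_eq_zero e
      rw [Complex.sub_im, hb] at h2
      refine h1.cos_pos ?_
      have := hcross x ⟨ham.trans_le hx.1, hx.2⟩ (by linarith)
      rw [Complex.sub_re]
      linarith
    · simp only [add_zero] at hmb1
      exact ⟨by linarith [hmb1.1], by linarith [hmb1.2]⟩
  -- The path reaches `b` from above, so the last secants point downwards; on the branch fixed by
  -- `hb1` this means a negative angle relative to `2πk`.
  have hmb' : θm b ≤ 2 * Real.pi * k := by
    refine le_of_tendsto (H.tendsto_left b) ?_
    filter_upwards [hendb, Ioo_mem_nhdsLT hmb] with s hs1 hs2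
    by_contra hlt
    have h1 := hb1 s ⟨hs2.1.le, hs2.2⟩
    have h2 := Real.sin_pos_of_pos_of_lt_pi (x := Θ s b - 2 * Real.pi * k) (by linarith)
      (by linarith [h1.2])
    have h3 : Real.sin (Θ s b) = Real.sin (Θ s b - 2 * Real.pi * k) := by
      rw [← sin_two_pi_int_add k (Θ s b - 2 * Real.pi * k)]; congr 1; ring
    have hne := H.ne_zero hs2.2 (by linarith [hs2.1] : b < s + L)
    have h4 := (H.isArg s b hs2.2 (by linarith [hs2.1])).im
    rw [Complex.sub_im, hb, h3] at h4
    have : 0 < ‖g b - g s‖ := norm_pos_iff.2 hne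
    nlinarith
  -- The turning bound from `m` to `b` excludes leaving the lowest point horizontally to the left.
  -- This is what forces the branches before and after `m` to agree in `hjk`.
  have hlt : θp m < 2 * Real.pi * k + Real.pi := by
    have := H.turning m b hmb (by linarith)
    linarith
  have hjk : j = k := by
    have h1 : (j : ℝ) < k + 1 := by
      rcases H.jump m with h | h <;> nlinarith [hpm.1, hmm.1, hmm.2]
    have h2 : (k : ℝ) < j + 1 := by
      rcases H.jump m with h | h <;> nlinarith [hpm.1, hmm.1, hmm.2]
    have h3 : j < k + 1 := by exact_mod_cast h1
    have h4 : k < j + 1 := by exact_mod_cast h2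
    omega
  subst hjk
  -- the angle at which the path starts
  have hamne : Real.sin (Θ a m) ≠ 0 := fun e => by
    have := (H.isArg a m ham (by linarith)).im_eq_zero e
    rw [Complex.sub_im, ha] at this
    linarith
  have ham1 := mem_Ioo_of_mem_Icc_of_sin_ne_zero (c := -Real.pi) (k := j) hamne
    (by
      have := hj a ⟨le_rfl, ham⟩
      exact ⟨by linarith [this.1], by linarith [this.2]⟩) (by simp)
  -- All crossings are to the left of `g a`, so a secant starting at `a` never points in the
  -- positive real direction.
  have ha1 : ∀ t ∈ Ioc a m, Θ a t ∈ Ioo (2 * Real.pi * j - 2 * Real.pi) (2 * Real.pi * j) := by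
    intro t ht
    have hS : Ioc a m ⊆ Ioo a (a + L) := fun t ht => ⟨ht.1, by linarith [ht.2]⟩
    refine mem_Ioo_of_cos_neg (S := Ioc a m) (φ := fun s => Θ a s) isPreconnected_Ioc
      (H.continuousOn_right hS) (fun x hx e => ?_) (x₀ := m) ⟨ham, le_rfl⟩ ?_ ht
    · have h1 := H.isArg a x (hS hx).1 (hS hx).2
      have h2 := h1.im_eq_zero e
      rw [Complex.sub_im, ha] at h2
      refine h1.cos_neg ?_
      have := hcross x ⟨hx.1, hx.2.trans_lt hmb⟩ (by linarith)
      rw [Complex.sub_re]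
      linarith
    · exact ⟨by linarith [ham1.1], by linarith [ham1.2]⟩
  refine ⟨m, ⟨ham, hmb⟩, j, hpm.1, ?_, fun hup => ?_⟩
  · refine le_of_tendsto (H.tendsto_right a) ?_
    filter_upwards [Ioo_mem_nhdsGT ham] with t ht using (ha1 t ⟨ht.1, ht.2.le⟩).2.le
  · refine le_of_tendsto (H.tendsto_right a) ?_
    filter_upwards [hup, Ioo_mem_nhdsGT ham] with t ht1 ht
    by_contra hlt
    have h1 := ha1 t ⟨ht.1, ht.2.le⟩
    have h2 := Real.sin_neg_of_neg_of_neg_pi_lt (x := Θ a t - 2 * Real.pi * j) (by linarith [h1.2])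
      (by linarith)
    have h3 : Real.sin (Θ a t) = Real.sin (Θ a t - 2 * Real.pi * j) := by
      rw [← sin_two_pi_int_add j (Θ a t - 2 * Real.pi * j)]; congr 1; ring
    have hne := H.ne_zero ht.1 (by linarith [ht.2] : t < a + L)
    have h4 := (H.isArg a t ht.1 (by linarith [ht.2])).im
    rw [Complex.sub_im, ha, h3] at h4
    have : 0 < ‖g t - g a‖ := norm_pos_iff.2 hne
    nlinarith

/-- The complementary arc of a curve does not enter the convex cap `K` below the segment `(-ℓ, 0)`,
if the other arc returns to `-ℓ` from the right of the cap through the upper half-plane. -/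
theorem not_mem_cap {e q A ℓ : ℝ} (heq : e < q) (hqA : q < A)
    (gA : g A = 0) (gq : g q = -ℓ) (he : (g e).im = 0) (he0 : 0 < (g e).re)
    (hup : ∀ t ∈ Icc e q, 0 ≤ (g t).im) {K : Set ℂ} (hKo : IsOpen K)
    (hKim : ∀ z ∈ K, z.im < 0)
    (hchord : ∀ z : ℂ, z.im = 0 → -ℓ < z.re → z.re < 0 → z ∈ closure K)
    (hO : IsOpen (K ∪ {z : ℂ | z.im = 0 ∧ -ℓ < z.re ∧ z.re < 0} ∪ {z : ℂ | 0 < z.im}))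
    (hcl : ∀ z ∈ closure K, z.im = 0 → -ℓ ≤ z.re ∧ z.re ≤ 0)
    (hfr : ∀ t ∈ Ioo A (e + L), (g t).im < 0 → g t ∈ closure K → g t ∈ K)
    (hA : 0 < θm A) (hT : θm (e + L) < Real.pi) {s₀ : ℝ} (hs₀ : s₀ ∈ Ioo A (e + L)) :
    g s₀ ∉ K := by
  intro hs₀K
  have hpi := Real.pi_pos
  have hL := H.length_pos
  have hgc := H.continuous
  have hgi : Continuous fun t => (g t).im := Complex.continuous_im.comp hgc
  have hgr : Continuous fun t => (g t).re := Complex.continuous_re.comp hgc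
  have hs₀i := hKim _ hs₀K
  have geL : g (e + L) = g e := H.periodic e
  have hclim : ∀ z ∈ closure K, z.im ≤ 0 := fun z hz =>
    closure_minimal (fun w hw => (hKim w hw).le)
      (isClosed_le Complex.continuous_im continuous_const) hz
  -- `P` collects the parameters on the axis outside the open chord; `a` and `b` are the ones next
  -- to `s₀` on either side. Between them the axis is crossed only through the chord.
  set P : Set ℝ := {t | (g t).im = 0 ∧ ((g t).re ≤ -ℓ ∨ 0 ≤ (g t).re)} with hP
  have hPc : IsClosed P := (isClosed_eq hgi continuous_const).inter
    ((isClosed_le hgr continuous_const).union (isClosed_le continuous_const hgr))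
  obtain ⟨a, ⟨ha1, ha2⟩, hamax⟩ := (isCompact_Icc.inter_right hPc :
    IsCompact (Icc A s₀ ∩ P)).exists_isGreatest ⟨A, ⟨le_rfl, hs₀.1.le⟩, by simp [hP, gA]⟩
  obtain ⟨b, ⟨hb1, hb2⟩, hbmin⟩ := (isCompact_Icc.inter_right hPc :
    IsCompact (Icc s₀ (e + L) ∩ P)).exists_isLeast
    ⟨e + L, ⟨hs₀.2.le, le_rfl⟩, by rw [hP]; exact ⟨by rw [geL, he], Or.inr (by rw [geL]; exact he0.le)⟩⟩
  have has₀ : a < s₀ := lt_of_le_of_ne ha1.2 fun h => by rw [← h, ha2.1] at hs₀i; exact hs₀i.false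
  have hs₀b : s₀ < b := lt_of_le_of_ne hb1.1 fun h => by rw [h, hb2.1] at hs₀i; exact hs₀i.false
  have hcross : ∀ t ∈ Ioo a b, (g t).im = 0 → -ℓ < (g t).re ∧ (g t).re < 0 := by
    intro t ht h0
    by_contra hcon
    have htP : t ∈ P := ⟨h0, by
      rw [not_and_or, not_lt, not_lt] at hcon; exact hcon⟩
    rcases le_total t s₀ with h | h
    · exact (hamax ⟨⟨ha1.1.trans ht.1.le, h⟩, htP⟩).not_gt ht.1
    · exact (hbmin ⟨⟨h, ht.2.le.trans hb1.2⟩, htP⟩).not_gt ht.2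
  -- The path is in the cap at `s₀` and cannot leave through the inner arc by injectivity (`hfr`).
  -- So it stays in the open set made of the cap, the open chord and the upper half-plane.
  have hinO : ∀ t ∈ Ioo a b,
      g t ∈ K ∪ {z : ℂ | z.im = 0 ∧ -ℓ < z.re ∧ z.re < 0} ∪ {z : ℂ | 0 < z.im} := by
    have hsub := (isPreconnected_Ioo (a := a) (b := b)).subset_left_of_subset_union
      (hO.preimage hgc)
      (((isOpen_lt Complex.continuous_im continuous_const).inter
        isClosed_closure.isOpen_compl : IsOpen ({z : ℂ | z.im < 0} ∩ (closure K)ᶜ)).preimage hgc)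
      (by
        rw [Set.disjoint_left]
        rintro t ((h | h) | h) ⟨h1, h2⟩
        · exact h2 (subset_closure h)
        · exact absurd h.1 (ne_of_lt h1)
        · exact lt_asymm (show 0 < (g t).im from h) h1)
      (by
        intro t ht
        rcases lt_trichotomy (g t).im 0 with h | h | h
        · by_cases hc : g t ∈ closure K
          · exact Or.inl (Or.inl (Or.inl (hfr t
              ⟨ha1.1.trans_lt ht.1, ht.2.trans_le hb1.2⟩ h hc)))
          · exact mem_union_right _ (show (g t).im < 0 ∧ g t ∉ closure K from ⟨h, hc⟩)
        · exact Or.inl (Or.inl (Or.inr ⟨h, hcross t ht h⟩))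
        · exact Or.inl (Or.inr h))
      ⟨s₀, (show s₀ ∈ Ioo a b from ⟨has₀, hs₀b⟩), Or.inl (Or.inl hs₀K)⟩
    exact fun t ht => hsub ht
  have hne : ∀ t, A < t → t ≤ e + L → g t ≠ -ℓ ∧ g t ≠ 0 := by
    intro t h1 h2
    refine ⟨fun h => H.injective q t (hqA.trans h1) (by linarith) (by rw [gq, h]),
      fun h => H.injective A t h1 (by linarith) (by rw [gA, h])⟩
  have hnot : ∀ t, A < t → t ≤ e + L → t ∈ P → g t ∉ closure K := by
    intro t h1 h2 hP h3
    have h4 := hcl _ h3 hP.1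
    have h5 := hne t h1 h2
    rcases hP.2 with h | h
    · exact h5.1 (Complex.ext (by simpa using le_antisymm h h4.1) (by simpa using hP.1))
    · exact h5.2 (Complex.ext (by simpa using le_antisymm h4.2 h) (by simpa using hP.1))
  have hout : ∀ t ∈ Ioo a b, g t ∉ closure K → 0 < (g t).im := by
    intro t ht hc
    rcases hinO t ht with (h | h) | h
    · exact absurd (subset_closure h) hc
    · exact absurd (hchord _ h.1 h.2.1 h.2.2) hc
    · exact h
  have hon : ∀ t ∈ Ioo a b, g t ∈ closure K → g t ∉ K → (g t).im = 0 := by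
    intro t ht hc hK
    rcases hinO t ht with (h | h) | h
    · exact absurd h hK
    · exact h.1
    · exact absurd (hclim _ hc) (not_le.2 h)
  -- the last point of the closed cap
  have hy : ∃ y ∈ Ioo a b, (g y).im = 0 ∧ ∀ t ∈ Ioo y b, 0 < (g t).im := by
    obtain ⟨y, ⟨hy1, hy2⟩, hymax⟩ := (isCompact_Icc.inter_right
      (isClosed_closure.preimage hgc) : IsCompact (Icc s₀ b ∩ g ⁻¹' closure K)).exists_isGreatest
      ⟨s₀, ⟨le_rfl, hs₀b.le⟩, subset_closure hs₀K⟩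
    have hyb : y < b := lt_of_le_of_ne hy1.2 fun h =>
      hnot b (hs₀.1.trans hs₀b) hb1.2 hb2 (h ▸ hy2)
    have hyab : y ∈ Ioo a b := ⟨has₀.trans_le hy1.1, hyb⟩
    refine ⟨y, hyab, hon y hyab hy2 fun hK => ?_, fun t ht => ?_⟩
    · have h1 : ∀ᶠ t in 𝓝[>] y, g t ∈ K :=
        (hgc.tendsto y).mono_left nhdsWithin_le_nhds (hKo.mem_nhds hK)
      obtain ⟨t, ht, htK⟩ := (Filter.Eventually.and (Ioo_mem_nhdsGT hyb) h1).exists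
      exact (hymax ⟨⟨hy1.1.trans ht.1.le, ht.2.le⟩, subset_closure htK⟩).not_gt ht.1
    · exact hout t ⟨hyab.1.trans ht.1, ht.2⟩ fun h =>
        (hymax ⟨⟨hy1.1.trans ht.1.le, ht.2.le⟩, h⟩).not_gt ht.1
  have hy' : A < a → ∃ y ∈ Ioo a b, (g y).im = 0 ∧ ∀ t ∈ Ioo a y, 0 < (g t).im := by
    intro hAa
    obtain ⟨y, ⟨hy1, hy2⟩, hymin⟩ := (isCompact_Icc.inter_right
      (isClosed_closure.preimage hgc) : IsCompact (Icc a s₀ ∩ g ⁻¹' closure K)).exists_isLeast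
      ⟨s₀, ⟨has₀.le, le_rfl⟩, subset_closure hs₀K⟩
    have hay : a < y := lt_of_le_of_ne hy1.1 fun h =>
      hnot a hAa (by linarith [hs₀.2]) ha2 (h ▸ hy2)
    have hyab : y ∈ Ioo a b := ⟨hay, hy1.2.trans_lt hs₀b⟩
    refine ⟨y, hyab, hon y hyab hy2 fun hK => ?_, fun t ht => ?_⟩
    · have h1 : ∀ᶠ t in 𝓝[<] y, g t ∈ K :=
        (hgc.tendsto y).mono_left nhdsWithin_le_nhds (hKo.mem_nhds hK)
      obtain ⟨t, ht, htK⟩ := (Filter.Eventually.and (Ioo_mem_nhdsLT hay) h1).exists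
      exact (hymin ⟨⟨ht.1.le, ht.2.le.trans hy1.2⟩, subset_closure htK⟩).not_gt ht.2
    · exact hout t ⟨ht.1, ht.2.trans hyab.2⟩ fun h =>
        (hymin ⟨⟨ht.1.le, ht.2.le.trans hy1.2⟩, h⟩).not_gt ht.2
  obtain ⟨y, hyab, hy0, hyup⟩ := hy
  have gqr : (g q).re = -ℓ := by simp [gq]
  have gqi : (g q).im = 0 := by simp [gq]
  -- If `g b` were left of `-ℓ`, the path from `y` to `b` above the axis would have endpoints
  -- interlaced with those of the arc from `e` to `q`.
  have hb0 : 0 < (g b).re := by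
    have hAb : A < b := hs₀.1.trans hs₀b
    rcases hb2.2 with h | h
    · exfalso
      have hbe : b < e + L := lt_of_le_of_ne hb1.2 fun h' => by
        rw [h', geL] at h
        have := hcross y hyab hy0
        linarith
      have hc := hcross y hyab hy0
      have hlt : (g b).re < -ℓ := lt_of_le_of_ne h fun h' =>
        (hne b hAb hb1.2).1 (Complex.ext (by simpa using h') (by simpa using hb2.1))
      refine H.not_interlaced (s₁ := y) (s₂ := b) heq ?_ hup ?_ he gqi hy0 hb2.1
        (by rw [gqr]; exact hc.1) (by linarith [hc.2]) (by rw [gqr]; exact hlt)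
      · rw [uIcc_of_le hyab.2.le]
        exact fun t ht => ⟨by linarith [ht.1, hyab.1, ha1.1], ht.2.trans_lt hbe⟩
      · rw [uIcc_of_le hyab.2.le]
        intro t ht
        rcases ht.1.eq_or_lt with rfl | h1
        · exact hy0.ge
        rcases ht.2.eq_or_lt with rfl | h2
        · exact hb2.1.ge
        exact (hyup t ⟨h1, h2⟩).le
    · exact lt_of_le_of_ne h fun h' => (hne b hAb hb1.2).2
        (Complex.ext (by simpa using h'.symm) (by simpa using hb2.1))
  have ha0 : 0 ≤ (g a).re := by
    rcases ha1.1.eq_or_lt with rfl | hAa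
    · simp [gA]
    rcases ha2.2 with h | h
    · exfalso
      obtain ⟨x, hxab, hx0, hxup⟩ := hy' hAa
      have hc := hcross x hxab hx0
      have hlt : (g a).re < -ℓ := lt_of_le_of_ne h fun h' =>
        (hne a hAa (by linarith [hs₀.2])).1
          (Complex.ext (by simpa using h') (by simpa using ha2.1))
      refine H.not_interlaced (s₁ := x) (s₂ := a) heq ?_ hup ?_ he gqi hx0 ha2.1
        (by rw [gqr]; exact hc.1) (by linarith [hc.2]) (by rw [gqr]; exact hlt)
      · rw [uIcc_of_ge hxab.1.le]
        exact fun t ht => ⟨by linarith [ht.1], by linarith [ht.2, hxab.2, hb1.2]⟩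
      · rw [uIcc_of_ge hxab.1.le]
        intro t ht
        rcases ht.1.eq_or_lt with rfl | h1
        · exact ha2.1.ge
        rcases ht.2.eq_or_lt with rfl | h2
        · exact hx0.ge
        exact (hxup t ⟨h1, h2⟩).le
    · exact h
  obtain ⟨m, hm, k, hk1, hk2, hk3⟩ := H.lowest_point (has₀.trans hs₀b)
    (by linarith [ha1.1, hb1.2]) ha2.1 hb2.1 ha0 hb0 (fun t ht h => (hcross t ht h).2)
    ⟨s₀, ⟨has₀, hs₀b⟩, hs₀i⟩
    (by filter_upwards [Ioo_mem_nhdsLT hyab.2] with t ht using hyup t ht)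
  -- The angle at `A` is positive. If `a = A`, it is at most `2πk`. If `A < a`, the path leaves `a`
  -- upwards with angle at most `2πk - π`, and by the turning bound it has lost less than `π` since
  -- `A`.
  have hk : (0 : ℝ) < k := by
    rcases ha1.1.eq_or_lt with rfl | hAa
    · have := H.le_jump A
      have : 0 < 2 * Real.pi * k := by linarith
      exact pos_of_mul_pos_right this (by positivity)
    · obtain ⟨x, hxab, -, hxup⟩ := hy' hAa
      have h1 := hk3 (by filter_upwards [Ioo_mem_nhdsGT hxab.1] with t ht using hxup t ht)
      have h2 := H.turning A a hAa (by linarith [hs₀.2])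
      have := H.le_jump A
      have := H.le_jump a
      have : 0 < 2 * Real.pi * k := by linarith
      exact pos_of_mul_pos_right this (by positivity)
  have hk' : (1 : ℝ) ≤ k := by
    have : 0 < k := by exact_mod_cast hk
    exact_mod_cast this
  -- The angle at `m` is at least `2π` and the one at `e + L` is below `π`: a forbidden right turn.
  have := H.turning m (e + L) (hm.2.trans_le hb1.2) (by linarith [hm.1, ha1.1])
  nlinarith

end TurningLoop

/-! ### Offsets from oriented lines, and arcs with a tangent angle -/

/-- The signed offset of `z` to the left of the oriented line through `0` with angle `ψ`. -/
noncomputable def side (ψ : ℝ) (z : ℂ) : ℝ := z.im * Real.cos ψ - z.re * Real.sin ψ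

theorem side_add (ψ : ℝ) (z w : ℂ) : side ψ (z + w) = side ψ z + side ψ w := by
  simp only [side, Complex.add_im, Complex.add_re]; ring

theorem side_sub (ψ : ℝ) (z w : ℂ) : side ψ (z - w) = side ψ z - side ψ w := by
  simp only [side, Complex.sub_im, Complex.sub_re]; ring

theorem side_smul (ψ r : ℝ) (z : ℂ) : side ψ (r * z) = r * side ψ z := by
  simp only [side, Complex.mul_im, Complex.mul_re, Complex.ofReal_re, Complex.ofReal_im]; ring

theorem side_exp (ψ φ : ℝ) : side ψ (Complex.exp (φ * Complex.I)) = Real.sin (φ - ψ) := by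
  rw [side, Complex.exp_ofReal_mul_I_im, Complex.exp_ofReal_mul_I_re, Real.sin_sub]

theorem side_zero_left (z : ℂ) : side 0 z = z.im := by simp [side]

theorem side_add_pi (ψ : ℝ) (z : ℂ) : side (ψ + Real.pi) z = -side ψ z := by
  simp only [side, Real.cos_add_pi, Real.sin_add_pi]; ring

theorem continuous_side : Continuous fun x : ℝ × ℂ => side x.1 x.2 := by
  unfold side; fun_prop

theorem exists_eq_of_side_eq_zero {ψ : ℝ} {z : ℂ} (h : side ψ z = 0) :
    ∃ r : ℝ, z = r * Complex.exp (ψ * Complex.I) := by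
  unfold side at h
  have h1 := Real.sin_sq_add_cos_sq ψ
  refine ⟨z.re * Real.cos ψ + z.im * Real.sin ψ, Complex.ext ?_ ?_⟩
  · rw [Complex.re_ofReal_mul, Complex.exp_ofReal_mul_I_re]
    linear_combination z.re * (-h1) - Real.sin ψ * h
  · rw [Complex.im_ofReal_mul, Complex.exp_ofReal_mul_I_im]
    linear_combination z.im * (-h1) + Real.cos ψ * h

/-- On `[a, b]` the curve `g` has unit speed with continuous tangent angle `ϑ`. -/
structure HasAngle (g : ℝ → ℂ) (ϑ : ℝ → ℝ) (a b : ℝ) : Prop where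
  continuous : Continuous ϑ
  integral_eq : ∀ s ∈ Icc a b, ∀ t ∈ Icc a b,
    g t - g s = ∫ u in s..t, Complex.exp (ϑ u * Complex.I)

namespace HasAngle

variable {g : ℝ → ℂ} {ϑ : ℝ → ℝ} {a b : ℝ} (h : HasAngle g ϑ a b)
include h

theorem mono {c d : ℝ} (hac : a ≤ c) (hdb : d ≤ b) : HasAngle g ϑ c d :=
  ⟨h.continuous, fun s hs t ht => h.integral_eq s ⟨hac.trans hs.1, hs.2.trans hdb⟩ t
    ⟨hac.trans ht.1, ht.2.trans hdb⟩⟩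

theorem continuous_exp : Continuous fun u => Complex.exp (ϑ u * Complex.I) := by
  have := h.continuous
  fun_prop

theorem side_eq (ψ : ℝ) {s t : ℝ} (hs : s ∈ Icc a b) (ht : t ∈ Icc a b) :
    side ψ (g t - g s) = ∫ u in s..t, Real.sin (ϑ u - ψ) := by
  have hi : IntervalIntegrable (fun u => Complex.exp (ϑ u * Complex.I)) MeasureTheory.volume s t :=
    h.continuous_exp.intervalIntegrable s t
  have e1 : (g t - g s).im = ∫ u in s..t, Real.sin (ϑ u) := by
    rw [h.integral_eq s hs t ht]
    have := Complex.imCLM.intervalIntegral_comp_comm hi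
    simp only [Complex.imCLM_apply, Complex.exp_ofReal_mul_I_im] at this
    exact this.symm
  have e2 : (g t - g s).re = ∫ u in s..t, Real.cos (ϑ u) := by
    rw [h.integral_eq s hs t ht]
    have := Complex.reCLM.intervalIntegral_comp_comm hi
    simp only [Complex.reCLM_apply, Complex.exp_ofReal_mul_I_re] at this
    exact this.symm
  have hc := h.continuous
  rw [side, e1, e2, ← intervalIntegral.integral_mul_const, ← intervalIntegral.integral_mul_const,
    ← intervalIntegral.integral_sub (by apply Continuous.intervalIntegrable; fun_prop)
      (by apply Continuous.intervalIntegrable; fun_prop)]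
  simp only [Real.sin_sub]

theorem side_nonneg {ψ s t : ℝ} (hs : a ≤ s) (hst : s ≤ t) (ht : t ≤ b)
    (hn : ∀ u ∈ Icc s t, 0 ≤ Real.sin (ϑ u - ψ)) : 0 ≤ side ψ (g t - g s) := by
  rw [h.side_eq ψ ⟨hs, hst.trans ht⟩ ⟨hs.trans hst, ht⟩]
  exact intervalIntegral.integral_nonneg hst hn

theorem side_pos {ψ s t : ℝ} (hs : a ≤ s) (hst : s < t) (ht : t ≤ b)
    (hn : ∀ u ∈ Icc s t, 0 ≤ Real.sin (ϑ u - ψ)) (hp : ∃ u ∈ Icc s t, 0 < Real.sin (ϑ u - ψ)) :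
    0 < side ψ (g t - g s) := by
  rw [h.side_eq ψ ⟨hs, hst.le.trans ht⟩ ⟨hs.trans hst.le, ht⟩]
  have hc := h.continuous
  exact intervalIntegral.integral_pos hst (by fun_prop) (fun u hu => hn u ⟨hu.1.le, hu.2⟩) hp

theorem im_lt {s t : ℝ} (hs : a ≤ s) (hst : s < t) (ht : t ≤ b)
    (hn : ∀ u ∈ Icc s t, 0 ≤ Real.sin (ϑ u)) (hp : ∃ u ∈ Icc s t, 0 < Real.sin (ϑ u)) :
    (g s).im < (g t).im := by
  have := h.side_pos (ψ := 0) hs hst ht (by simpa using hn) (by simpa using hp)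
  rw [side_zero_left, Complex.sub_im] at this
  linarith

theorem side_neg {ψ s t : ℝ} (hs : a ≤ s) (hst : s < t) (ht : t ≤ b)
    (hn : ∀ u ∈ Icc s t, Real.sin (ϑ u - ψ) ≤ 0) (hp : ∃ u ∈ Icc s t, Real.sin (ϑ u - ψ) < 0) :
    side ψ (g t - g s) < 0 := by
  obtain ⟨u, hu, hu'⟩ := hp
  have := h.side_pos (ψ := ψ - Real.pi) hs hst ht
    (fun v hv => by
      have := hn v hv
      rw [show ϑ v - (ψ - Real.pi) = ϑ v - ψ + Real.pi by ring, Real.sin_add_pi]; linarith)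
    ⟨u, hu, by
      rw [show ϑ u - (ψ - Real.pi) = ϑ u - ψ + Real.pi by ring, Real.sin_add_pi]; linarith⟩
  have e := side_add_pi (ψ - Real.pi) (g t - g s)
  rw [sub_add_cancel] at e
  linarith

theorem im_gt {s t : ℝ} (hs : a ≤ s) (hst : s < t) (ht : t ≤ b)
    (hn : ∀ u ∈ Icc s t, Real.sin (ϑ u) ≤ 0) (hp : ∃ u ∈ Icc s t, Real.sin (ϑ u) < 0) :
    (g t).im < (g s).im := by
  have := h.side_neg (ψ := 0) hs hst ht (by simpa using hn) (by simpa using hp)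
  rw [side_zero_left, Complex.sub_im] at this
  linarith

theorem eq_add_of_const {s t φ : ℝ} (hs : s ∈ Icc a b) (ht : t ∈ Icc a b)
    (hc : ∀ u ∈ uIcc s t, ϑ u = φ) : g t = g s + (t - s : ℝ) * Complex.exp (φ * Complex.I) := by
  have e := h.integral_eq s hs t ht
  rw [intervalIntegral.integral_congr (g := fun _ => Complex.exp (φ * Complex.I))
    (fun u hu => by simp only [hc u hu]), intervalIntegral.integral_const] at e
  rw [← sub_eq_iff_eq_add', e, Complex.real_smul]

/-- The arc lies to the left of its tangents as long as it turns left by at most `π`. -/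
theorem tangent_nonneg (hm : MonotoneOn ϑ (Icc a b)) (hπ : ϑ b ≤ ϑ a + Real.pi) {s u : ℝ}
    (hs : s ∈ Icc a b) (hu : u ∈ Icc a b) : 0 ≤ side (ϑ u) (g s - g u) := by
  have ha : a ∈ Icc a b := ⟨le_rfl, hs.1.trans hs.2⟩
  have hb : b ∈ Icc a b := ⟨hs.1.trans hs.2, le_rfl⟩
  rcases le_total u s with hus | hsu
  · refine h.side_nonneg hu.1 hus hs.2 fun v hv => ?_
    have hv' : v ∈ Icc a b := ⟨hu.1.trans hv.1, hv.2.trans hs.2⟩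
    exact Real.sin_nonneg_of_nonneg_of_le_pi (by linarith [hm hu hv' hv.1])
      (by linarith [hm hv' hb hv'.2, hm ha hu hu.1])
  · have := h.side_nonneg (ψ := ϑ u + Real.pi) hs.1 hsu hu.2 fun v hv => by
      have hv' : v ∈ Icc a b := ⟨hs.1.trans hv.1, hv.2.trans hu.2⟩
      rw [← sub_sub, Real.sin_sub_pi, ← Real.sin_neg]
      exact Real.sin_nonneg_of_nonneg_of_le_pi (by linarith [hm hv' hu hv.2])
        (by linarith [hm hu hb hu.2, hm ha hv' hv'.1])
    rw [side_add_pi] at this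
    rw [side_sub] at this ⊢
    linarith

theorem tangent_pos (hm : MonotoneOn ϑ (Icc a b)) (hπ : ϑ b ≤ ϑ a + Real.pi) {s u : ℝ}
    (hs : s ∈ Icc a b) (hu : u ∈ Icc a b) (hne : ϑ s ≠ ϑ u) : 0 < side (ϑ u) (g s - g u) := by
  have ha : a ∈ Icc a b := ⟨le_rfl, hs.1.trans hs.2⟩
  have hb : b ∈ Icc a b := ⟨hs.1.trans hs.2, le_rfl⟩
  have hpi := Real.pi_pos
  rcases lt_trichotomy u s with hus | rfl | hsu
  · have hlt : ϑ u < ϑ s := lt_of_le_of_ne (hm hu hs hus.le) (Ne.symm hne)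
    refine h.side_pos hu.1 hus hs.2 (fun v hv => ?_) ?_
    · have hv' : v ∈ Icc a b := ⟨hu.1.trans hv.1, hv.2.trans hs.2⟩
      exact Real.sin_nonneg_of_nonneg_of_le_pi (by linarith [hm hu hv' hv.1])
        (by linarith [hm hv' hb hv'.2, hm ha hu hu.1])
    · obtain ⟨v, hv, e⟩ := intermediate_value_Icc hus.le h.continuous.continuousOn
        (show (ϑ u + ϑ s) / 2 ∈ Icc (ϑ u) (ϑ s) from ⟨by linarith, by linarith⟩)
      refine ⟨v, hv, Real.sin_pos_of_pos_of_lt_pi (by linarith) ?_⟩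
      linarith [hm ha hu hu.1, hm hs hb hs.2]
  · exact absurd rfl hne
  · have hlt : ϑ s < ϑ u := lt_of_le_of_ne (hm hs hu hsu.le) hne
    have := h.side_pos (ψ := ϑ u + Real.pi) hs.1 hsu hu.2 (fun v hv => by
      have hv' : v ∈ Icc a b := ⟨hs.1.trans hv.1, hv.2.trans hu.2⟩
      rw [← sub_sub, Real.sin_sub_pi, ← Real.sin_neg]
      exact Real.sin_nonneg_of_nonneg_of_le_pi (by linarith [hm hv' hu hv.2])
        (by linarith [hm hu hb hu.2, hm ha hv' hv'.1])) (by
      obtain ⟨v, hv, e⟩ := intermediate_value_Icc hsu.le h.continuous.continuousOn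
        (show (ϑ s + ϑ u) / 2 ∈ Icc (ϑ s) (ϑ u) from ⟨by linarith, by linarith⟩)
      refine ⟨v, hv, ?_⟩
      rw [← sub_sub, Real.sin_sub_pi, ← Real.sin_neg]
      exact Real.sin_pos_of_pos_of_lt_pi (by linarith) (by linarith [hm ha hs hs.1, hm hu hb hu.2]))
    rw [side_add_pi] at this
    rw [side_sub] at this ⊢
    linarith

/-- A point to the left of all tangents which lies on a tangent, ahead of its point of contact, is
on the arc or on the last tangent. -/
theorem eq_or_of_tangent_ahead (hm : MonotoneOn ϑ (Icc a b)) {z : ℂ} {s r : ℝ} (hs : s ∈ Icc a b)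
    (hr : 0 ≤ r) (hz : z = g s + r * Complex.exp (ϑ s * Complex.I))
    (hn : ∀ u ∈ Icc a b, 0 ≤ side (ϑ u) (z - g u)) :
    z ∈ g '' Icc a b ∨ ∃ r : ℝ, 0 < r ∧ z = g b + r * Complex.exp (ϑ b * Complex.I) := by
  have hpi := Real.pi_pos
  -- `c` is the end of the straight piece that starts at `s`. Either `z` lies on this piece, or `z`
  -- is ahead of `g c` at some distance `l > 0` on the same tangent.
  obtain ⟨c, ⟨hc1, hc2⟩, hcmax⟩ := (isCompact_Icc.inter_right
    (isClosed_eq h.continuous (continuous_const (y := ϑ s))) :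
    IsCompact (Icc s b ∩ {u | ϑ u = ϑ s})).exists_isGreatest ⟨s, ⟨le_rfl, hs.2⟩, rfl⟩
  have hc2 : ϑ c = ϑ s := hc2
  have hcab : c ∈ Icc a b := ⟨hs.1.trans hc1.1, hc1.2⟩
  have hconst : ∀ u ∈ Icc s c, ϑ u = ϑ s := fun u hu => by
    have hu' : u ∈ Icc a b := ⟨hs.1.trans hu.1, hu.2.trans hc1.2⟩
    exact le_antisymm ((hm hu' hcab hu.2).trans hc2.le) (hm hs hu' hu.1)
  have hgt : ∀ t ∈ Icc s c, g t = g s + (t - s : ℝ) * Complex.exp (ϑ s * Complex.I) := by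
    intro t ht
    refine h.eq_add_of_const hs ⟨hs.1.trans ht.1, ht.2.trans hc1.2⟩ fun u hu => ?_
    rw [uIcc_of_le ht.1] at hu
    exact hconst u ⟨hu.1, hu.2.trans ht.2⟩
  rcases le_or_gt r (c - s) with hrc | hrc
  · refine Or.inl ⟨s + r, ⟨by linarith [hs.1], by linarith [hc1.2]⟩, ?_⟩
    rw [hgt (s + r) ⟨by linarith, by linarith⟩, hz]
    simp
  have hz' : z = g c + (r - (c - s) : ℝ) * Complex.exp (ϑ c * Complex.I) := by
    rw [hgt c ⟨hc1.1, le_rfl⟩, hz, hc2]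
    push_cast
    ring
  rcases hc1.2.eq_or_lt with rfl | hcb
  · exact Or.inr ⟨r - (c - s), by linarith, hz'⟩
  exfalso
  set l := r - (c - s) with hl
  have hl0 : 0 < l := by linarith
  obtain ⟨u, ⟨hu1, hu2⟩, hu3⟩ : ∃ u, u ∈ Ioo c (min b (c + l)) ∧ ϑ u < ϑ c + Real.pi / 2 := by
    have h1 : ∀ᶠ u in 𝓝[>] c, ϑ u < ϑ c + Real.pi / 2 :=
      (h.continuous.tendsto c).mono_left nhdsWithin_le_nhds
        (Iio_mem_nhds (by linarith))
    exact (Filter.Eventually.and (Ioo_mem_nhdsGT (lt_min hcb (by linarith))) h1).exists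
  have hub : u ≤ b := hu2.le.trans (min_le_left _ _)
  have hul : u - c < l := by linarith [hu2.trans_le (min_le_right _ _)]
  have huab : u ∈ Icc a b := ⟨hcab.1.trans hu1.le, hub⟩
  have hlt : ϑ c < ϑ u := lt_of_le_of_ne (hm hcab huab hu1.le) fun e =>
    (hcmax ⟨⟨hc1.1.trans hu1.le, hub⟩, by rw [mem_ofPred_eq, ← e, hc2]⟩).not_gt hu1
  have hN := hn u huab
  rw [hz', add_sub_right_comm, side_add, side_smul, side_exp] at hN
  -- For `u` just behind `c` the offset of `z` from the tangent at `u` is this integral minus `l *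
  -- sin (ϑ u - ϑ c)`, hence at most `(u - c - l) * sin (ϑ u - ϑ c)`, which is negative. The bound
  -- of `π / 2` on the turn makes the sine monotone.
  have e1 : side (ϑ u) (g c - g u) = ∫ v in c..u, Real.sin (ϑ u - ϑ v) := by
    rw [h.side_eq _ huab hcab, intervalIntegral.integral_symm, ← intervalIntegral.integral_neg]
    refine intervalIntegral.integral_congr fun v _ => ?_
    rw [← Real.sin_neg, neg_sub]
  have e2 : ∫ v in c..u, Real.sin (ϑ u - ϑ v) ≤ ∫ v in c..u, Real.sin (ϑ u - ϑ c) := by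
    have hcont := h.continuous
    refine intervalIntegral.integral_mono_on hu1.le
      (by apply Continuous.intervalIntegrable; fun_prop) (by simp) fun v hv => ?_
    have hv' : v ∈ Icc a b := ⟨hcab.1.trans hv.1, hv.2.trans hub⟩
    exact Real.sin_le_sin_of_le_of_le_pi_div_two (by linarith [hm hv' huab hv.2]) (by linarith)
      (by linarith [hm hcab hv' hv.1])
  rw [intervalIntegral.integral_const, smul_eq_mul] at e2
  have e3 := Real.sin_pos_of_pos_of_lt_pi (x := ϑ u - ϑ c) (by linarith) (by linarith)
  have e4 : Real.sin (ϑ c - ϑ u) = -Real.sin (ϑ u - ϑ c) := by rw [← Real.sin_neg, neg_sub]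
  rw [e4] at hN
  nlinarith

/-- A point to the left of all tangents which lies on a tangent, behind its point of contact, is
on the arc or on the first tangent. -/
theorem eq_or_of_tangent_behind (hm : MonotoneOn ϑ (Icc a b)) {z : ℂ} {s r : ℝ} (hs : s ∈ Icc a b)
    (hr : r ≤ 0) (hz : z = g s + r * Complex.exp (ϑ s * Complex.I))
    (hn : ∀ u ∈ Icc a b, 0 ≤ side (ϑ u) (z - g u)) :
    z ∈ g '' Icc a b ∨ ∃ r : ℝ, r < 0 ∧ z = g a + r * Complex.exp (ϑ a * Complex.I) := by
  have hpi := Real.pi_pos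
  obtain ⟨c, ⟨hc1, hc2⟩, hcmin⟩ := (isCompact_Icc.inter_right
    (isClosed_eq h.continuous (continuous_const (y := ϑ s))) :
    IsCompact (Icc a s ∩ {u | ϑ u = ϑ s})).exists_isLeast ⟨s, ⟨hs.1, le_rfl⟩, rfl⟩
  have hc2 : ϑ c = ϑ s := hc2
  have hcab : c ∈ Icc a b := ⟨hc1.1, hc1.2.trans hs.2⟩
  have hconst : ∀ u ∈ Icc c s, ϑ u = ϑ s := fun u hu => by
    have hu' : u ∈ Icc a b := ⟨hc1.1.trans hu.1, hu.2.trans hs.2⟩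
    exact le_antisymm (hm hu' hs hu.2) (hc2.ge.trans (hm hcab hu' hu.1))
  have hgt : ∀ t ∈ Icc c s, g t = g s + (t - s : ℝ) * Complex.exp (ϑ s * Complex.I) := by
    intro t ht
    refine h.eq_add_of_const hs ⟨hc1.1.trans ht.1, ht.2.trans hs.2⟩ fun u hu => ?_
    rw [uIcc_of_ge ht.2] at hu
    exact hconst u ⟨ht.1.trans hu.1, hu.2⟩
  rcases le_or_gt (c - s) r with hrc | hrc
  · refine Or.inl ⟨s + r, ⟨by linarith [hc1.1], by linarith [hs.2]⟩, ?_⟩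
    rw [hgt (s + r) ⟨by linarith, by linarith⟩, hz]
    simp
  have hz' : z = g c + (r - (c - s) : ℝ) * Complex.exp (ϑ c * Complex.I) := by
    rw [hgt c ⟨le_rfl, hc1.2⟩, hz, hc2]
    push_cast
    ring
  rcases hc1.1.eq_or_lt with rfl | hac
  · exact Or.inr ⟨r - (a - s), by linarith, hz'⟩
  exfalso
  set l := r - (c - s) with hl
  have hl0 : l < 0 := by linarith
  obtain ⟨u, ⟨hu1, hu2⟩, hu3⟩ : ∃ u, u ∈ Ioo (max a (c + l)) c ∧ ϑ c - Real.pi / 2 < ϑ u := by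
    have h1 : ∀ᶠ u in 𝓝[<] c, ϑ c - Real.pi / 2 < ϑ u :=
      (h.continuous.tendsto c).mono_left nhdsWithin_le_nhds
        (Ioi_mem_nhds (by linarith))
    exact (Filter.Eventually.and (Ioo_mem_nhdsLT (max_lt hac (by linarith))) h1).exists
  have hau : a ≤ u := (le_max_left _ _).trans hu1.le
  have hul : l < u - c := by linarith [(le_max_right _ _).trans_lt hu1]
  have huab : u ∈ Icc a b := ⟨hau, hu2.le.trans hcab.2⟩
  have hlt : ϑ u < ϑ c := lt_of_le_of_ne (hm huab hcab hu2.le) fun e =>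
    (hcmin ⟨⟨hau, hu2.le.trans hc1.2⟩, by rw [mem_ofPred_eq, e, hc2]⟩).not_gt hu2
  have hN := hn u huab
  rw [hz', add_sub_right_comm, side_add, side_smul, side_exp] at hN
  have e1 : side (ϑ u) (g c - g u) = ∫ v in u..c, Real.sin (ϑ v - ϑ u) := h.side_eq _ huab hcab
  have e2 : ∫ v in u..c, Real.sin (ϑ v - ϑ u) ≤ ∫ v in u..c, Real.sin (ϑ c - ϑ u) := by
    have hcont := h.continuous
    refine intervalIntegral.integral_mono_on hu2.le
      (by apply Continuous.intervalIntegrable; fun_prop) (by simp) fun v hv => ?_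
    have hv' : v ∈ Icc a b := ⟨hau.trans hv.1, hv.2.trans hcab.2⟩
    exact Real.sin_le_sin_of_le_of_le_pi_div_two (by linarith [hm huab hv' hv.1]) (by linarith)
      (by linarith [hm hv' hcab hv.2])
  rw [intervalIntegral.integral_const, smul_eq_mul] at e2
  have e3 := Real.sin_pos_of_pos_of_lt_pi (x := ϑ c - ϑ u) (by linarith) (by linarith)
  nlinarith

end HasAngle

/-! ### The cap of a convex arc that turns by `π` -/

/-- The points to the left of all tangents of the arc of `g` over `[a, b]`. -/
def leftOfTangents (g : ℝ → ℂ) (ϑ : ℝ → ℝ) (a b : ℝ) : Set ℂ :=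
  {z | ∀ u ∈ Icc a b, 0 < side (ϑ u) (z - g u)}

/-- The cap cut off by the real axis from a convex arc below it. -/
def cap (g : ℝ → ℂ) (ϑ : ℝ → ℝ) (a b : ℝ) : Set ℂ :=
  {z | z.im < 0} ∩ leftOfTangents g ϑ a b

/-- Infinitely many open half-planes are intersected, but they are parametrized by a compact
interval: the complement is the projection of a closed set along a compact factor. -/
theorem isOpen_leftOfTangents {g : ℝ → ℂ} {ϑ : ℝ → ℝ} (hg : Continuous g) (hϑ : Continuous ϑ)
    (a b : ℝ) : IsOpen (leftOfTangents g ϑ a b) := by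
  have hcont : Continuous fun x : ℂ × Icc a b => side (ϑ x.2) (x.1 - g x.2) :=
    continuous_side.comp (f := fun x : ℂ × Icc a b => (ϑ x.2, x.1 - g x.2)) (by fun_prop)
  have hcl : IsClosed {x : ℂ × Icc a b | side (ϑ x.2) (x.1 - g x.2) ≤ 0} :=
    isClosed_le hcont continuous_const
  have := isClosedMap_fst_of_compactSpace _ hcl
  convert this.isOpen_compl using 1
  ext z
  simp only [leftOfTangents, mem_ofPred_eq, mem_compl_iff, mem_image, Prod.exists, not_exists,
    not_and]
  constructor
  · rintro h x u hu rfl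
    exact absurd (h u u.2) (not_lt.2 hu)
  · intro h u hu
    by_contra hcon
    exact h z ⟨u, hu⟩ (not_lt.1 hcon) rfl

theorem side_segment {ψ t : ℝ} {z w v : ℂ} :
    side ψ (((1 - t : ℝ) : ℂ) * z + (t : ℂ) * w - v) =
      (1 - t) * side ψ (z - v) + t * side ψ (w - v) := by
  simp only [side, Complex.sub_im, Complex.add_im, Complex.sub_re, Complex.add_re,
    Complex.re_ofReal_mul, Complex.im_ofReal_mul]
  ring

theorem convex_leftOfTangents (g : ℝ → ℂ) (ϑ : ℝ → ℝ) (a b : ℝ) :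
    Convex ℝ (leftOfTangents g ϑ a b) := by
  intro z hz w hw r t hr ht hrt u hu
  obtain rfl : r = 1 - t := by linarith
  have h1 := hz u hu
  have h2 := hw u hu
  rw [Complex.real_smul, Complex.real_smul, side_segment]
  rcases ht.eq_or_lt with rfl | ht
  · simpa using h1
  · nlinarith [mul_nonneg hr h1.le, mul_pos ht h2]

theorem convex_cap (g : ℝ → ℂ) (ϑ : ℝ → ℝ) (a b : ℝ) : Convex ℝ (cap g ϑ a b) :=
  Convex.inter (convex_halfSpace_lt (f := Complex.im) (by constructor <;> simp) 0)
    (convex_leftOfTangents g ϑ a b)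

theorem isOpen_cap {g : ℝ → ℂ} {ϑ : ℝ → ℝ} (hg : Continuous g) (hϑ : Continuous ϑ)
    (a b : ℝ) : IsOpen (cap g ϑ a b) :=
  (isOpen_lt Complex.continuous_im continuous_const).inter (isOpen_leftOfTangents hg hϑ a b)

theorem curve_not_mem_cap {g : ℝ → ℂ} {ϑ : ℝ → ℝ} {a b s : ℝ} (hs : s ∈ Icc a b) :
    g s ∉ cap g ϑ a b := fun hc => by
  have := hc.2 s hs
  simp [side] at this

/-- A convex arc below the real axis which turns left by `π` and whose endpoints are `-ℓ` and
`0`. -/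
structure CapArc (g : ℝ → ℂ) (ϑ : ℝ → ℝ) (a b ℓ : ℝ) : Prop extends HasAngle g ϑ a b where
  continuous_curve : Continuous g
  lt : a < b
  mono : MonotoneOn ϑ (Icc a b)
  turn : ϑ b = ϑ a + Real.pi
  length_pos : 0 < ℓ
  left_end : g a = -ℓ
  right_end : g b = 0
  angle_left : ϑ a ∈ Ioo (-Real.pi) 0

namespace CapArc

variable {g : ℝ → ℂ} {ϑ : ℝ → ℝ} {a b ℓ : ℝ} (h : CapArc g ϑ a b ℓ)
include h

theorem left_mem_Icc : a ∈ Icc a b := ⟨le_rfl, h.lt.le⟩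

theorem right_mem_Icc : b ∈ Icc a b := ⟨h.lt.le, le_rfl⟩

theorem angle_mem {u : ℝ} (hu : u ∈ Icc a b) : ϑ u ∈ Icc (ϑ a) (ϑ a + Real.pi) :=
  ⟨h.mono h.left_mem_Icc hu hu.1, h.turn ▸ h.mono hu h.right_mem_Icc hu.2⟩

theorem sin_left : Real.sin (ϑ a) < 0 :=
  Real.sin_neg_of_neg_of_neg_pi_lt h.angle_left.2 h.angle_left.1

theorem sin_right : 0 < Real.sin (ϑ b) := by
  rw [h.turn, Real.sin_add_pi]
  linarith [h.sin_left]

/-- The height starts at `0`, decreases while the tangent angle is negative, and afterwards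
increases until it is `0` again. -/
theorem im_neg {s : ℝ} (hs : s ∈ Ioo a b) : (g s).im < 0 := by
  have hpi := Real.pi_pos
  have hl := h.angle_left
  have hs' : s ∈ Icc a b := Ioo_subset_Icc_self hs
  rcases le_total (ϑ s) 0 with h0 | h0
  · have := h.toHasAngle.im_gt le_rfl hs.1 hs.2.le (fun u hu => by
      have hu' : u ∈ Icc a b := ⟨hu.1, hu.2.trans hs.2.le⟩
      exact Real.sin_nonpos_of_nonpos_of_neg_pi_le ((h.mono hu' hs' hu.2).trans h0)
        (by linarith [(h.angle_mem hu').1, hl.1])) ⟨a, ⟨le_rfl, hs.1.le⟩, h.sin_left⟩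
    simpa [h.left_end] using this
  · have := h.toHasAngle.im_lt hs.1.le hs.2 le_rfl (fun u hu => by
      have hu' : u ∈ Icc a b := ⟨hs.1.le.trans hu.1, hu.2⟩
      exact Real.sin_nonneg_of_nonneg_of_le_pi (h0.trans (h.mono hs' hu' hu.1))
        (by linarith [(h.angle_mem hu').2, hl.2])) ⟨b, ⟨hs.2.le, le_rfl⟩, h.sin_right⟩
    simpa [h.right_end] using this

theorem im_nonpos {s : ℝ} (hs : s ∈ Icc a b) : (g s).im ≤ 0 := by
  rcases hs.1.eq_or_lt with rfl | h1
  · simp [h.left_end]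
  rcases hs.2.eq_or_lt with rfl | h2
  · simp [h.right_end]
  exact (h.im_neg ⟨h1, h2⟩).le

theorem tangent_nonneg {s u : ℝ} (hs : s ∈ Icc a b) (hu : u ∈ Icc a b) :
    0 ≤ side (ϑ u) (g s - g u) :=
  h.toHasAngle.tangent_nonneg h.mono h.turn.le hs hu

theorem tangent_pos {s u : ℝ} (hs : s ∈ Icc a b) (hu : u ∈ Icc a b) (hne : ϑ s ≠ ϑ u) :
    0 < side (ϑ u) (g s - g u) :=
  h.toHasAngle.tangent_pos h.mono h.turn.le hs hu hne

/-- The tangent angles at the two ends differ by `π`, so at least one of them differs from `ϑ u`. -/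
theorem tangent_ends {u : ℝ} (hu : u ∈ Icc a b) :
    0 < side (ϑ u) (g a - g u) ∨ 0 < side (ϑ u) (g b - g u) := by
  by_cases hne : ϑ a = ϑ u
  · refine Or.inr (h.tangent_pos h.right_mem_Icc hu ?_)
    rw [← hne, h.turn]
    linarith [Real.pi_pos]
  · exact Or.inl (h.tangent_pos h.left_mem_Icc hu hne)

/-- The open chord lies to the left of all tangents. -/
theorem chord_mem {z : ℂ} (h0 : z.im = 0) (h1 : -ℓ < z.re) (h2 : z.re < 0) :
    z ∈ leftOfTangents g ϑ a b := by
  intro u hu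
  have hℓ := h.length_pos
  set t : ℝ := (z.re + ℓ) / ℓ with ht
  have ht0 : 0 < t := div_pos (by linarith) hℓ
  have ht1 : t < 1 := by rw [ht, div_lt_one hℓ]; linarith
  have ez : z = ((1 - t : ℝ) : ℂ) * g a + (t : ℂ) * g b := by
    rw [h.left_end, h.right_end]
    refine Complex.ext ?_ ?_
    · simp [ht]
      field_simp
      ring
    · simp [h0]
  rw [ez, side_segment]
  have n1 := h.tangent_nonneg h.left_mem_Icc hu
  have n2 := h.tangent_nonneg h.right_mem_Icc hu
  rcases h.tangent_ends hu with h3 | h3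
  · nlinarith [mul_pos (sub_pos.2 ht1) h3, mul_nonneg ht0.le n2]
  · nlinarith [mul_pos ht0 h3, mul_nonneg (sub_pos.2 ht1).le n1]

theorem re_bounds {z : ℂ} (h0 : z.im = 0) (h1 : 0 ≤ side (ϑ a) (z - g a))
    (h2 : 0 ≤ side (ϑ b) (z - g b)) : -ℓ ≤ z.re ∧ z.re ≤ 0 := by
  have s1 := h.sin_left
  have s2 := h.sin_right
  simp [side, h.left_end, h.right_end, h0] at h1 h2
  constructor <;> nlinarith

theorem re_bounds_strict {z : ℂ} (h0 : z.im = 0) (h1 : 0 < side (ϑ a) (z - g a))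
    (h2 : 0 < side (ϑ b) (z - g b)) : -ℓ < z.re ∧ z.re < 0 := by
  have s1 := h.sin_left
  have s2 := h.sin_right
  simp [side, h.left_end, h.right_end, h0] at h1 h2
  constructor <;> nlinarith

theorem cap_nonempty : (cap g ϑ a b).Nonempty := by
  have hℓ := h.length_pos
  have hz : ((-(ℓ / 2) : ℝ) : ℂ) ∈ leftOfTangents g ϑ a b :=
    h.chord_mem (by simp) (by rw [Complex.ofReal_re]; linarith) (by rw [Complex.ofReal_re]; linarith)
  have hev : ∀ᶠ t : ℝ in 𝓝[>] 0, ((-(ℓ / 2) : ℝ) : ℂ) - t * Complex.I ∈ leftOfTangents g ϑ a b := by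
    have hc : Continuous fun t : ℝ => ((-(ℓ / 2) : ℝ) : ℂ) - t * Complex.I := by fun_prop
    refine (hc.tendsto 0).mono_left nhdsWithin_le_nhds ?_
    refine (isOpen_leftOfTangents h.continuous_curve h.continuous a b).mem_nhds ?_
    simpa using hz
  obtain ⟨t, ht, ht0⟩ := (hev.and self_mem_nhdsWithin).exists
  exact ⟨_, by simpa using ht0, ht⟩

/-- Moving a point that satisfies the weak inequalities slightly towards a point of the cap makes
them all strict. -/
theorem closure_cap : closure (cap g ϑ a b) =
    {z | z.im ≤ 0 ∧ ∀ u ∈ Icc a b, 0 ≤ side (ϑ u) (z - g u)} := by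
  apply Subset.antisymm
  · refine closure_minimal (fun z hz => ⟨(show z.im < 0 from hz.1).le, fun u hu => (hz.2 u hu).le⟩) ?_
    have e : {z : ℂ | z.im ≤ 0 ∧ ∀ u ∈ Icc a b, 0 ≤ side (ϑ u) (z - g u)} =
        {z | z.im ≤ 0} ∩ ⋂ u ∈ Icc a b, {z | 0 ≤ side (ϑ u) (z - g u)} := by
      ext z; simp
    rw [e]
    refine (isClosed_le Complex.continuous_im continuous_const).inter
      (isClosed_biInter fun u _ => isClosed_le continuous_const ?_)
    exact continuous_side.comp (f := fun z : ℂ => (ϑ u, z - g u)) (by fun_prop)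
  · rintro z ⟨hz1, hz2⟩
    obtain ⟨w, hw1, hw2⟩ := h.cap_nonempty
    have hw1 : w.im < 0 := hw1
    have hc : Continuous fun t : ℝ => ((1 - t : ℝ) : ℂ) * z + (t : ℂ) * w := by fun_prop
    have ht : Tendsto (fun t : ℝ => ((1 - t : ℝ) : ℂ) * z + (t : ℂ) * w) (𝓝[>] 0) (𝓝 z) := by
      have := (hc.tendsto 0).mono_left (nhdsWithin_le_nhds (s := Ioi 0))
      simpa using this
    refine mem_closure_of_tendsto ht ?_
    filter_upwards [Ioo_mem_nhdsGT (show (0 : ℝ) < 1 by norm_num)] with t ht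
    refine ⟨?_, fun u hu => ?_⟩
    · simp only [mem_ofPred_eq, Complex.add_im, Complex.im_ofReal_mul]
      nlinarith [mul_pos ht.1 (neg_pos.2 hw1), mul_nonneg (sub_pos.2 ht.2).le (neg_nonneg.2 hz1)]
    · rw [side_segment]
      nlinarith [mul_pos ht.1 (hw2 u hu), mul_nonneg (sub_pos.2 ht.2).le (hz2 u hu)]

theorem arc_subset_closure {s : ℝ} (hs : s ∈ Icc a b) : g s ∈ closure (cap g ϑ a b) := by
  rw [h.closure_cap]
  exact ⟨h.im_nonpos hs, fun u hu => h.tangent_nonneg hs hu⟩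

theorem segment_eq : segment ℝ (g a) (g b) = {z : ℂ | z.im = 0 ∧ -ℓ ≤ z.re ∧ z.re ≤ 0} := by
  have hℓ := h.length_pos
  ext z
  rw [h.left_end, h.right_end]
  constructor
  · rintro ⟨r, t, hr, ht, hrt, rfl⟩
    simp only [mem_ofPred_eq, Complex.real_smul, mul_zero, add_zero]
    simp only [mul_neg, Complex.neg_im, Complex.neg_re, ← Complex.ofReal_mul, Complex.ofReal_im,
      Complex.ofReal_re]
    exact ⟨by simp, by nlinarith, by nlinarith⟩
  · rintro ⟨h0, h1, h2⟩
    refine ⟨-z.re / ℓ, 1 - -z.re / ℓ, by apply div_nonneg <;> linarith, ?_, by ring, ?_⟩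
    · rw [sub_nonneg, div_le_one hℓ]; linarith
    · refine Complex.ext ?_ ?_
      · simp
        field_simp
      · simp [h0]

/-- A frontier point is either on the axis, where the end tangents bound the chord, or below it and
on some tangent. In the second case, sliding along that tangent ends on the arc or on an extension
of an end tangent; these extensions run above the axis. -/
theorem frontier_cap :
    frontier (cap g ϑ a b) = segment ℝ (g a) (g b) ∪ g '' Icc a b := by
  rw [frontier, (isOpen_cap h.continuous_curve h.continuous a b).interior_eq]
  apply Subset.antisymm
  · rintro z ⟨hz1, hz2⟩
    rw [h.closure_cap] at hz1
    obtain ⟨him, hn⟩ := hz1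
    rcases him.eq_or_lt with h0 | h0
    · left
      rw [h.segment_eq]
      exact ⟨h0, h.re_bounds h0 (hn a h.left_mem_Icc) (hn b h.right_mem_Icc)⟩
    · right
      obtain ⟨u, hu, hu0⟩ : ∃ u ∈ Icc a b, side (ϑ u) (z - g u) = 0 := by
        by_contra hcon
        push Not at hcon
        exact hz2 ⟨h0, fun u hu => lt_of_le_of_ne (hn u hu) (hcon u hu).symm⟩
      obtain ⟨r, hr⟩ := exists_eq_of_side_eq_zero hu0
      rw [sub_eq_iff_eq_add'] at hr
      rcases le_total 0 r with hr0 | hr0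
      · refine (h.toHasAngle.eq_or_of_tangent_ahead h.mono hu hr0 hr hn).resolve_right ?_
        rintro ⟨r', hr', e⟩
        rw [e, h.right_end, zero_add, Complex.im_ofReal_mul, Complex.exp_ofReal_mul_I_im] at h0
        nlinarith [h.sin_right, mul_pos hr' h.sin_right]
      · refine (h.toHasAngle.eq_or_of_tangent_behind h.mono hu hr0 hr hn).resolve_right ?_
        rintro ⟨r', hr', e⟩
        rw [e, h.left_end, Complex.add_im, Complex.im_ofReal_mul, Complex.exp_ofReal_mul_I_im] at h0
        simp at h0
        nlinarith [h.sin_left, mul_pos_of_neg_of_neg hr' h.sin_left]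
  · rintro z (hz | ⟨s, hs, rfl⟩)
    · rw [h.segment_eq] at hz
      refine ⟨?_, fun hc => ?_⟩
      · rw [← h.segment_eq] at hz
        have hconv : Convex ℝ (closure (cap g ϑ a b)) := (convex_cap g ϑ a b).closure
        exact hconv.segment_subset (h.arc_subset_closure h.left_mem_Icc)
          (h.arc_subset_closure h.right_mem_Icc) hz
      · have : z.im < 0 := hc.1
        linarith [hz.1]
    · exact ⟨h.arc_subset_closure hs, curve_not_mem_cap hs⟩

theorem chord_subset_closure {z : ℂ} (h0 : z.im = 0) (h1 : -ℓ < z.re) (h2 : z.re < 0) :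
    z ∈ closure (cap g ϑ a b) := by
  have : z ∈ frontier (cap g ϑ a b) := by
    rw [h.frontier_cap, h.segment_eq]
    exact Or.inl ⟨h0, h1.le, h2.le⟩
  exact this.1

theorem re_of_mem_closure {z : ℂ} (hz : z ∈ closure (cap g ϑ a b)) (h0 : z.im = 0) :
    -ℓ ≤ z.re ∧ z.re ≤ 0 := by
  rw [h.closure_cap] at hz
  exact h.re_bounds h0 (hz.2 a h.left_mem_Icc) (hz.2 b h.right_mem_Icc)

/-- On the axis the points to the left of all tangents are exactly those of the open chord. Hence
the union is that of two open sets, the points left of all tangents and the upper half-plane. -/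
theorem isOpen_cap_union : IsOpen (cap g ϑ a b ∪ {z : ℂ | z.im = 0 ∧ -ℓ < z.re ∧ z.re < 0} ∪
    {z : ℂ | 0 < z.im}) := by
  have e : cap g ϑ a b ∪ {z : ℂ | z.im = 0 ∧ -ℓ < z.re ∧ z.re < 0} ∪ {z : ℂ | 0 < z.im} =
      leftOfTangents g ϑ a b ∪ {z : ℂ | 0 < z.im} := by
    ext z
    constructor
    · rintro ((hz | hz) | hz)
      · exact Or.inl hz.2
      · exact Or.inl (h.chord_mem hz.1 hz.2.1 hz.2.2)
      · exact Or.inr hz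
    · rintro (hz | hz)
      · rcases lt_trichotomy z.im 0 with h0 | h0 | h0
        · exact Or.inl (Or.inl ⟨h0, hz⟩)
        · exact Or.inl (Or.inr ⟨h0, h.re_bounds_strict h0 (hz a h.left_mem_Icc)
            (hz b h.right_mem_Icc)⟩)
        · exact Or.inr h0
      · exact Or.inr hz
  rw [e]
  exact (isOpen_leftOfTangents h.continuous_curve h.continuous a b).union
    (isOpen_lt continuous_const Complex.continuous_im)

theorem mem_cap_of_not_mem_arc {z : ℂ} (hz : z ∈ closure (cap g ϑ a b)) (h0 : z.im < 0)
    (hne : z ∉ g '' Icc a b) : z ∈ cap g ϑ a b := by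
  by_contra hc
  have hf : z ∈ frontier (cap g ϑ a b) := by
    rw [frontier, (isOpen_cap h.continuous_curve h.continuous a b).interior_eq]
    exact ⟨hz, hc⟩
  rw [h.frontier_cap, h.segment_eq] at hf
  rcases hf with hf | hf
  · linarith [hf.1]
  · exact hne hf

end CapArc

/-! ### Plane geometry of the nested arcs -/

theorem sin_sub_mul_im (p q : ℝ) (z : ℂ) :
    z.im * Real.sin (p - q) = side q z * Real.sin p - side p z * Real.sin q := by
  rw [Real.sin_sub, side, side]; ring

theorem side_polar (ψ χ r : ℝ) :
    side ψ (r * Complex.exp (χ * Complex.I)) = r * Real.sin (χ - ψ) := by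
  rw [side_smul, side_exp]

/-- A vector pointing to the left of the direction `ψ` has an argument in `(ψ, ψ + π)`. -/
theorem exists_arg_of_side_pos {ψ : ℝ} {z : ℂ} (h : 0 < side ψ z) :
    ∃ χ ∈ Ioo ψ (ψ + Real.pi), IsArg z χ := by
  set w : ℂ := z * Complex.exp ((-ψ : ℝ) * Complex.I) with hw
  have him : 0 < w.im := by
    have e : w.im = side ψ z := by
      rw [hw, Complex.mul_im, Complex.exp_ofReal_mul_I_re, Complex.exp_ofReal_mul_I_im,
        Real.cos_neg, Real.sin_neg, side]
      ring
    rw [e]; exact h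
  have hw0 : w ≠ 0 := fun e => by simp [e] at him
  have harg : IsArg w w.arg := by
    unfold IsArg; exact (Complex.norm_mul_exp_arg_mul_I w).symm
  have h1 := harg.mul_exp ψ
  have e1 : w * Complex.exp (ψ * Complex.I) = z := by
    rw [hw, mul_assoc, ← Complex.exp_add]
    simp
  rw [e1] at h1
  refine ⟨w.arg + ψ, ⟨?_, ?_⟩, h1⟩
  · have : 0 ≤ w.arg := Complex.arg_nonneg_iff.2 him.le
    have h2 : w.arg ≠ 0 := fun e => by
      rw [Complex.arg_eq_zero_iff] at e
      linarith [e.2]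
    have := lt_of_le_of_ne this h2.symm
    linarith
  · have : w.arg < Real.pi := Complex.arg_lt_pi_iff.2 (Or.inr him.ne')
    linarith

/-- The configuration of nested arcs, with the chord of the inner arc on the real axis. -/
structure NestedArcs (g : ℝ → ℂ) (ϑ : ℝ → ℝ) (p' p q q' ℓ : ℝ) : Prop extends
    HasAngle g ϑ p' q' where
  cap_arc : CapArc g ϑ q q' ℓ
  lt₁ : p' < p
  lt₂ : p < q
  injective : ∀ s ∈ Icc p' q', ∀ t ∈ Icc p' q', s < t → g s ≠ g t
  mono : MonotoneOn ϑ (Icc p' p)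
  anti : AntitoneOn ϑ (Icc p q)
  turn : ϑ p = ϑ p' + Real.pi
  concave : ϑ p - ϑ q ∈ Ioo 0 Real.pi
  meets : ∃ s ∈ Icc q q', g s ∈ segment ℝ (g p) (g p')

namespace NestedArcs

variable {g : ℝ → ℂ} {ϑ : ℝ → ℝ} {p' p q q' ℓ : ℝ} (h : NestedArcs g ϑ p' p q q' ℓ)
include h

theorem lt₃ : q < q' := h.cap_arc.lt

theorem outer : HasAngle g ϑ p' p := h.toHasAngle.mono le_rfl (h.lt₂.trans h.lt₃).le

theorem middle : HasAngle g ϑ p q := h.toHasAngle.mono h.lt₁.le h.lt₃.le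

theorem middle_angle {u : ℝ} (hu : u ∈ Icc p q) : ϑ u ∈ Icc (ϑ q) (ϑ p) :=
  ⟨h.anti hu ⟨h.lt₂.le, le_rfl⟩ hu.2, h.anti ⟨le_rfl, h.lt₂.le⟩ hu hu.1⟩

theorem side_q_p : side (ϑ q) (g p - g q) < 0 := by
  have := h.middle.side_pos (ψ := ϑ q) le_rfl h.lt₂ le_rfl
    (fun u hu => Real.sin_nonneg_of_nonneg_of_le_pi (by linarith [(h.middle_angle hu).1])
      (by linarith [(h.middle_angle hu).2, h.concave.2]))
    ⟨p, ⟨le_rfl, h.lt₂.le⟩, Real.sin_pos_of_pos_of_lt_pi h.concave.1 h.concave.2⟩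
  rw [side_sub] at this ⊢
  linarith

theorem side_p_q : side (ϑ p) (g q - g p) < 0 :=
  h.middle.side_neg (ψ := ϑ p) le_rfl h.lt₂ le_rfl
    (fun u hu => Real.sin_nonpos_of_nonpos_of_neg_pi_le (by linarith [(h.middle_angle hu).2])
      (by linarith [(h.middle_angle hu).1, h.concave.2]))
    ⟨q, ⟨h.lt₂.le, le_rfl⟩, Real.sin_neg_of_neg_of_neg_pi_lt (by linarith [h.concave.1])
      (by linarith [h.concave.2])⟩

theorem side_p_p' : 0 < side (ϑ p) (g p' - g p) :=
  h.outer.tangent_pos h.mono h.turn.le ⟨le_rfl, h.lt₁.le⟩ ⟨h.lt₁.le, le_rfl⟩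
    (by rw [h.turn]; linarith [Real.pi_pos])

/-- The chord `p p'` crosses the real axis downwards, inside the tangents to the inner arc. -/
theorem chord_position : ∃ l k : ℝ, ∃ s ∈ Icc q q', 0 < k ∧ k ≤ l ∧ l ≤ 1 ∧
    g s = g p + l * (g p' - g p) ∧ (g p + k * (g p' - g p)).im = 0 ∧
    -ℓ < (g p + k * (g p' - g p)).re ∧ 0 < (g p).im ∧ (g p').im < 0 := by
  have hc := h.cap_arc
  obtain ⟨s, hs, hseg⟩ := h.meets
  rw [segment_eq_image'] at hseg
  obtain ⟨l, ⟨hl0, hl1⟩, hl⟩ := hseg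
  simp only [Complex.real_smul] at hl
  set D := g p' - g p with hD
  have a1 := h.side_q_p
  have a2 := h.side_p_q
  have a3 := h.side_p_p'
  rw [← hD] at a3
  have a4 : 0 ≤ side (ϑ q) (g s - g q) := hc.tangent_nonneg hs hc.left_mem_Icc
  have a5 : side (ϑ q) (g p - g q) + l * side (ϑ q) D ≥ 0 := by
    rw [← side_smul, ← side_add, show g p - g q + l * D = g s - g q by rw [← hl]; ring]
    exact a4
  have a6 : 0 < l * side (ϑ q) D := by linarith
  have a7 : 0 < side (ϑ q) D := pos_of_mul_pos_right a6 hl0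
  have hl0' : 0 < l := pos_of_mul_pos_left a6 a7.le
  -- `n` is the parameter at which the chord `p p'` crosses the tangent at `q`. It exists since `p`
  -- is to the right of this tangent and the meeting point with the inner arc is not.
  set n : ℝ := -side (ϑ q) (g p - g q) / side (ϑ q) D with hn
  have hnD : n * side (ϑ q) D = -side (ϑ q) (g p - g q) := by rw [hn]; field_simp
  have hn0 : 0 < n := div_pos (by linarith) a7
  have hnl : n ≤ l := by
    rw [hn, div_le_iff₀ a7]; linarith
  have hw : side (ϑ q) (g p + n * D - g q) = 0 := by
    rw [add_sub_right_comm, side_add, side_smul, hnD]; ring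
  obtain ⟨m, hm⟩ := exists_eq_of_side_eq_zero hw
  -- The crossing is behind `q`: the chord runs to the left of the tangent at `p`, while `q` and
  -- every point ahead of it on its tangent are to the right. Since the tangent at `q` descends, the
  -- crossing is above the axis.
  have hm0 : m < 0 := by
    have e1 : side (ϑ p) (g p + n * D - g p) = n * side (ϑ p) D := by
      rw [add_sub_cancel_left, side_smul]
    have e2 : g p + n * D - g p = (g q - g p) + m * Complex.exp (ϑ q * Complex.I) := by
      rw [← hm]; ring
    rw [e2, side_add, side_polar] at e1
    have e3 : Real.sin (ϑ q - ϑ p) = -Real.sin (ϑ p - ϑ q) := by rw [← Real.sin_neg, neg_sub]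
    have e4 := Real.sin_pos_of_pos_of_lt_pi h.concave.1 h.concave.2
    rw [e3] at e1
    have e5 := mul_pos hn0 a3
    by_contra hcon
    push Not at hcon
    nlinarith [mul_nonneg hcon e4.le]
  have gqi : (g q).im = 0 := by simp [hc.left_end]
  have hwim : 0 < (g p).im + n * D.im := by
    have e1 := congrArg Complex.im hm
    rw [Complex.sub_im, Complex.add_im, Complex.im_ofReal_mul, Complex.im_ofReal_mul,
      Complex.exp_ofReal_mul_I_im, gqi] at e1
    nlinarith [mul_pos_of_neg_of_neg hm0 hc.sin_left]
  have hrim : (g p).im + l * D.im ≤ 0 := by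
    have e1 := congrArg Complex.im hl
    rw [Complex.add_im, Complex.im_ofReal_mul] at e1
    linarith [hc.im_nonpos hs]
  have hDim : D.im < 0 := by
    by_contra hcon
    push Not at hcon
    nlinarith [mul_nonneg (sub_nonneg.2 hnl) hcon]
  have hpim : 0 < (g p).im := by nlinarith [mul_pos hn0 (neg_pos.2 hDim)]
  have hDim' : D.im = (g p').im - (g p).im := by rw [hD, Complex.sub_im]
  -- `k` is the parameter at which the chord crosses the axis. As `n < k`, it has passed the tangent
  -- at `q` by then, so it crosses to the right of `-ℓ`.
  set k : ℝ := -(g p).im / D.im with hk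
  have hkD : k * D.im = -(g p).im := div_mul_cancel₀ _ hDim.ne
  have hk0 : 0 < k := by rw [hk, neg_div, ← div_neg]; exact div_pos hpim (by linarith)
  have hkl : k ≤ l := by
    by_contra hcon
    push Not at hcon
    nlinarith [mul_pos (sub_pos.2 hcon) (neg_pos.2 hDim)]
  have hnk : n < k := by
    by_contra hcon
    push Not at hcon
    nlinarith [mul_nonneg (sub_nonneg.2 hcon) (neg_pos.2 hDim).le]
  have hz0 : (g p + k * D).im = 0 := by
    rw [Complex.add_im, Complex.im_ofReal_mul, hkD]; ring
  refine ⟨l, k, s, hs, hk0, hkl, hl1, hl.symm, hz0, ?_, hpim, ?_⟩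
  · have e1 : 0 < side (ϑ q) (g p + k * D - g q) := by
      rw [add_sub_right_comm, side_add, side_smul]
      nlinarith [mul_pos (sub_pos.2 hnk) a7]
    have e2 := hc.sin_left
    rw [side, Complex.sub_im, hz0, gqi, Complex.sub_re, hc.left_end, Complex.neg_re,
      Complex.ofReal_re] at e1
    nlinarith
  · have e1 : (g p').im ≤ 0 := by nlinarith [mul_nonneg (sub_nonneg.2 hl1) (neg_pos.2 hDim).le]
    -- Were `p'` on the axis, it would be the meeting point itself and hence a point of the inner
    -- arc, against injectivity.
    refine lt_of_le_of_ne e1 fun e2 => ?_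
    have e3 : (1 - l) * D.im = 0 := by
      nlinarith [mul_nonneg (sub_nonneg.2 hl1) (neg_pos.2 hDim).le]
    have e4 : l = 1 := by
      rcases mul_eq_zero.1 e3 with e4 | e4 <;> linarith
    have e5 : g s = g p' := by rw [← hl, e4, hD]; push_cast; ring
    exact h.injective p' ⟨le_rfl, by linarith [h.lt₁, h.lt₂, h.lt₃]⟩ s
      ⟨by linarith [hs.1, h.lt₁, h.lt₂], hs.2⟩ (by linarith [hs.1, h.lt₁, h.lt₂]) e5.symm

/-- The chord vector `g p' - g p` points to the left of both directions `ϑ p` and `ϑ q`. For `ϑ p ≥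
0` the identity `sin_sub_mul_im` would make it point upwards, but the chord descends. -/
theorem angle_p : ϑ p ∈ Ioo (-Real.pi) 0 := by
  obtain ⟨l, k, s, hs, hk0, hkl, hl1, hl, hz, -, hp, hp'⟩ := h.chord_position
  have hc := h.cap_arc
  have hq := hc.angle_left
  have hcc := h.concave
  refine ⟨by linarith [hq.1, hcc.1], ?_⟩
  by_contra hcon
  push Not at hcon
  have a1 := h.side_q_p
  have a3 := h.side_p_p'
  have a4 : 0 ≤ side (ϑ q) (g s - g q) := hc.tangent_nonneg hs hc.left_mem_Icc
  have a5 : 0 < side (ϑ q) (g p' - g p) := by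
    rw [hl, add_sub_right_comm, side_add, side_smul] at a4
    exact pos_of_mul_pos_right (by linarith) (by linarith : (0 : ℝ) ≤ l)
  have e := sin_sub_mul_im (ϑ p) (ϑ q) (g p' - g p)
  have s1 := Real.sin_pos_of_pos_of_lt_pi hcc.1 hcc.2
  have s2 := Real.sin_nonneg_of_nonneg_of_le_pi hcon (by linarith [hcc.2, hq.2])
  have s3 := hc.sin_left
  rw [Complex.sub_im] at e
  nlinarith [mul_nonneg a5.le s2, mul_pos a3 (neg_pos.2 s3)]

/-- The outer arc crosses the real axis to the right of the chord of the inner arc. -/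
theorem exists_crossing : ∃ e ∈ Ioo p' p, (g e).im = 0 ∧ 0 < (g e).re ∧
    (∀ t ∈ Icc e q, 0 ≤ (g t).im) ∧ ϑ e < -Real.pi := by
  obtain ⟨l, k, s, hs, hk0, hkl, hl1, hl, hz, hzre, hp, hp'⟩ := h.chord_position
  have hpi := Real.pi_pos
  have hc := h.cap_arc
  have hpa := h.angle_p
  have hpos := h.lt₁
  have hturn := h.turn
  have mp' : p' ∈ Icc p' p := ⟨le_rfl, hpos.le⟩
  have mp : p ∈ Icc p' p := ⟨hpos.le, le_rfl⟩
  have hgi : Continuous fun t => (g t).im := Complex.continuous_im.comp hc.continuous_curve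
  -- `e` is the last parameter of the outer arc on or below the axis.
  obtain ⟨e, ⟨he1, he2⟩, hemax⟩ := (isCompact_Icc.inter_right
    (isClosed_le hgi continuous_const) :
    IsCompact (Icc p' p ∩ {t | (g t).im ≤ 0})).exists_isGreatest ⟨p', mp', hp'.le⟩
  have he2 : (g e).im ≤ 0 := he2
  have hep : e < p := lt_of_le_of_ne he1.2 fun h' => by rw [h'] at he2; linarith
  have he0 : (g e).im = 0 := by
    obtain ⟨x, hx, hx0⟩ := intermediate_value_Icc he1.2 hgi.continuousOn
      (show (0 : ℝ) ∈ Icc (g e).im (g p).im from ⟨he2, hp.le⟩)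
    have hx0 : (g x).im = 0 := hx0
    have : x ≤ e := hemax ⟨⟨he1.1.trans hx.1, hx.2⟩, hx0.le⟩
    rw [le_antisymm this hx.1] at hx0
    exact hx0
  have hp'e : p' < e := lt_of_le_of_ne he1.1 fun h' => by rw [← h'] at he0; linarith
  -- Otherwise the angles from `e` to `p` would lie in `[-π, 0]` and the curve could not rise to `g
  -- p`.
  have hea : ϑ e < -Real.pi := by
    by_contra hcon
    push Not at hcon
    have := h.outer.side_nonneg (ψ := -Real.pi) he1.1 he1.2 le_rfl fun u hu => by
      have hu' : u ∈ Icc p' p := ⟨he1.1.trans hu.1, hu.2⟩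
      exact Real.sin_nonneg_of_nonneg_of_le_pi (by linarith [h.mono he1 hu' hu.1])
        (by linarith [h.mono hu' mp hu.2, hpa.2])
    simp [side] at this
    linarith
  have hup : ∀ t ∈ Icc e q, 0 ≤ (g t).im := by
    intro t ht
    rcases le_total t p with htp | hpt
    · rcases ht.1.eq_or_lt with rfl | het
      · exact he0.ge
      by_contra hcon
      push Not at hcon
      exact (hemax ⟨⟨he1.1.trans ht.1, htp⟩, hcon.le⟩).not_gt het
    · have := h.middle.side_nonneg (ψ := -Real.pi) hpt ht.2 le_rfl fun u hu => by
        have hu' : u ∈ Icc p q := ⟨hpt.trans hu.1, hu.2⟩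
        exact Real.sin_nonneg_of_nonneg_of_le_pi
          (by linarith [(h.middle_angle hu').1, hc.angle_left.1])
          (by linarith [(h.middle_angle hu').2, hpa.2])
      simp [side, hc.left_end] at this
      linarith
  have hdown : ∀ t ∈ Ico p' e, (g t).im < 0 := by
    intro t ht
    have h1 : ∀ u ∈ Icc t e, 0 < Real.sin (ϑ u) := fun u hu => by
      have hu' : u ∈ Icc p' p := ⟨ht.1.trans hu.1, hu.2.trans he1.2⟩
      rw [← Real.sin_add_two_pi]
      exact Real.sin_pos_of_pos_of_lt_pi (by linarith [h.mono mp' hu' hu'.1, hpa.1])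
        (by linarith [h.mono hu' he1 hu.2])
    have := h.outer.im_lt ht.1 ht.2 he1.2 (fun u hu => (h1 u hu).le)
      ⟨e, ⟨ht.2.le, le_rfl⟩, h1 e ⟨ht.2.le, le_rfl⟩⟩
    linarith
  refine ⟨e, ⟨hp'e, hep⟩, he0, ?_, hup, hea⟩
  -- the crossing point is to the right of the point where the chord `p p'` crosses the axis
  have hze : (g p + k * (g p' - g p)).re ≤ (g e).re := by
    obtain ⟨χ, hχ, hD⟩ := exists_arg_of_side_pos h.side_p_p'
    have hside : 0 ≤ side χ (g e - g p) := by
      -- The outer arc is to the left of its chord `p p'`: its offset from the chord grows from `p'`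
      -- until the angle reaches `χ - π`, then shrinks to `0` at `p`. The half of the motion that
      -- contains no change of sign is used.
      rcases le_total (ϑ e) (χ - Real.pi) with hle | hle
      · have e1 := h.outer.side_nonneg (ψ := χ - Real.pi - Real.pi) le_rfl he1.1 he1.2 fun u hu => by
          have hu' : u ∈ Icc p' p := ⟨hu.1, hu.2.trans he1.2⟩
          exact Real.sin_nonneg_of_nonneg_of_le_pi (by linarith [h.mono mp' hu' hu.1, hχ.2])
            (by linarith [h.mono hu' he1 hu.2])
        have e2 := side_add_pi (χ - Real.pi - Real.pi) (g e - g p')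
        have e3 := side_add_pi (χ - Real.pi) (g e - g p')
        rw [sub_add_cancel] at e2 e3
        have e4 : side χ (g p' - g p) = 0 := by
          rw [hD, side_polar, sub_self, Real.sin_zero, mul_zero]
        have e5 : side χ (g e - g p) = side χ (g e - g p') + side χ (g p' - g p) := by
          rw [← side_add]; congr 1; ring
        linarith
      · have e1 := h.outer.side_nonneg (ψ := χ - Real.pi) he1.1 he1.2 le_rfl fun u hu => by
          have hu' : u ∈ Icc p' p := ⟨he1.1.trans hu.1, hu.2⟩
          exact Real.sin_nonneg_of_nonneg_of_le_pi (by linarith [h.mono he1 hu' hu.1])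
            (by linarith [h.mono hu' mp hu.2, hχ.1])
        have e3 := side_add_pi (χ - Real.pi) (g p - g e)
        rw [sub_add_cancel] at e3
        have e5 : side χ (g e - g p) = -side χ (g p - g e) := by simp only [side_sub]; ring
        linarith
    have e1 : side χ (g e - g p) = side χ (g e - (g p + k * (g p' - g p))) := by
      rw [← sub_sub, side_sub _ (g e - g p), side_smul]
      rw [show side χ (g p' - g p) = 0 by rw [hD, side_polar, sub_self, Real.sin_zero, mul_zero]]
      ring
    rw [e1, side, Complex.sub_im, he0, hz, Complex.sub_re] at hside
    have e2 := hD.im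
    rw [Complex.sub_im] at e2
    have e3 : Real.sin χ < 0 := by
      by_contra hcon
      push Not at hcon
      nlinarith [mul_nonneg (norm_nonneg (g p' - g p)) hcon]
    nlinarith
  by_contra hcon
  push Not at hcon
  have hne : ∀ t ∈ Ico p' q, ∀ u ∈ Icc q q', g t ≠ g u := fun t ht u hu =>
    h.injective t ⟨ht.1, by linarith [ht.2, hu.1, hu.2]⟩ u
      ⟨by linarith [ht.1, ht.2, hu.1], hu.2⟩ (ht.2.trans_le hu.1)
  have heq : e ∈ Ico p' q := ⟨he1.1, hep.trans h.lt₂⟩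
  have he_neg : (g e).re < 0 := lt_of_le_of_ne hcon fun h' =>
    hne e heq q' hc.right_mem_Icc (by
      rw [hc.right_end]
      exact Complex.ext (by simpa using h') (by simpa using he0))
  have heW : g e ∈ leftOfTangents g ϑ q q' := hc.chord_mem he0 (by linarith) he_neg
  have hWo := isOpen_leftOfTangents hc.continuous_curve hc.continuous q q'
  have hKo := isOpen_cap hc.continuous_curve hc.continuous q q'
  -- If `g e` is on the open chord of the inner arc, the outer arc followed backwards from `e`
  -- enters the cap. It stays below the axis and cannot meet the inner arc, so `p'` is in the cap
  -- too.
  have hp'K : g p' ∈ cap g ϑ q q' := by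
    have h1 : ∀ᶠ t in 𝓝[<] e, g t ∈ leftOfTangents g ϑ q q' :=
      (hc.continuous_curve.tendsto e).mono_left nhdsWithin_le_nhds (hWo.mem_nhds heW)
    obtain ⟨t, ht, htW⟩ := (Filter.Eventually.and (Ioo_mem_nhdsLT hp'e) h1).exists
    have hsub := (isPreconnected_Ico (a := p') (b := e)).subset_left_of_subset_union
      (hKo.preimage hc.continuous_curve)
      (isClosed_closure.isOpen_compl.preimage hc.continuous_curve :
        IsOpen (g ⁻¹' (closure (cap g ϑ q q'))ᶜ))
      (by
        rw [Set.disjoint_left]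
        exact fun x hx hx' => hx' (subset_closure hx))
      (by
        intro x hx
        by_cases hxc : g x ∈ closure (cap g ϑ q q')
        · refine Or.inl (hc.mem_cap_of_not_mem_arc hxc (hdown x hx) ?_)
          rintro ⟨u, hu, hux⟩
          exact hne x ⟨hx.1, hx.2.trans heq.2⟩ u hu hux.symm
        · exact Or.inr hxc)
      ⟨t, (show t ∈ Ico p' e from ⟨ht.1.le, ht.2⟩), hdown t ⟨ht.1.le, ht.2⟩, htW⟩
    exact hsub ⟨le_rfl, hp'e⟩
  have hzW : g p + k * (g p' - g p) ∈ leftOfTangents g ϑ q q' :=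
    hc.chord_mem hz hzre (by linarith)
  have hk1 : k < 1 := by
    rw [Complex.add_im, Complex.im_ofReal_mul, Complex.sub_im] at hz
    by_contra hcon
    push Not at hcon
    nlinarith
  -- The meeting point `g s` lies between the crossing with the axis and `g p'`, at the fraction `(l
  -- - k) / (1 - k)`. Both ends are strictly left of all tangents, whereas a point of the arc is
  -- not.
  have hsW : g s ∈ leftOfTangents g ϑ q q' := by
    have hconv := convex_leftOfTangents g ϑ q q'
    have ha : 0 ≤ (l - k) / (1 - k) := div_nonneg (by linarith) (by linarith)
    have hb : 0 ≤ 1 - (l - k) / (1 - k) := by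
      rw [sub_nonneg, div_le_one (by linarith)]; linarith
    have := hconv hzW hp'K.2 hb ha (by ring)
    convert this using 1
    rw [hl, Complex.real_smul, Complex.real_smul]
    have hne1 : (1 - k : ℂ) ≠ 0 := by
      rw [sub_ne_zero]; exact_mod_cast hk1.ne'
    push_cast
    field_simp
    ring
  have := hsW s hs
  simp [side] at this

end NestedArcs

/-! ### Tangent angle and curvature of piecewise `C²` curves -/

theorem Piecewise.exists_finite {L : ℝ} {P : ℝ → ℝ → Prop} (h : Piecewise L P) :
    ∃ F : Set ℝ, F.Finite ∧ ∀ s ∈ Icc 0 L, s ∉ F → ∃ c d, 0 ≤ c ∧ d ≤ L ∧ s ∈ Ioo c d ∧ P c d := by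
  obtain ⟨n, a, h0, hn, hlt, hP⟩ := h
  have hmono : ∀ i j, i ≤ j → j ≤ n → a i ≤ a j := by
    intro i j hij
    induction j, hij using Nat.le_induction with
    | base => intro; exact le_rfl
    | succ j hij ih => intro hj; exact (ih (by omega)).trans (hlt j (by omega)).le
  refine ⟨a '' Iic n, (finite_Iic n).image a, fun s hs hsF => ?_⟩
  have key : ∀ m ≤ n, s < a m → ∃ i < m, s ∈ Ioo (a i) (a (i + 1)) := by
    intro m
    induction m with
    | zero => intro _ h; rw [h0] at h; exact absurd hs.1 (not_le.2 h)
    | succ m ih =>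
      intro hm hsm
      rcases lt_trichotomy s (a m) with h1 | h1 | h1
      · obtain ⟨i, hi, hi'⟩ := ih (by omega) h1
        exact ⟨i, by omega, hi'⟩
      · exact absurd ⟨m, (by simp; omega : m ∈ Iic n), h1.symm⟩ hsF
      · exact ⟨m, by omega, h1, hsm⟩
  have hsn : s < a n := lt_of_le_of_ne (hn ▸ hs.2) fun e => hsF ⟨n, by simp, e.symm⟩
  obtain ⟨i, hi, hi'⟩ := key n le_rfl hsn
  exact ⟨a i, a (i + 1), h0 ▸ hmono 0 i (by omega) (by omega),
    hn ▸ hmono (i + 1) n (by omega) le_rfl, hi', hP i hi⟩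

theorem Piecewise.intervalIntegrable {L : ℝ} {P : ℝ → ℝ → Prop} (h : Piecewise L P) {f : ℝ → ℝ}
    (hf : ∀ c d, c < d → P c d → IntervalIntegrable f MeasureTheory.volume c d) :
    IntervalIntegrable f MeasureTheory.volume 0 L := by
  obtain ⟨n, a, h0, hn, hlt, hP⟩ := h
  rw [← h0, ← hn]
  exact IntervalIntegrable.trans_iterate fun k hk => hf _ _ (hlt k hk) (hP k hk)

/-- On a piece of class `C²` the second derivative exists and the curvature is continuous. -/
theorem exists_curvature_of_contDiffOn {γ : ℝ → ℂ} {c d : ℝ} (hcd : c < d)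
    (h : ContDiffOn ℝ 2 γ (Icc c d)) :
    ∃ κ : ℝ → ℝ, ContinuousOn κ (Icc c d) ∧ ∀ s ∈ Ioo c d, curvature γ s = κ s ∧
      HasDerivAt (deriv γ) (deriv (deriv γ) s) s := by
  have hu : UniqueDiffOn ℝ (Icc c d) := uniqueDiffOn_Icc hcd
  have h1 : ContDiffOn ℝ 1 (derivWithin γ (Icc c d)) (Icc c d) :=
    h.derivWithin hu (by norm_num)
  have h2 : ContinuousOn (derivWithin (derivWithin γ (Icc c d)) (Icc c d)) (Icc c d) :=
    h1.continuousOn_derivWithin hu le_rfl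
  have e1 : ∀ s ∈ Ioo c d, deriv γ s = derivWithin γ (Icc c d) s := fun s hs =>
    (derivWithin_of_mem_nhds (Icc_mem_nhds hs.1 hs.2)).symm
  have e2 : ∀ s ∈ Ioo c d, deriv γ =ᶠ[𝓝 s] derivWithin γ (Icc c d) := fun s hs => by
    filter_upwards [Ioo_mem_nhds hs.1 hs.2] with t ht using e1 t ht
  have e3 : ∀ s ∈ Ioo c d, deriv (deriv γ) s =
      derivWithin (derivWithin γ (Icc c d)) (Icc c d) s := fun s hs => by
    rw [(e2 s hs).deriv_eq, derivWithin_of_mem_nhds (Icc_mem_nhds hs.1 hs.2)]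
  refine ⟨fun s => inner ℝ (derivWithin (derivWithin γ (Icc c d)) (Icc c d) s)
    (Complex.I * derivWithin γ (Icc c d) s),
    ContinuousOn.inner (𝕜 := ℝ) h2 (continuousOn_const.mul h1.continuousOn), fun s hs => ⟨?_, ?_⟩⟩
  · rw [curvature, e1 s hs, e3 s hs]
  · have : DifferentiableAt ℝ (derivWithin γ (Icc c d)) s :=
      (h1.differentiableOn one_ne_zero s (Ioo_subset_Icc_self hs)).differentiableAt
        (Icc_mem_nhds hs.1 hs.2)
    exact (this.congr_of_eventuallyEq (e2 s hs)).hasDerivAt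

/-- The Frenet equation: a unit vector field rotates with its curvature. -/
theorem eq_curvature_smul {v : ℝ → ℂ} {v' : ℂ} {s : ℝ} (h : HasDerivAt v v' s)
    (hv : ∀ᶠ t in 𝓝 s, ‖v t‖ = 1) :
    v' = (inner ℝ v' (Complex.I * v s) : ℝ) * (Complex.I * v s) := by
  have h1 : HasDerivAt (fun t => ‖v t‖ ^ 2) 0 s := by
    refine (hasDerivAt_const s (1 : ℝ)).congr_of_eventuallyEq ?_
    filter_upwards [hv] with t ht
    rw [ht, one_pow]
  have h2 := h.norm_sq.unique h1
  have h3 : (v s).re ^ 2 + (v s).im ^ 2 = 1 := by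
    have := hv.self_of_nhds
    have h4 := Complex.sq_norm (v s)
    rw [this, Complex.normSq_apply] at h4
    linarith
  have h5 : (v s).re * v'.re + (v s).im * v'.im = 0 := by
    rw [Complex.inner, Complex.mul_re, Complex.conj_re, Complex.conj_im] at h2
    linarith
  refine Complex.ext ?_ ?_ <;>
  simp only [Complex.inner, Complex.mul_re, Complex.conj_re, Complex.conj_im, Complex.I_re,
    Complex.I_im, Complex.mul_im, Complex.ofReal_re, Complex.ofReal_im]
  · linear_combination (-v'.re) * h3 + (v s).re * h5
  · linear_combination (-v'.im) * h3 + (v s).im * h5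

/-- The tangent angle of a piecewise `C²` curve with respect to its curvature. -/
structure HasCurvatureAngle (γ : ℝ → ℂ) (ϑ : ℝ → ℝ) (a b : ℝ) : Prop extends
    HasAngle γ ϑ a b where
  total : ∀ s ∈ Icc a b, ∀ t ∈ Icc a b, totalCurvature γ s t = ϑ t - ϑ s
  integrable : ∀ s ∈ Icc a b, ∀ t ∈ Icc a b,
    IntervalIntegrable (curvature γ) MeasureTheory.volume s t

theorem HasAngle.hasDerivWithinAt {γ : ℝ → ℂ} {ϑ : ℝ → ℝ} {a b s : ℝ} (h : HasAngle γ ϑ a b)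
    (hs : s ∈ Icc a b) : HasDerivWithinAt γ (Complex.exp (ϑ s * Complex.I)) (Icc a b) s := by
  have ha : a ∈ Icc a b := ⟨le_rfl, hs.1.trans hs.2⟩
  have h1 : HasDerivAt (fun t => γ a + ∫ u in a..t, Complex.exp (ϑ u * Complex.I))
      (Complex.exp (ϑ s * Complex.I)) s :=
    (h.continuous_exp.integral_hasStrictDerivAt a s).hasDerivAt.const_add _
  refine h1.hasDerivWithinAt.congr (fun t ht => ?_) ?_
  · rw [← h.integral_eq a ha t ht]; ring
  · rw [← h.integral_eq a ha s hs]; ring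

theorem HasAngle.hasDerivAt {γ : ℝ → ℂ} {ϑ : ℝ → ℝ} {a b s : ℝ} (h : HasAngle γ ϑ a b)
    (hs : s ∈ Ioo a b) : HasDerivAt γ (Complex.exp (ϑ s * Complex.I)) s :=
  (h.hasDerivWithinAt (Ioo_subset_Icc_self hs)).hasDerivAt (Icc_mem_nhds hs.1 hs.2)

theorem HasAngle.derivWithin_eq {γ : ℝ → ℂ} {ϑ : ℝ → ℝ} {a b s : ℝ} (h : HasAngle γ ϑ a b)
    (hab : a < b) (hs : s ∈ Icc a b) :
    derivWithin γ (Icc a b) s = Complex.exp (ϑ s * Complex.I) :=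
  (h.hasDerivWithinAt hs).derivWithin (uniqueDiffOn_Icc hab s hs)

theorem IsAdmissible.exists_angle {γ : ℝ → ℂ} {L : ℝ} (h : IsAdmissible γ L) :
    ∃ ϑ : ℝ → ℝ, HasCurvatureAngle γ ϑ 0 L := by
  have hL := h.length_pos
  have h0 : (0 : ℝ) ∈ Icc 0 L := ⟨le_rfl, hL.le⟩
  have hu : UniqueDiffOn ℝ (Icc 0 L) := uniqueDiffOn_Icc hL
  set v : ℝ → ℂ := derivWithin γ (Icc 0 L) with hv
  have hvc : ContinuousOn v (Icc 0 L) := h.contDiffOn.continuousOn_derivWithin hu le_rfl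
  have hvd : ∀ s ∈ Ioo 0 L, HasDerivAt γ (v s) s := fun s hs => by
    have h1 : HasDerivWithinAt γ (v s) (Icc 0 L) s :=
      (h.contDiffOn.differentiableOn one_ne_zero s (Ioo_subset_Icc_self hs)).hasDerivWithinAt
    exact h1.hasDerivAt (Icc_mem_nhds hs.1 hs.2)
  have hvderiv : ∀ s ∈ Ioo 0 L, deriv γ =ᶠ[𝓝 s] v := fun s hs => by
    filter_upwards [Ioo_mem_nhds hs.1 hs.2] with t ht using (hvd t ht).deriv
  obtain ⟨F, hF, hFP⟩ := h.piecewise_C2.exists_finite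
  have hint : IntervalIntegrable (curvature γ) MeasureTheory.volume 0 L := by
    refine h.piecewise_C2.intervalIntegrable fun c d hcd hP => ?_
    obtain ⟨κ, hκ, he⟩ := exists_curvature_of_contDiffOn hcd hP
    rw [intervalIntegrable_congr_uIoo (g := κ) (fun s hs => by
      rw [uIoo_of_le hcd.le] at hs; exact (he s hs).1)]
    exact ContinuousOn.intervalIntegrable (by rwa [uIcc_of_le hcd.le])
  have hsub : ∀ s ∈ Icc 0 L, ∀ t ∈ Icc 0 L,
      IntervalIntegrable (curvature γ) MeasureTheory.volume s t := fun s hs t ht =>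
    hint.mono_set (by
      rw [uIcc_of_le hL.le]
      exact uIcc_subset_Icc hs ht)
  set k : ℝ → ℝ := fun s => ∫ u in (0)..s, curvature γ u with hk
  have hkc : ContinuousOn k (Icc 0 L) := by
    have := intervalIntegral.continuousOn_primitive_interval (a := 0) (b := L)
      (f := curvature γ) (μ := MeasureTheory.volume) (by
        rw [← intervalIntegrable_iff']; exact hint)
    rwa [uIcc_of_le hL.le] at this
  -- By the Frenet equation this product has derivative `0` away from the breakpoints. It is
  -- continuous, so finitely many exceptions do not matter.
  have hconst : ∀ s ∈ Icc 0 L, v s * Complex.exp ((-k s : ℝ) * Complex.I) = v 0 := by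
    intro s hs
    have hcont : ContinuousOn (fun s => v s * Complex.exp ((-k s : ℝ) * Complex.I)) (Icc 0 s) := by
      have h1 := hvc.mono (Icc_subset_Icc_right hs.2)
      have h2 := hkc.mono (Icc_subset_Icc_right hs.2)
      fun_prop
    have := MeasureTheory.integral_eq_of_hasDerivAt_off_countable_of_le
      (fun s => v s * Complex.exp ((-k s : ℝ) * Complex.I)) (fun _ => 0) hs.1 hF.countable hcont
      (fun x hx => by
        have hx' : x ∈ Ioo 0 L := ⟨hx.1.1, hx.1.2.trans_le hs.2⟩
        obtain ⟨c, d, -, -, hxcd, hP⟩ := hFP x (Ioo_subset_Icc_self hx') hx.2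
        obtain ⟨κ, hκ, he⟩ := exists_curvature_of_contDiffOn (hxcd.1.trans hxcd.2) hP
        have hd1 : HasDerivAt v (deriv (deriv γ) x) x :=
          ((he x hxcd).2).congr_of_eventuallyEq (hvderiv x hx').symm
        have hcc : ContinuousOn (curvature γ) (Ioo c d) :=
          (hκ.mono Ioo_subset_Icc_self).congr fun y hy => (he y hy).1
        have hd2 : HasDerivAt k (curvature γ x) x :=
          intervalIntegral.integral_hasDerivAt_right (hsub 0 h0 x (Ioo_subset_Icc_self hx'))
            (hcc.stronglyMeasurableAtFilter isOpen_Ioo x hxcd)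
            (hcc.continuousAt (Ioo_mem_nhds hxcd.1 hxcd.2))
        have hfr := eq_curvature_smul hd1 (by
          filter_upwards [Ioo_mem_nhds hx'.1 hx'.2] with t ht
          exact h.unit_speed t (Ioo_subset_Icc_self ht))
        have hcurv : (inner ℝ (deriv (deriv γ) x) (Complex.I * v x) : ℝ) = curvature γ x := by
          rw [curvature, (hvd x hx').deriv]
        rw [hcurv] at hfr
        have hd3 : HasDerivAt (fun s => Complex.exp ((-k s : ℝ) * Complex.I))
            (Complex.exp ((-k x : ℝ) * Complex.I) * ((-curvature γ x : ℝ) * Complex.I)) x :=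
          ((hd2.neg.ofReal_comp).mul_const Complex.I).cexp
        refine (hd1.mul hd3).congr_deriv ?_
        rw [hfr]
        push_cast
        ring)
      (by simp)
    simp only [intervalIntegral.integral_zero] at this
    have e0 : k 0 = 0 := by simp [hk]
    rw [e0] at this
    simp at this
    have := (sub_eq_zero.1 this.symm)
    simpa using this
  set φ : ℝ := (v 0).arg with hφ
  have hv0 : v 0 = Complex.exp (φ * Complex.I) := by
    have := Complex.norm_mul_exp_arg_mul_I (v 0)
    rw [h.unit_speed 0 h0] at this
    simpa using this.symm
  -- The projection extends the angle by constants beyond `[0, L]`, which makes it continuous on the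
  -- whole line.
  set ϑ : ℝ → ℝ := fun s => φ + k (projIcc 0 L hL.le s) with hϑ
  have hϑe : ∀ s ∈ Icc 0 L, ϑ s = φ + k s := fun s hs => by
    simp only [hϑ, projIcc_of_mem hL.le hs]
  have hϑc : Continuous ϑ := continuous_const.add
    ((continuousOn_iff_continuous_domRestrict.1 hkc).comp continuous_projIcc)
  have hvϑ : ∀ s ∈ Icc 0 L, v s = Complex.exp (ϑ s * Complex.I) := by
    intro s hs
    have h1 := hconst s hs
    rw [hϑe s hs]
    push_cast
    rw [add_mul, Complex.exp_add, ← hv0, ← h1, mul_assoc, ← Complex.exp_add]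
    simp
  have hgle : ∀ s ∈ Icc 0 L, ∀ t ∈ Icc 0 L, s ≤ t →
      γ t - γ s = ∫ u in s..t, Complex.exp (ϑ u * Complex.I) := by
    intro s hs t ht hst
    refine (MeasureTheory.integral_eq_of_hasDerivAt_off_countable_of_le γ _ hst
      (countable_empty) (h.contDiffOn.continuousOn.mono (Icc_subset_Icc hs.1 ht.2))
      (fun x hx => ?_) ?_).symm
    · have hx' : x ∈ Ioo 0 L := ⟨hs.1.trans_lt hx.1.1, hx.1.2.trans_le ht.2⟩
      rw [← hvϑ x (Ioo_subset_Icc_self hx')]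
      exact hvd x hx'
    · apply Continuous.intervalIntegrable; fun_prop
  refine ⟨ϑ, ⟨⟨hϑc, fun s hs t ht => ?_⟩, fun s hs t ht => ?_, hsub⟩⟩
  · rcases le_total s t with hst | hts
    · exact hgle s hs t ht hst
    · rw [intervalIntegral.integral_symm, ← hgle t ht s hs hts]; ring
  · rw [hϑe s hs, hϑe t ht, totalCurvature,
      ← intervalIntegral.integral_interval_sub_left (hsub 0 h0 t ht) (hsub 0 h0 s hs)]
    ring

section CurvatureAngle

variable {γ : ℝ → ℂ} {ϑ : ℝ → ℝ} {a b : ℝ}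

theorem HasCurvatureAngle.mono (h : HasCurvatureAngle γ ϑ a b) {c d : ℝ} (hac : a ≤ c)
    (hdb : d ≤ b) : HasCurvatureAngle γ ϑ c d :=
  ⟨h.toHasAngle.mono hac hdb, fun _ hs _ ht => h.total _ (Icc_subset_Icc hac hdb hs) _
    (Icc_subset_Icc hac hdb ht), fun _ hs _ ht => h.integrable _ (Icc_subset_Icc hac hdb hs) _
    (Icc_subset_Icc hac hdb ht)⟩

theorem HasCurvatureAngle.monotoneOn (h : HasCurvatureAngle γ ϑ a b) {F : Set ℝ}
    (hF : F.Countable) (hk : ∀ u ∈ Ioo a b, u ∉ F → 0 ≤ curvature γ u) :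
    MonotoneOn ϑ (Icc a b) := by
  intro x hx y hy hxy
  have h1 : 0 ≤ totalCurvature γ x y := by
    rw [totalCurvature, intervalIntegral.integral_of_le hxy,
      MeasureTheory.integral_Ioc_eq_integral_Ioo]
    refine MeasureTheory.integral_nonneg_of_ae ?_
    rw [EventuallyLE, MeasureTheory.ae_restrict_iff' measurableSet_Ioo]
    have : ∀ᵐ u ∂(MeasureTheory.volume : MeasureTheory.Measure ℝ), u ∉ F :=
      hF.ae_notMem _
    filter_upwards [this] with u hu hu'
    exact hk u ⟨hx.1.trans_lt hu'.1, hu'.2.trans_le hy.2⟩ hu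
  rw [h.total x hx y hy] at h1
  linarith

theorem HasCurvatureAngle.antitoneOn (h : HasCurvatureAngle γ ϑ a b) {F : Set ℝ}
    (hF : F.Countable) (hk : ∀ u ∈ Ioo a b, u ∉ F → curvature γ u ≤ 0) :
    AntitoneOn ϑ (Icc a b) := by
  intro x hx y hy hxy
  have h1 : 0 ≤ - totalCurvature γ x y := by
    rw [totalCurvature, ← intervalIntegral.integral_neg, intervalIntegral.integral_of_le hxy,
      MeasureTheory.integral_Ioc_eq_integral_Ioo]
    refine MeasureTheory.integral_nonneg_of_ae ?_
    rw [EventuallyLE, MeasureTheory.ae_restrict_iff' measurableSet_Ioo]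
    have : ∀ᵐ u ∂(MeasureTheory.volume : MeasureTheory.Measure ℝ), u ∉ F :=
      hF.ae_notMem _
    filter_upwards [this] with u hu hu'
    exact neg_nonneg.2 (hk u ⟨hx.1.trans_lt hu'.1, hu'.2.trans_le hy.2⟩ hu)
  rw [h.total x hx y hy] at h1
  linarith

/-- Immediately after a point of positive curvature there are further points of positive
curvature, outside of any given countable set. -/
theorem HasCurvatureAngle.exists_curvature_pos (h : HasCurvatureAngle γ ϑ a b) {u t : ℝ}
    (hu : u ∈ Ioo a b) (hk : 0 < curvature γ u) (hut : u < t) {F : Set ℝ} (hF : F.Countable) :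
    ∃ u' ∈ Ioo u t, u' ∉ F ∧ 0 < curvature γ u' := by
  -- Where the second derivative does not exist, its default value makes the curvature `0`, so
  -- positive curvature implies differentiability even at a breakpoint.
  have hdd : DifferentiableAt ℝ (deriv γ) u := by
    by_contra hc
    rw [curvature, deriv_zero_of_not_differentiableAt hc] at hk
    simp at hk
  set w₀ : ℂ := Complex.I * deriv γ u
  have hd : HasDerivAt (fun w => inner ℝ (deriv γ w) w₀) (curvature γ u) u := by
    have := hdd.hasDerivAt.inner ℝ (hasDerivAt_const u w₀)
    simpa [curvature, w₀] using this
  have hval : ∀ w ∈ Ioo a b, (inner ℝ (deriv γ w) w₀ : ℝ) = Real.sin (ϑ w - ϑ u) := by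
    intro w hw
    simp only [w₀, (h.hasDerivAt hw).deriv, (h.hasDerivAt hu).deriv]
    rw [Complex.inner, Real.sin_sub]
    simp [Complex.exp_ofReal_mul_I_re, Complex.exp_ofReal_mul_I_im]
    ring
  have h0 : (inner ℝ (deriv γ u) w₀ : ℝ) = 0 := by rw [hval u hu]; simp
  have h1 : ∀ᶠ w in 𝓝[>] u, 0 < (inner ℝ (deriv γ w) w₀ : ℝ) := by
    have h2 := (hasDerivAt_iff_tendsto_slope.1 hd).eventually (lt_mem_nhds hk)
    have h3 : ∀ᶠ w in 𝓝[>] u, 0 < slope (fun w => (inner ℝ (deriv γ w) w₀ : ℝ)) u w :=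
      h2.filter_mono (nhdsWithin_mono _ fun x hx => ne_of_gt hx)
    filter_upwards [h3, self_mem_nhdsWithin] with w hw hw'
    rw [slope_def_field, h0, sub_zero] at hw
    exact (div_pos_iff_of_pos_right (sub_pos.2 hw')).1 hw
  have h2 : ∀ᶠ w in 𝓝[>] u, ϑ w < ϑ u + Real.pi ∧ ϑ u - Real.pi < ϑ w :=
    (((h.continuous.tendsto u).eventually (gt_mem_nhds (by linarith [Real.pi_pos]))).and
      ((h.continuous.tendsto u).eventually (lt_mem_nhds (by linarith [Real.pi_pos])))).filter_mono
      nhdsWithin_le_nhds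
  have h3 : ∀ᶠ w in 𝓝[>] u, w ∈ Ioo u (min b t) := Ioo_mem_nhdsGT (lt_min hu.2 hut)
  obtain ⟨w, hw1, hw2, hw3⟩ := (h1.and (h2.and h3)).exists
  have hwb : w < b := hw3.2.trans_le (min_le_left _ _)
  have hwt : w < t := hw3.2.trans_le (min_le_right _ _)
  rw [hval w ⟨hu.1.trans hw3.1, hwb⟩] at hw1
  by_contra hc
  push Not at hc
  -- By the derivative at `u` the tangent has turned strictly left at `w`. With nonpositive
  -- curvature in between, up to a countable set, it could not have done so.
  have := (h.mono hu.1.le hwb.le).antitoneOn hF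
    (fun x hx hxF => hc x ⟨hx.1, hx.2.trans hwt⟩ hxF)
    (left_mem_Icc.2 hw3.1.le) (right_mem_Icc.2 hw3.1.le) hw3.1.le
  have h4 := Real.sin_nonpos_of_nonpos_of_neg_pi_le (x := ϑ w - ϑ u) (by linarith)
    (by linarith [hw2.2])
  linarith

end CurvatureAngle

/-! ### No arc turns right by `π` -/

/-- A compact family of arcs on which the curvature has the sign `σ` and which contain a given
interval has a member of largest total curvature. -/
theorem exists_maximal_arc {C : Set (ℝ × ℝ)} (hC : IsCompact C) {ϑ k : ℝ → ℝ}
    (hϑ : Continuous ϑ) (σ : ℝ) {s t : ℝ} (hst : (s, t) ∈ C) (hk : ∀ u ∈ Ioo s t, 0 ≤ σ * k u) :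
    ∃ s' t', (s', t') ∈ C ∧ s' ≤ s ∧ t ≤ t' ∧ (∀ u ∈ Ioo s' t', 0 ≤ σ * k u) ∧
      ∀ s'' t'', (s'', t'') ∈ C → s'' ≤ s → t ≤ t'' → (∀ u ∈ Ioo s'' t'', 0 ≤ σ * k u) →
        σ * (ϑ t'' - ϑ s'') ≤ σ * (ϑ t' - ϑ s') := by
  -- Written as a disjunction, the sign condition on the open interval is visibly closed in the
  -- endpoints, although `k` need not be continuous.
  set D : Set (ℝ × ℝ) := {x | x.1 ≤ s ∧ t ≤ x.2 ∧ ∀ u, u ≤ x.1 ∨ x.2 ≤ u ∨ 0 ≤ σ * k u} with hD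
  have hDc : IsClosed D := by
    refine (isClosed_le continuous_fst continuous_const).inter
      ((isClosed_le continuous_const continuous_snd).inter ?_)
    have : {x : ℝ × ℝ | ∀ u, u ≤ x.1 ∨ x.2 ≤ u ∨ 0 ≤ σ * k u} =
      ⋂ u, ({x | u ≤ x.1} ∪ ({x | x.2 ≤ u} ∪ {x | 0 ≤ σ * k u})) := by
      ext x; simp
    change IsClosed {x : ℝ × ℝ | ∀ u, u ≤ x.1 ∨ x.2 ≤ u ∨ 0 ≤ σ * k u}
    rw [this]
    exact isClosed_iInter fun u => (isClosed_le continuous_const continuous_fst).union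
      ((isClosed_le continuous_snd continuous_const).union isClosed_const)
  have hmem : ∀ s' t', (s', t') ∈ D ↔ s' ≤ s ∧ t ≤ t' ∧ ∀ u ∈ Ioo s' t', 0 ≤ σ * k u := by
    intro s' t'
    simp only [hD, mem_ofPred_eq, mem_Ioo]
    refine and_congr_right fun _ => and_congr_right fun _ => forall_congr' fun u => ?_
    constructor
    · rintro (h | h | h) h'
      · linarith
      · linarith
      · exact h
    · intro h
      by_cases h1 : u ≤ s'
      · exact Or.inl h1
      by_cases h2 : t' ≤ u
      · exact Or.inr (Or.inl h2)
      exact Or.inr (Or.inr (h ⟨not_le.1 h1, not_le.1 h2⟩))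
  obtain ⟨⟨s', t'⟩, hx, hmax⟩ := (hC.inter_right hDc).exists_isMaxOn
    ⟨(s, t), hst, (hmem s t).2 ⟨le_rfl, le_rfl, hk⟩⟩
    (f := fun x : ℝ × ℝ => σ * (ϑ x.2 - ϑ x.1)) (by fun_prop)
  obtain ⟨h1, h2, h3⟩ := (hmem s' t').1 hx.2
  exact ⟨s', t', hx.1, h1, h2, h3, fun s'' t'' h4 h5 h6 h7 =>
    hmax ⟨h4, (hmem s'' t'').2 ⟨h5, h6, h7⟩⟩⟩

/-- If the maximal convex arcs turn by more than `π` and the maximal concave arcs turn by less than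
`π`, then no arc turns by `-π` or less. -/
theorem neg_pi_lt_totalCurvature {A : ℝ → ℝ → Prop} {γ : ℝ → ℂ} {ϑ : ℝ → ℝ} {lo hi s₀ t₀ : ℝ}
    (h : HasCurvatureAngle γ ϑ lo hi) (hlo : lo ≤ s₀) (hst₀ : s₀ ≤ t₀) (hhi : t₀ ≤ hi)
    {C : Set (ℝ × ℝ)} (hC : IsCompact C)
    (hCsub : ∀ s t, (s, t) ∈ C → lo ≤ s ∧ t ≤ hi)
    (hCA : ∀ s t, ∀ u ∈ Ioo s₀ t₀, s < u → u < t → (A s t ↔ (s, t) ∈ C))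
    (hA : ∀ s t, s₀ ≤ s → s < t → t ≤ t₀ → A s t)
    (hloc : ∀ s t, s₀ ≤ s → t ≤ t₀ → ∀ u ∈ Ioo s t, 0 < curvature γ u →
      ∃ c d, A c d ∧ (∀ x ∈ Ioo c d, 0 ≤ curvature γ x) ∧
        ∃ u' ∈ Ioo c d, u' ∈ Ioo s t ∧ 0 < curvature γ u')
    (hconv : ∀ s t, IsMaximalConvexArc A γ s t → s₀ < s → t < t₀ →
      Real.pi < totalCurvature γ s t)
    (hconc : ∀ s t, IsMaximalConcaveArc A γ s t → -Real.pi < totalCurvature γ s t) :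
    -Real.pi < ϑ t₀ - ϑ s₀ := by
  by_contra hcon
  push Not at hcon
  have hcl : IsClosed {x : ℝ × ℝ | x.1 ≤ x.2 ∧ ϑ x.2 - ϑ x.1 ≤ -Real.pi} :=
    (isClosed_le continuous_fst continuous_snd).inter
      (isClosed_le ((h.continuous.comp continuous_snd).sub (h.continuous.comp continuous_fst))
        continuous_const)
  -- A shortest arc that turns by `-π` or less; all shorter ones obey the bound.
  obtain ⟨⟨s, t⟩, ⟨⟨hs, ht⟩, hst, hle⟩, hmin⟩ :=
    (((isCompact_Icc (a := s₀) (b := t₀)).prod (isCompact_Icc (a := s₀) (b := t₀))).inter_right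
      hcl).exists_isMinOn ⟨(s₀, t₀), ⟨left_mem_Icc.2 hst₀, right_mem_Icc.2 hst₀⟩, hst₀, hcon⟩
    (f := fun x : ℝ × ℝ => x.2 - x.1) (by fun_prop)
  simp only at hs ht hst hle
  have hmin' : ∀ s' t', s₀ ≤ s' → s' ≤ t' → t' ≤ t₀ → t' - s' < t - s → -Real.pi < ϑ t' - ϑ s' := by
    intro s' t' h1 h2 h3 h4
    by_contra h5
    have := hmin (show (s', t') ∈ _ from ⟨⟨⟨h1, h2.trans h3⟩, ⟨h1.trans h2, h3⟩⟩, h2, not_lt.1 h5⟩)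
    simp only [mem_ofPred_eq] at this
    linarith
  have hlt : s < t := lt_of_le_of_ne hst fun e => by
    rw [e] at hle; linarith [Real.pi_pos]
  have hpi := Real.pi_pos
  by_cases hneg : ∀ u ∈ Ioo s t, curvature γ u ≤ 0
  · have hne : ∃ u ∈ Ioo s t, curvature γ u ≠ 0 := by
      by_contra hc
      push Not at hc
      have := (h.mono (hlo.trans hs.1) (ht.2.trans hhi)).monotoneOn countable_empty
        (fun u hu _ => (hc u hu).ge) (left_mem_Icc.2 hst) (right_mem_Icc.2 hst) hst
      linarith
    obtain ⟨u, hu, hku⟩ := hne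
    have hu0 : u ∈ Ioo s₀ t₀ := ⟨hs.1.trans_lt hu.1, hu.2.trans_le ht.2⟩
    obtain ⟨s', t', hM, hs', ht', hkM, hmax⟩ := exists_maximal_arc hC h.continuous (-1)
      (k := curvature γ) ((hCA s t u hu0 hu.1 hu.2).1 (hA s t hs.1 hlt ht.2))
      (fun x hx => by linarith [hneg x hx])
    have hanti : ∀ x y, (x, y) ∈ C → (∀ u ∈ Ioo x y, curvature γ u ≤ 0) →
        AntitoneOn ϑ (Icc x y) := fun x y hxy hk =>
      (h.mono (hCsub x y hxy).1 (hCsub x y hxy).2).antitoneOn countable_empty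
        fun u hu _ => hk u hu
    have htot : ∀ x y, (x, y) ∈ C → x ≤ s → t ≤ y → totalCurvature γ x y = ϑ y - ϑ x := by
      intro x y hxy hx hy
      have := hCsub x y hxy
      exact h.total x ⟨this.1, by linarith⟩ y ⟨by linarith, this.2⟩
    have hkM' : ∀ u ∈ Ioo s' t', curvature γ u ≤ 0 := fun u hu => by linarith [hkM u hu]
    have hmono := hanti s' t' hM hkM'
    have hs't' : s' ≤ t' := hs'.trans (hst.trans ht')
    have hmaxarc : IsMaximalConcaveArc A γ s' t' := by
      refine ⟨⟨(hCA s' t' u hu0 (hs'.trans_lt hu.1) (hu.2.trans_le ht')).2 hM, hkM', u,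
        ⟨hs'.trans_lt hu.1, hu.2.trans_le ht'⟩, hku⟩, ?_⟩
      rintro ⟨x, y, ⟨hAxy, hkxy, -⟩, hx, hy, habs⟩
      have hxyC := (hCA x y u hu0 (hx.trans_lt (hs'.trans_lt hu.1))
        ((hu.2.trans_le ht').trans_le hy)).1 hAxy
      have h1 := hmax x y hxyC (hx.trans hs') (ht'.trans hy) fun u hu => by linarith [hkxy u hu]
      have hxy : x ≤ y := hx.trans (hs't'.trans hy)
      have h2 := hanti x y hxyC hkxy (left_mem_Icc.2 hxy) (right_mem_Icc.2 hxy) hxy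
      have h3 := hmono (left_mem_Icc.2 hs't') (right_mem_Icc.2 hs't') hs't'
      rw [htot _ _ hM hs' ht', htot _ _ hxyC (hx.trans hs') (ht'.trans hy),
        abs_of_nonpos (by linarith), abs_of_nonpos (by linarith)] at habs
      linarith
    have h1 := hconc s' t' hmaxarc
    rw [htot _ _ hM hs' ht'] at h1
    have h2 := hmono (left_mem_Icc.2 hs't') ⟨hs', hst.trans ht'⟩ hs'
    have h3 := hmono ⟨hs'.trans hst, ht'⟩ (right_mem_Icc.2 hs't') ht'
    linarith
  · push Not at hneg
    obtain ⟨u₁, hu₁, hk₁⟩ := hneg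
    obtain ⟨c, d, hAcd, hkcd, u, hucd, hu, hku⟩ := hloc s t hs.1 ht.2 u₁ hu₁ hk₁
    have hu0 : u ∈ Ioo s₀ t₀ := ⟨hs.1.trans_lt hu.1, hu.2.trans_le ht.2⟩
    obtain ⟨s', t', hM, hs', ht', hkM, hmax⟩ := exists_maximal_arc hC h.continuous 1
      (k := curvature γ) ((hCA c d u hu0 hucd.1 hucd.2).1 hAcd)
      (fun x hx => by linarith [hkcd x hx])
    have hmon : ∀ x y, (x, y) ∈ C → (∀ u ∈ Ioo x y, 0 ≤ curvature γ u) →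
        MonotoneOn ϑ (Icc x y) := fun x y hxy hk =>
      (h.mono (hCsub x y hxy).1 (hCsub x y hxy).2).monotoneOn countable_empty
        fun u hu _ => hk u hu
    have htot : ∀ x y, (x, y) ∈ C → x ≤ c → d ≤ y → totalCurvature γ x y = ϑ y - ϑ x := by
      intro x y hxy hx hy
      have := hCsub x y hxy
      exact h.total x ⟨this.1, by linarith [hucd.1, hucd.2]⟩ y
        ⟨by linarith [hucd.1, hucd.2], this.2⟩
    have hkM' : ∀ u ∈ Ioo s' t', 0 ≤ curvature γ u := fun u hu => by linarith [hkM u hu]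
    have hmono := hmon s' t' hM hkM'
    have hs'u : s' < u := hs'.trans_lt hucd.1
    have hut' : u < t' := hucd.2.trans_le ht'
    have hs't' : s' ≤ t' := (hs'u.trans hut').le
    have hmaxarc : IsMaximalConvexArc A γ s' t' := by
      refine ⟨⟨(hCA s' t' u hu0 hs'u hut').2 hM, hkM', u, ⟨hs'u, hut'⟩, hku.ne'⟩, ?_⟩
      rintro ⟨x, y, ⟨hAxy, hkxy, -⟩, hx, hy, habs⟩
      have hxyC := (hCA x y u hu0 (hx.trans_lt hs'u) (hut'.trans_le hy)).1 hAxy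
      have h1 := hmax x y hxyC (hx.trans hs') (ht'.trans hy) fun u hu => by linarith [hkxy u hu]
      have hxy : x ≤ y := hx.trans (hs't'.trans hy)
      have h2 := hmon x y hxyC hkxy (left_mem_Icc.2 hxy) (right_mem_Icc.2 hxy) hxy
      have h3 := hmono (left_mem_Icc.2 hs't') (right_mem_Icc.2 hs't') hs't'
      rw [htot _ _ hM hs' ht', htot _ _ hxyC (hx.trans hs') (ht'.trans hy),
        abs_of_nonneg (by linarith), abs_of_nonneg (by linarith)] at habs
      linarith
    -- If the maximal convex arc reaches beyond an end of the shortest arc, the common part turns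
    -- left and can be cut off, which leaves a shorter counterexample. Otherwise it lies inside and
    -- turns by more than `π`, while the two remaining pieces each turn by more than `-π`.
    rcases le_or_gt s' s with h1 | h1
    · have hm : s < min t' t := lt_min (hu.1.trans hut') hlt
      have h2 := hmono ⟨h1, (hu.1.trans hut').le⟩
        ⟨h1.trans hm.le, min_le_left t' t⟩ hm.le
      have h3 := hmin' (min t' t) t (hs.1.trans hm.le) (min_le_right _ _) ht.2 (by linarith)
      linarith
    rcases le_or_gt t t' with h2 | h2
    · have h3 := hmono (left_mem_Icc.2 hs't') ⟨(hs'u.trans hu.2).le, h2⟩ (hs'u.trans hu.2).le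
      have h4 := hmin' s s' hs.1 h1.le ((hs'u.trans hu0.2).le) (by linarith [hs'u, hu.2])
      linarith
    · have h3 := hconv s' t' hmaxarc (hs.1.trans_lt h1) (h2.trans_le ht.2)
      rw [htot _ _ hM hs' ht'] at h3
      have h4 := hmin' s s' hs.1 h1.le ((hs'u.trans hu0.2).le) (by linarith [hs'u, hu.2])
      have h5 := hmin' t' t ((hs.1.trans_lt (hu.1.trans hut')).le) h2.le ht.2
        (by linarith [hu.1, hut'])
      linarith

/-! ### The turning bound for smooth and for cusped curves -/

theorem periodic_deriv {E : Type*} [NormedAddCommGroup E] [NormedSpace ℝ E] {f : ℝ → E} {L : ℝ}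
    (h : Function.Periodic f L) : Function.Periodic (deriv f) L := fun x => by
  rw [← deriv_comp_add_const, show (fun x => f (x + L)) = f from funext h]

theorem periodic_curvature {γ : ℝ → ℂ} {L : ℝ} (h : Function.Periodic γ L) :
    Function.Periodic (curvature γ) L := fun x => by
  simp only [curvature, periodic_deriv h x, periodic_deriv (periodic_deriv h) x]

/-- Up to finitely many points, each point of the curve has a neighbourhood in which the curvature
does not change sign. -/
theorem IsAdmissible.exists_nonneg_interval {γ : ℝ → ℂ} {L : ℝ} (h : IsAdmissible γ L) :
    ∃ F : Set ℝ, F.Finite ∧ ∀ s ∈ Icc 0 L, s ∉ F → 0 < curvature γ s →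
      ∃ c d, 0 ≤ c ∧ d ≤ L ∧ s ∈ Ioo c d ∧ ∀ u ∈ Ioo c d, 0 ≤ curvature γ u := by
  obtain ⟨F, hF, hFP⟩ := h.finite_sign_changes.exists_finite
  refine ⟨F, hF, fun s hs hsF hk => ?_⟩
  obtain ⟨c, d, hc, hd, hscd, hP | hP⟩ := hFP s hs hsF
  · exact ⟨c, d, hc, hd, hscd, hP⟩
  · linarith [hP s hscd]

theorem ClassCPi.neg_pi_lt {γ : ℝ → ℂ} {L : ℝ} (h : ClassCPi γ L) {ϑ : ℝ → ℝ}
    (hϑ : HasCurvatureAngle γ ϑ 0 L) {s t : ℝ} (hs : 0 ≤ s) (hst : s ≤ t) (ht : t ≤ L) :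
    -Real.pi < ϑ t - ϑ s := by
  obtain ⟨F, hF, hFP⟩ := h.1.1.exists_nonneg_interval
  have hL := h.1.1.length_pos
  have hcl : IsClosed {x : ℝ × ℝ | x.1 ≤ x.2} := isClosed_le continuous_fst continuous_snd
  refine neg_pi_lt_totalCurvature (A := CuspFreeArc L) hϑ hs hst ht
    (((isCompact_Icc (a := 0) (b := L)).prod (isCompact_Icc (a := 0) (b := L))).inter_right hcl)
    (fun x y hxy => ⟨hxy.1.1.1, hxy.1.2.2⟩) (fun x y u hu hxu huy => ⟨fun hA => ?_, fun hC => ?_⟩)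
    (fun x y hx hxy hy => ⟨by linarith, hxy, by linarith⟩) (fun x y hx hy u hu hk => ?_)
    (fun x y hM hx hy => h.2.1 x y hM (by linarith) (by linarith))
    (fun x y hM => (h.2.2 x y hM).1)
  · exact ⟨⟨⟨hA.1, hA.2.1.le.trans hA.2.2⟩, ⟨hA.1.trans hA.2.1.le, hA.2.2⟩⟩, hA.2.1.le⟩
  · exact ⟨hC.1.1.1, hxu.trans huy, hC.1.2.2⟩
  -- At a cut point between sign intervals there may be no neighbourhood of constant sign, so the
  -- point of positive curvature is first moved off the cut points.
  · obtain ⟨u', hu', hu'F, hk'⟩ := (hϑ.mono (by linarith) (by linarith)).exists_curvature_pos hu hk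
      hu.2 hF.countable
    obtain ⟨c, d, hc, hd, hm, hcd⟩ := hFP u' ⟨by linarith [hu.1, hu'.1], by linarith [hu'.2]⟩ hu'F hk'
    exact ⟨c, d, ⟨hc, hm.1.trans hm.2, hd⟩, hcd, u', hm, ⟨hu.1.trans hu'.1, hu'.2⟩, hk'⟩

/-- A closed smooth curve has a tangent angle along its whole periodic extension. -/
theorem ClassK.exists_angle {γ : ℝ → ℂ} {L : ℝ} (h : ClassK γ L) :
    ∃ ϑ : ℝ → ℝ, ∀ a b, HasCurvatureAngle γ ϑ a b := by
  obtain ⟨ϑ₀, h₀⟩ := h.1.exists_angle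
  have hL := h.1.length_pos
  have l0 : (0 : ℝ) ∈ Icc 0 L := ⟨le_rfl, hL.le⟩
  have l1 : L ∈ Icc 0 L := ⟨hL.le, le_rfl⟩
  have hkp := periodic_curvature h.1.periodic
  have hint : ∀ s t, IntervalIntegrable (curvature γ) MeasureTheory.volume s t := fun s t =>
    hkp.intervalIntegrable₀ hL.ne' (h₀.integrable 0 l0 L l1) s t
  set ϑ : ℝ → ℝ := fun s => ϑ₀ 0 + ∫ u in (0)..s, curvature γ u with hϑ
  have hϑc : Continuous ϑ :=
    continuous_const.add (intervalIntegral.continuous_primitive (fun _ _ => hint _ _) 0)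
  have htot : ∀ s t, totalCurvature γ s t = ϑ t - ϑ s := fun s t => by
    rw [totalCurvature, ← intervalIntegral.integral_interval_sub_left (hint 0 t) (hint 0 s)]
    simp only [hϑ]; ring
  have heq : ∀ s ∈ Icc 0 L, ϑ s = ϑ₀ s := fun s hs => by
    have := h₀.total 0 l0 s hs
    simp only [hϑ]
    rw [totalCurvature] at this
    linarith
  have hexp : Function.Periodic (fun s => Complex.exp (ϑ s * Complex.I)) L := by
    intro s
    have e1 : ϑ (s + L) = ϑ s + (ϑ₀ L - ϑ₀ 0) := by
      have := htot s (s + L)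
      rw [totalCurvature, hkp.intervalIntegral_add_eq s 0, zero_add] at this
      have h2 := h₀.total 0 l0 L l1
      rw [totalCurvature] at h2
      linarith
    have e2 : Complex.exp (ϑ₀ L * Complex.I) = Complex.exp (ϑ₀ 0 * Complex.I) := by
      rw [← h₀.derivWithin_eq hL l0, ← h₀.derivWithin_eq hL l1, h.2]
    simp only [e1]
    push_cast
    rw [add_mul, Complex.exp_add, sub_mul, Complex.exp_sub, e2, div_self (Complex.exp_ne_zero _),
      mul_one]
  have hec : Continuous fun s => Complex.exp (ϑ s * Complex.I) := by fun_prop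
  -- The defect of the integral formula vanishes on one period. It is periodic because the tangent
  -- vectors match at the closing point (`hexp`) and the curve closes up.
  set G : ℝ → ℂ := fun s => (∫ u in (0)..s, Complex.exp (ϑ u * Complex.I)) - (γ s - γ 0) with hG
  have hi : ∀ s t, IntervalIntegrable (fun u => Complex.exp (ϑ u * Complex.I))
    MeasureTheory.volume s t := fun s t => hec.intervalIntegrable s t
  have hG0 : ∀ s ∈ Icc 0 L, G s = 0 := fun s hs => by
    simp only [hG]
    rw [h₀.integral_eq 0 l0 s hs, sub_eq_zero]
    refine intervalIntegral.integral_congr fun u hu => ?_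
    have hu' : u ∈ Icc 0 L := uIcc_subset_Icc l0 hs hu
    simp only [heq u hu']
  have hGp : Function.Periodic G L := by
    intro s
    have h1 := hG0 L l1
    simp only [hG] at h1 ⊢
    rw [← intervalIntegral.integral_add_adjacent_intervals (hi 0 s) (hi s (s + L)),
      hexp.intervalIntegral_add_eq s 0, zero_add, h.1.periodic s]
    have h2 := h.1.periodic 0
    rw [zero_add] at h2
    rw [h2, sub_self, sub_zero] at h1
    rw [h1, add_zero]
  have hGz : ∀ s, G s = 0 := fun s => by
    obtain ⟨y, hy, e⟩ := hGp.exists_mem_Ico₀ hL s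
    rw [e, hG0 y ⟨hy.1, hy.2.le⟩]
  refine ⟨ϑ, fun a b => ⟨⟨hϑc, fun s _ t _ => ?_⟩, fun s _ t _ => htot s t,
    fun s _ t _ => hint s t⟩⟩
  have h1 := hGz s
  have h2 := hGz t
  simp only [hG] at h1 h2
  rw [← intervalIntegral.integral_interval_sub_left (hi 0 t) (hi 0 s), sub_eq_zero.1 h1,
    sub_eq_zero.1 h2]
  ring

theorem ClassKPi.neg_pi_lt {γ : ℝ → ℂ} {L : ℝ} (h : ClassKPi γ L) {ϑ : ℝ → ℝ}
    (hϑ : ∀ a b, HasCurvatureAngle γ ϑ a b) {s t : ℝ} (hst : s ≤ t) (ht : t ≤ s + L) :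
    -Real.pi < ϑ t - ϑ s := by
  obtain ⟨F, hF, hFP⟩ := h.1.1.exists_nonneg_interval
  have hL := h.1.1.length_pos
  have hkp := periodic_curvature h.1.1.periodic
  have hcl : IsClosed {x : ℝ × ℝ | x.1 ≤ x.2 ∧ x.2 ≤ x.1 + L} :=
    (isClosed_le continuous_fst continuous_snd).inter
      (isClosed_le continuous_snd (continuous_fst.add continuous_const))
  refine neg_pi_lt_totalCurvature (A := SmoothArc L) (hϑ (s - L) (t + L)) (by linarith) hst
    (by linarith) (((isCompact_Icc (a := s - L) (b := t + L)).prod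
      (isCompact_Icc (a := s - L) (b := t + L))).inter_right hcl) (fun x y hxy =>
        ⟨hxy.1.1.1, hxy.1.2.2⟩) (fun x y u hu hxu huy => ⟨fun hA => ?_, fun hC => ?_⟩)
    (fun x y hx hxy hy => ⟨hxy, by linarith⟩) (fun x y hx hy u hu hk => ?_)
    (fun x y hM _ _ => h.2.1 x y hM) (fun x y hM => (h.2.2 x y hM).1)
  · have := hA.2
    exact ⟨⟨⟨by simp only; linarith [hu.1], by simp only; linarith [hu.2]⟩,
      ⟨by simp only; linarith [hu.1], by simp only; linarith [hu.2]⟩⟩, hA.1.le, hA.2⟩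
  · exact ⟨hxu.trans huy, hC.2.2⟩
  · obtain ⟨u', hu', hu'F, hk'⟩ := (hϑ x y).exists_curvature_pos hu hk hu.2
      -- All translates of the cut points have to be avoided, since the arc may lie anywhere on the
      -- periodic extension.
      (F := ⋃ n : ℤ, (fun w => w - n • L) ⁻¹' F)
      (countable_iUnion fun n => hF.countable.preimage (sub_left_injective))
    obtain ⟨n, hn, -⟩ := existsUnique_sub_zsmul_mem_Ico hL u' 0
    simp only [zero_add] at hn
    have hF' : u' - n • L ∉ F := fun hc => hu'F (mem_iUnion.2 ⟨n, hc⟩)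
    have hkn : ∀ w, curvature γ (w - n • L) = curvature γ w := fun w => hkp.sub_zsmul_eq n
    obtain ⟨c, d, hc, hd, hm, hcd⟩ := hFP _ ⟨hn.1, hn.2.le⟩ hF' (by rwa [hkn])
    refine ⟨c + n • L, d + n • L, ⟨by linarith [hm.1, hm.2], by linarith⟩, fun w hw => ?_,
      u', ⟨by linarith [hm.1], by linarith [hm.2]⟩, ⟨hu.1.trans hu'.1, hu'.2⟩, hk'⟩
    rw [← hkn]
    exact hcd _ ⟨by linarith [hw.1], by linarith [hw.2]⟩

/-! ### Secant arguments near the diagonal -/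

theorem continuous_of_periodic {γ : ℝ → ℂ} {L : ℝ} (hL : 0 < L) (hp : Function.Periodic γ L)
    (hc : ContinuousOn γ (Icc 0 L)) : Continuous γ := by
  have : Fact (0 < L) := ⟨hL⟩
  have h1 : Continuous (AddCircle.liftIco L 0 γ) :=
    AddCircle.liftIco_continuous (by rw [hp 0]) (by rwa [zero_add])
  have h2 : γ = fun s : ℝ => AddCircle.liftIco L 0 γ (s : AddCircle L) := by
    funext s
    obtain ⟨n, hn, -⟩ := existsUnique_sub_zsmul_mem_Ico hL s 0
    have : ((s - n • L : ℝ) : AddCircle L) = (s : AddCircle L) := by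
      simp [AddCircle.coe_period]
    rw [← this, AddCircle.liftIco_coe_apply hn, hp.sub_zsmul_eq n]
  rw [h2]
  exact h1.comp (AddCircle.continuous_mk' L)

theorem IsAdmissible.injective {γ : ℝ → ℂ} {L : ℝ} (h : IsAdmissible γ L) {s t : ℝ} (hst : s < t)
    (hts : t < s + L) : γ s ≠ γ t := by
  intro e
  obtain ⟨n, hn, -⟩ := existsUnique_sub_zsmul_mem_Ico h.length_pos s 0
  rw [zero_add] at hn
  have e1 := h.periodic.sub_zsmul_eq n (x := s)
  have e2 := h.periodic.sub_zsmul_eq n (x := t)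
  rcases lt_or_ge (t - n • L) L with h1 | h1
  · have := h.simple hn ⟨by linarith [hn.1], h1⟩ (by rw [e1, e2, e])
    linarith
  · have := h.simple hn (x₂ := t - n • L - L) ⟨by linarith, by linarith [hn.2]⟩
      (by rw [h.periodic.sub_eq, e1, e2, e])
    linarith

theorem IsAdmissible.exists_secantLoop {γ : ℝ → ℂ} {L : ℝ} (h : IsAdmissible γ L) :
    ∃ Θ : ℝ → ℝ → ℝ, SecantLoop γ L Θ := by
  have hc := continuous_of_periodic h.length_pos h.periodic h.contDiffOn.continuousOn
  obtain ⟨Θ, h1, h2⟩ := exists_secant_arg h.length_pos hc fun s t => h.injective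
  exact ⟨Θ, h.length_pos, h.periodic, hc, fun s t => h.injective, h1, h2⟩

theorem sin_sub_pos_of_side_pos {z : ℂ} {φ ψ : ℝ} (hz : IsArg z φ) (h : 0 < side ψ z) :
    0 < Real.sin (φ - ψ) := by
  have e : side ψ z = ‖z‖ * Real.sin (φ - ψ) := by
    rw [side, hz.im, hz.re, Real.sin_sub]; ring
  rw [e] at h
  exact pos_of_mul_pos_right h (norm_nonneg z)

/-- The secant argument approaches the tangent angle, up to a fixed multiple of `2 * π`. -/
theorem SecantLoop.exists_tendsto {g : ℝ → ℂ} {L : ℝ} {Θ : ℝ → ℝ → ℝ} (H : SecantLoop g L Θ)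
    {ϑ : ℝ → ℝ} {a b : ℝ} (h : HasAngle g ϑ a b) (hab : a < b) :
    ∃ n : ℤ, (∀ c ∈ Ioc a b, Tendsto (fun s => Θ s c) (𝓝[<] c) (𝓝 (ϑ c + 2 * Real.pi * n))) ∧
      ∀ c ∈ Ico a b, Tendsto (fun t => Θ c t) (𝓝[>] c) (𝓝 (ϑ c + 2 * Real.pi * n)) := by
  have hpi := Real.pi_pos
  have hL := H.length_pos
  have huc : ∀ ε, 0 < ε → ∃ δ, 0 < δ ∧ δ ≤ L ∧
      ∀ s t, a ≤ s → s < t → t ≤ b → t < s + δ → ∀ u ∈ Icc s t, |ϑ u - ϑ s| < ε := by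
    intro ε hε
    obtain ⟨δ, hδ, hδ'⟩ := Metric.uniformContinuousOn_iff.1
      (isCompact_Icc.uniformContinuousOn_of_continuous h.continuous.continuousOn) ε hε
    refine ⟨min δ L, lt_min hδ hL, min_le_right _ _, fun s t h1 h2 h3 h4 u hu => ?_⟩
    refine hδ' u ⟨h1.trans hu.1, hu.2.trans h3⟩ s ⟨h1, h2.le.trans h3⟩ ?_
    rw [Real.dist_eq, abs_of_nonneg (by linarith [hu.1])]
    linarith [hu.2, min_le_left δ L]
  -- A short secant is an integral of unit vectors whose angles are close to `ϑ s`, so its own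
  -- direction lies in the same narrow cone.
  have hstep : ∀ ε, 0 < ε → ε ≤ Real.pi / 2 → ∃ δ, 0 < δ ∧ δ ≤ L ∧
      ∀ s t, a ≤ s → s < t → t ≤ b → t < s + δ →
        0 < Real.sin (Θ s t - (ϑ s - ε)) ∧ Real.sin (Θ s t - (ϑ s + ε)) < 0 := by
    intro ε hε hε'
    obtain ⟨δ, hδ, hδL, hδ'⟩ := huc ε hε
    refine ⟨δ, hδ, hδL, fun s t h1 h2 h3 h4 => ?_⟩
    have harg := H.isArg s t h2 (by linarith)
    constructor
    · refine sin_sub_pos_of_side_pos harg (h.side_pos h1 h2 h3 (fun u hu => ?_) ⟨s, ⟨le_rfl, h2.le⟩, ?_⟩)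
      · have := abs_lt.1 (hδ' s t h1 h2 h3 h4 u hu)
        exact Real.sin_nonneg_of_nonneg_of_le_pi (by linarith) (by linarith)
      · exact Real.sin_pos_of_pos_of_lt_pi (by linarith) (by linarith)
    · have := sin_sub_pos_of_side_pos (ψ := ϑ s + ε - Real.pi) harg
        (h.side_pos h1 h2 h3 (fun u hu => ?_) ⟨s, ⟨le_rfl, h2.le⟩, ?_⟩)
      · rw [show Θ s t - (ϑ s + ε - Real.pi) = Θ s t - (ϑ s + ε) + Real.pi by ring,
          Real.sin_add_pi] at this
        linarith
      · have := abs_lt.1 (hδ' s t h1 h2 h3 h4 u hu)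
        exact Real.sin_nonneg_of_nonneg_of_le_pi (by linarith) (by linarith)
      · exact Real.sin_pos_of_pos_of_lt_pi (by linarith) (by linarith)
  obtain ⟨δ, hδ, hδL, hδ'⟩ := hstep (Real.pi / 2) (by linarith) le_rfl
  have hcos : ∀ s t, a ≤ s → s < t → t ≤ b → t < s + δ → 0 < Real.cos (Θ s t - ϑ s) := by
    intro s t h1 h2 h3 h4
    have := (hδ' s t h1 h2 h3 h4).1
    rwa [show Θ s t - (ϑ s - Real.pi / 2) = Θ s t - ϑ s + Real.pi / 2 by ring,
      Real.sin_add_pi_div_two] at this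
  -- On this convex strip along the diagonal the secant stays within a right angle of the tangent,
  -- so one multiple of `2π` serves the whole arc.
  set D : Set (ℝ × ℝ) := {x | a ≤ x.1 ∧ x.1 < x.2 ∧ x.2 ≤ b ∧ x.2 < x.1 + δ} with hD
  have hDc : Convex ℝ D := by
    have e : D = (Ici a ×ˢ Iic b) ∩ strip δ := by
      ext x
      simp only [hD, strip, mem_ofPred_eq, mem_inter_iff, mem_prod, mem_Ici, mem_Iic]
      tauto
    rw [e]
    exact ((convex_Ici a).prod (convex_Iic b)).inter (convex_strip δ)
  have hΘc : ContinuousOn (fun x : ℝ × ℝ => Θ x.1 x.2 - ϑ x.1) D :=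
    (H.arg_continuousOn.mono fun x hx => ⟨hx.2.1, by have := hx.2.2.2; linarith⟩).sub
      (h.continuous.comp continuous_fst).continuousOn
  set m := min b (a + δ / 2)
  have hx₀ : ((a, m) : ℝ × ℝ) ∈ D :=
    ⟨le_rfl, lt_min hab (by linarith), min_le_left _ _,
      (min_le_right _ _).trans_lt (by simp only; linarith)⟩
  have hex : ∃ n : ℤ, Θ a m - ϑ a ∈
      Ioo (2 * Real.pi * n - Real.pi) (2 * Real.pi * n + Real.pi) := by
    obtain ⟨n, hn⟩ := exists_int_mem_Ico (Θ a m - ϑ a + Real.pi)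
    refine ⟨n, lt_of_le_of_ne (by linarith [hn.1]) fun e => ?_, by linarith [hn.2]⟩
    have := hcos a m hx₀.1 hx₀.2.1 hx₀.2.2.1 hx₀.2.2.2
    rw [← e, sub_eq_add_neg, cos_two_pi_int_add, Real.cos_neg, Real.cos_pi] at this
    linarith
  obtain ⟨n, hn⟩ := hex
  have hall : ∀ x ∈ D, Θ x.1 x.2 - ϑ x.1 ∈
      Ioo (2 * Real.pi * n - Real.pi) (2 * Real.pi * n + Real.pi) := fun x hx =>
    mem_Ioo_of_cos_pos hDc.isPreconnected hΘc (fun x hx _ => hcos _ _ hx.1 hx.2.1 hx.2.2.1 hx.2.2.2)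
      hx₀ hn hx
  have hest : ∀ ε, 0 < ε → ∃ δ, 0 < δ ∧ ∀ s t, a ≤ s → s < t → t ≤ b → t < s + δ →
      |Θ s t - (ϑ s + 2 * Real.pi * n)| < ε ∧ |ϑ t - ϑ s| < ε := by
    intro ε hε
    set η := min ε (Real.pi / 2) with hη
    have hη0 : 0 < η := lt_min hε (by linarith)
    have hηε : η ≤ ε := min_le_left _ _
    have hηπ : η ≤ Real.pi / 2 := min_le_right _ _
    obtain ⟨δ₁, h1, h1L, h1'⟩ := hstep η hη0 hηπ
    obtain ⟨δ₂, h2, h2L, h2'⟩ := huc ε hε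
    refine ⟨min δ (min δ₁ δ₂), lt_min hδ (lt_min h1 h2), fun s t ha hst hb ht => ⟨?_, ?_⟩⟩
    · have hd0 : t < s + δ := ht.trans_le (by linarith [min_le_left δ (min δ₁ δ₂)])
      have hd1 : t < s + δ₁ := ht.trans_le
        (by linarith [min_le_right δ (min δ₁ δ₂), min_le_left δ₁ δ₂])
      have e1 := hall (s, t) ⟨ha, hst, hb, hd0⟩
      have e0 := hcos s t ha hst hb hd0
      obtain ⟨e2, e3⟩ := h1' s t ha hst hb hd1
      simp only at e1
      set x := Θ s t - ϑ s - 2 * Real.pi * n with hx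
      rw [show Θ s t - ϑ s = 2 * Real.pi * n + x by ring, cos_two_pi_int_add] at e0
      rw [show Θ s t - (ϑ s - η) = 2 * Real.pi * n + (x + η) by ring, sin_two_pi_int_add] at e2
      rw [show Θ s t - (ϑ s + η) = 2 * Real.pi * n + (x - η) by ring, sin_two_pi_int_add] at e3
      have hx1 : -Real.pi < x := by linarith [e1.1]
      have hx2 : x < Real.pi := by linarith [e1.2]
      have hx3 : -(Real.pi / 2) < x := by
        by_contra hc
        have := Real.cos_nonpos_of_pi_div_two_le_of_le (x := -x) (by linarith) (by linarith)
        rw [Real.cos_neg] at this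
        linarith
      have hx4 : x < Real.pi / 2 := by
        by_contra hc
        have := Real.cos_nonpos_of_pi_div_two_le_of_le (x := x) (by linarith) (by linarith)
        linarith
      rw [show Θ s t - (ϑ s + 2 * Real.pi * n) = x by ring, abs_lt]
      constructor
      · by_contra hc
        have := Real.sin_nonpos_of_nonpos_of_neg_pi_le (x := x + η) (by linarith) (by linarith)
        linarith
      · by_contra hc
        have := Real.sin_nonneg_of_nonneg_of_le_pi (x := x - η) (by linarith) (by linarith)
        linarith
    · exact h2' s t ha hst hb (ht.trans_le
        (by linarith [min_le_right δ (min δ₁ δ₂), min_le_right δ₁ δ₂])) t ⟨hst.le, le_rfl⟩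
  refine ⟨n, fun c hc => ?_, fun c hc => ?_⟩ <;> rw [Metric.tendsto_nhds] <;> intro ε hε
  · obtain ⟨δ', hδ0, hδ'⟩ := hest (ε / 2) (by linarith)
    have : Ioo (max a (c - δ')) c ∈ 𝓝[<] c := Ioo_mem_nhdsLT (max_lt hc.1 (by linarith))
    filter_upwards [this] with s hs
    obtain ⟨e1, e2⟩ := hδ' s c ((le_max_left _ _).trans hs.1.le) hs.2 hc.2
      (by linarith [hs.1, le_max_right a (c - δ')])
    rw [Real.dist_eq, abs_lt]
    rw [abs_lt] at e1 e2
    constructor <;> linarith [e1.1, e1.2, e2.1, e2.2]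
  · obtain ⟨δ', hδ0, hδ'⟩ := hest ε hε
    have : Ioo c (min b (c + δ')) ∈ 𝓝[>] c := Ioo_mem_nhdsGT (lt_min hc.2 (by linarith))
    filter_upwards [this] with t ht
    exact (hδ' c t hc.1 ht.1 (ht.2.le.trans (min_le_left _ _))
      (ht.2.trans_le (min_le_right _ _))).1

/-- A connected set that avoids the curve lies in a single component of the complement. This is how
membership in the region is carried from point to point. -/
theorem region_of_isPreconnected {γ : ℝ → ℂ} {L : ℝ} {S : Set ℂ} (hS : IsPreconnected S)
    (hST : ∀ z ∈ S, z ∉ trace γ L) {z w : ℂ} (hz : z ∈ S) (hzr : z ∈ region γ L) (hw : w ∈ S) :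
    w ∈ region γ L := by
  refine ⟨hST w hw, ?_⟩
  have h1 : w ∈ connectedComponentIn (trace γ L)ᶜ z :=
    hS.subset_connectedComponentIn hz hST hw
  rw [← connectedComponentIn_eq h1]
  exact hzr.2

theorem convex_side_pos (ψ : ℝ) (w : ℂ) : Convex ℝ {z | 0 < side ψ (z - w)} := by
  simpa [leftOfTangents] using convex_leftOfTangents (fun _ => w) (fun _ => ψ) 0 0

theorem neg_norm_le_side (ψ : ℝ) (z : ℂ) : -‖z‖ ≤ side ψ z := by
  have e : side ψ z = (z * Complex.exp ((-ψ : ℝ) * Complex.I)).im := by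
    rw [Complex.mul_im, Complex.exp_ofReal_mul_I_re, Complex.exp_ofReal_mul_I_im,
      Real.cos_neg, Real.sin_neg, side]
    ring
  have := Complex.abs_im_le_norm (z * Complex.exp ((-ψ : ℝ) * Complex.I))
  rw [norm_mul, Complex.norm_exp_ofReal_mul_I, mul_one, ← e] at this
  exact (abs_le.1 this).1

theorem SecantLoop.add_two_pi {g : ℝ → ℂ} {L : ℝ} {Θ : ℝ → ℝ → ℝ} (H : SecantLoop g L Θ) (n : ℤ) :
    SecantLoop g L fun s t => Θ s t + 2 * Real.pi * n := by
  refine { H with arg_continuousOn := H.arg_continuousOn.add continuousOn_const, isArg := ?_ }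
  intro s t h1 h2
  have := H.isArg s t h1 h2
  unfold IsArg at *
  conv_lhs => rw [this]
  push_cast
  rw [add_mul, Complex.exp_add, show (2 * Real.pi * n * Complex.I : ℂ) =
    n * (2 * Real.pi * Complex.I) by ring, Complex.exp_int_mul_two_pi_mul_I, mul_one]

theorem IsAdmissible.exists_secantLoop_tendsto {γ : ℝ → ℂ} {L : ℝ} (h : IsAdmissible γ L)
    {ϑ : ℝ → ℝ} {a b : ℝ} (hϑ : HasAngle γ ϑ a b) (hab : a < b) :
    ∃ Θ : ℝ → ℝ → ℝ, SecantLoop γ L Θ ∧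
      (∀ c ∈ Ioc a b, Tendsto (fun s => Θ s c) (𝓝[<] c) (𝓝 (ϑ c))) ∧
      ∀ c ∈ Ico a b, Tendsto (fun t => Θ c t) (𝓝[>] c) (𝓝 (ϑ c)) := by
  obtain ⟨Θ, H⟩ := h.exists_secantLoop
  obtain ⟨n, h1, h2⟩ := H.exists_tendsto hϑ hab
  refine ⟨_, H.add_two_pi (-n), fun c hc => ?_, fun c hc => ?_⟩
  · have := (h1 c hc).add_const (2 * Real.pi * (-n : ℤ))
    rwa [show ϑ c + 2 * Real.pi * n + 2 * Real.pi * (-n : ℤ) = ϑ c by push_cast; ring] at this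
  · have := (h2 c hc).add_const (2 * Real.pi * (-n : ℤ))
    rwa [show ϑ c + 2 * Real.pi * n + 2 * Real.pi * (-n : ℤ) = ϑ c by push_cast; ring] at this

theorem ClassKPi.exists_turningLoop {γ : ℝ → ℂ} {L : ℝ} (h : ClassKPi γ L) {ϑ : ℝ → ℝ}
    (hϑ : ∀ a b, HasCurvatureAngle γ ϑ a b) : ∃ Θ : ℝ → ℝ → ℝ, TurningLoop γ L Θ ϑ ϑ := by
  have hpi := Real.pi_pos
  obtain ⟨Θ, H, h1, -⟩ := h.1.1.exists_secantLoop_tendsto (hϑ (-1) 1).toHasAngle (by norm_num)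
  have key : ∀ c, Tendsto (fun s => Θ s c) (𝓝[<] c) (𝓝 (ϑ c)) ∧
      Tendsto (fun t => Θ c t) (𝓝[>] c) (𝓝 (ϑ c)) := by
    intro c
    have l1 : min c 0 - 1 < c := by linarith [min_le_left c 0]
    have l2 : min c 0 - 1 < 0 := by linarith [min_le_right c 0]
    have l3 : c < max c 0 + 1 := by linarith [le_max_left c 0]
    have l4 : 0 < max c 0 + 1 := by linarith [le_max_right c 0]
    obtain ⟨n, h2, h3⟩ := H.exists_tendsto
      (hϑ (min c 0 - 1) (max c 0 + 1)).toHasAngle (l1.trans l3)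
    -- The interval was chosen to contain both `c` and `0`; comparing the limits at `0` shows that
    -- its multiple of `2π` is zero.
    have e := tendsto_nhds_unique (h1 0 ⟨by norm_num, by norm_num⟩) (h2 0 ⟨l2, l4.le⟩)
    have e' : 2 * Real.pi * n = 0 := by linarith
    have h4 := h2 c ⟨l1, l3.le⟩
    have h5 := h3 c ⟨l1.le, l3⟩
    rw [e', add_zero] at h4 h5
    exact ⟨h4, h5⟩
  exact ⟨Θ, H, fun c => (key c).1, fun c => (key c).2, fun c => Or.inl rfl,
    fun s t hst ht => h.neg_pi_lt hϑ hst.le ht⟩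

/-! ### The external cusp -/

theorem ClassC.exists_angle_eq {γ : ℝ → ℂ} {L : ℝ} (h : ClassC γ L) {ϑ : ℝ → ℝ}
    (hϑ : HasAngle γ ϑ 0 L) : ∃ m : ℤ, ϑ 0 = ϑ L + Real.pi + m * (2 * Real.pi) := by
  have hL := h.1.length_pos
  have e := h.2.1
  rw [hϑ.derivWithin_eq hL ⟨le_rfl, hL.le⟩, hϑ.derivWithin_eq hL ⟨hL.le, le_rfl⟩] at e
  have e2 : Complex.exp (ϑ 0 * Complex.I) = Complex.exp ((ϑ L + Real.pi : ℝ) * Complex.I) := by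
    push_cast
    rw [e, add_mul, Complex.exp_add, Complex.exp_pi_mul_I]
    ring
  obtain ⟨n, hn⟩ := Complex.exp_eq_exp_iff_exists_int.1 e2
  refine ⟨n, ?_⟩
  have := congrArg Complex.im hn
  simpa using this

/-- At an external cusp the outgoing branch does not pass below the incoming one. -/
theorem ClassC.ne_below {γ : ℝ → ℂ} {L : ℝ} (h : ClassC γ L) {ϑ : ℝ → ℝ} (hϑ : HasAngle γ ϑ 0 L) :
    ∃ δ, 0 < δ ∧ 2 * δ < L ∧ ∀ s ∈ Icc 0 δ, ∀ t ∈ Icc 0 δ, ∀ η : ℝ, 0 < η →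
      γ t - γ (L - s) ≠ (-η : ℝ) * Complex.exp ((ϑ L + Real.pi / 2 : ℝ) * Complex.I) := by
  have hpi := Real.pi_pos
  have hL := h.1.length_pos
  have l0 : (0 : ℝ) ∈ Icc 0 L := ⟨le_rfl, hL.le⟩
  have l1 : L ∈ Icc 0 L := ⟨hL.le, le_rfl⟩
  have hγL : γ L = γ 0 := by simpa using h.1.periodic 0
  obtain ⟨m, hm⟩ := h.exists_angle_eq hϑ
  set α := ϑ L with hα
  -- the two branches are flat near the cusp
  obtain ⟨δ, hδ, hδL, hin, hout⟩ : ∃ δ, 0 < δ ∧ 2 * δ < L ∧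
      (∀ u ∈ Icc (L - δ) L, |ϑ u - α| < Real.pi / 4) ∧
      ∀ u ∈ Icc 0 δ, |ϑ u - ϑ 0| < Real.pi / 4 := by
    obtain ⟨δ₁, h1, h1'⟩ := Metric.continuousAt_iff.1 (hϑ.continuous.continuousAt (x := L))
      (Real.pi / 4) (by linarith)
    obtain ⟨δ₂, h2, h2'⟩ := Metric.continuousAt_iff.1 (hϑ.continuous.continuousAt (x := 0))
      (Real.pi / 4) (by linarith)
    have m1 := min_le_left (min δ₁ δ₂) L
    have m2 := min_le_right (min δ₁ δ₂) L
    have m3 := min_le_left δ₁ δ₂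
    have m4 := min_le_right δ₁ δ₂
    have m5 : 0 < min (min δ₁ δ₂) L := lt_min (lt_min h1 h2) hL
    refine ⟨min (min δ₁ δ₂) L / 3, by linarith, by linarith, fun u hu => h1' ?_,
      fun u hu => h2' ?_⟩
    · rw [Real.dist_eq, abs_lt]; constructor <;> linarith [hu.1, hu.2]
    · rw [Real.dist_eq, abs_lt]; constructor <;> linarith [hu.1, hu.2]
  -- Secants of either branch near the cusp are within `π / 4` of the line of angle `α`. Hence no
  -- other point of the same branch lies in the open cone of half-width `π / 4` above a point of it.
  have hin1 : ∀ v w, L - δ ≤ v → v < w → w ≤ L →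
      side (α + Real.pi / 4) (γ w - γ v) < 0 := fun v w hv hvw hw => by
    refine hϑ.side_neg (by linarith) hvw hw (fun u hu => (?_ : Real.sin _ < 0).le)
      ⟨v, ⟨le_rfl, hvw.le⟩, ?_⟩
    · have := abs_lt.1 (hin u ⟨hv.trans hu.1, hu.2.trans hw⟩)
      exact Real.sin_neg_of_neg_of_neg_pi_lt (by linarith) (by linarith)
    · have := abs_lt.1 (hin v ⟨hv, hvw.le.trans hw⟩)
      exact Real.sin_neg_of_neg_of_neg_pi_lt (by linarith) (by linarith)
  have hin2 : ∀ v w, L - δ ≤ v → v < w → w ≤ L →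
      0 < side (α - Real.pi / 4) (γ w - γ v) := fun v w hv hvw hw => by
    refine hϑ.side_pos (by linarith) hvw hw (fun u hu => (?_ : 0 < Real.sin _).le)
      ⟨v, ⟨le_rfl, hvw.le⟩, ?_⟩
    · have := abs_lt.1 (hin u ⟨hv.trans hu.1, hu.2.trans hw⟩)
      exact Real.sin_pos_of_pos_of_lt_pi (by linarith) (by linarith)
    · have := abs_lt.1 (hin v ⟨hv, hvw.le.trans hw⟩)
      exact Real.sin_pos_of_pos_of_lt_pi (by linarith) (by linarith)
  have hsin : ∀ u c, Real.sin (ϑ u - (α + c)) = Real.sin (ϑ u - ϑ 0 + Real.pi - c) := fun u c => by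
    rw [hm, show ϑ u - (α + Real.pi + m * (2 * Real.pi)) + Real.pi - c =
      ϑ u - (α + c) - m * (2 * Real.pi) by ring, Real.sin_sub_int_mul_two_pi]
  have hout1 : ∀ v w, 0 ≤ v → v < w → w ≤ δ →
      0 < side (α + Real.pi / 4) (γ w - γ v) := fun v w hv hvw hw => by
    refine hϑ.side_pos hv hvw (by linarith) (fun u hu => (?_ : 0 < Real.sin _).le)
      ⟨v, ⟨le_rfl, hvw.le⟩, ?_⟩
    · have := abs_lt.1 (hout u ⟨hv.trans hu.1, hu.2.trans hw⟩)
      rw [hsin]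
      exact Real.sin_pos_of_pos_of_lt_pi (by linarith) (by linarith)
    · have := abs_lt.1 (hout v ⟨hv, hvw.le.trans hw⟩)
      rw [hsin]
      exact Real.sin_pos_of_pos_of_lt_pi (by linarith) (by linarith)
  have hsin' : ∀ u, Real.sin (ϑ u - (α - Real.pi / 4)) =
      - Real.sin (ϑ u - ϑ 0 + Real.pi / 4) := fun u => by
    rw [sub_eq_add_neg α, hsin, ← Real.sin_add_pi]
    congr 1; ring
  have hout2 : ∀ v w, 0 ≤ v → v < w → w ≤ δ →
      side (α - Real.pi / 4) (γ w - γ v) < 0 := fun v w hv hvw hw => by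
    refine hϑ.side_neg hv hvw (by linarith) (fun u hu => (?_ : Real.sin _ < 0).le)
      ⟨v, ⟨le_rfl, hvw.le⟩, ?_⟩
    · have := abs_lt.1 (hout u ⟨hv.trans hu.1, hu.2.trans hw⟩)
      rw [hsin', neg_lt_zero]
      exact Real.sin_pos_of_pos_of_lt_pi (by linarith) (by linarith)
    · have := abs_lt.1 (hout v ⟨hv, hvw.le.trans hw⟩)
      rw [hsin', neg_lt_zero]
      exact Real.sin_pos_of_pos_of_lt_pi (by linarith) (by linarith)
  have hsd : ∀ (c r φ : ℝ), side c (r * Complex.exp ((φ : ℝ) * Complex.I)) = r * Real.sin (φ - c) :=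
    fun c r φ => by rw [side_smul, side_exp]
  set N : ℂ := Complex.exp ((α + Real.pi / 2 : ℝ) * Complex.I) with hN
  have s1 : 0 < Real.sin (α + Real.pi / 2 - (α + Real.pi / 4)) :=
    Real.sin_pos_of_pos_of_lt_pi (by linarith) (by linarith)
  have s2 : 0 < Real.sin (α + Real.pi / 2 - (α - Real.pi / 4)) :=
    Real.sin_pos_of_pos_of_lt_pi (by linarith) (by linarith)
  -- the rest of the curve stays away from the cusp
  have hγc : ContinuousOn γ (Icc 0 L) := h.1.contDiffOn.continuousOn
  obtain ⟨ρ, hρ, hρ'⟩ : ∃ ρ > 0, ∀ v ∈ Icc δ (L - δ), ρ ≤ ‖γ v - γ L‖ := by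
    have hK : IsCompact (γ '' Icc δ (L - δ)) :=
      isCompact_Icc.image_of_continuousOn (hγc.mono (Icc_subset_Icc hδ.le (by linarith)))
    have hnot : γ L ∉ γ '' Icc δ (L - δ) := by
      rintro ⟨v, hv, e⟩
      exact h.1.injective (s := v) (t := L) (by linarith [hv.2]) (by linarith [hv.1]) e
    obtain ⟨ρ, hρ, hρ'⟩ := Metric.isOpen_iff.1 hK.isClosed.isOpen_compl _ hnot
    refine ⟨ρ, hρ, fun v hv => ?_⟩
    by_contra hc
    exact hρ' (show γ v ∈ Metric.ball (γ L) ρ by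
      rw [Metric.mem_ball, dist_eq_norm]; exact not_le.1 hc) ⟨v, hv, rfl⟩
  -- The ray used below has length `3 * s` and starts within `s` of the cusp, so it stays within `4
  -- * s < ρ`, away from the rest of the curve. The factor `3` lifts its top into the half disc
  -- around the cusp.
  have hmδ : 0 < min (δ / 2) (ρ / 5) := lt_min (by linarith) (by linarith)
  refine ⟨min (δ / 2) (ρ / 5), hmδ, by linarith [min_le_left (δ / 2) (ρ / 5)], fun s hs t ht η hη e => ?_⟩
  have hsδ : s < δ := by linarith [hs.2.trans (min_le_left (δ / 2) (ρ / 5))]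
  have htδ : t ≤ δ := by linarith [ht.2.trans (min_le_left (δ / 2) (ρ / 5))]
  have hsρ : 5 * s ≤ ρ := by linarith [hs.2.trans (min_le_right (δ / 2) (ρ / 5))]
  have e1 : side (α + Real.pi / 4) (γ t - γ (L - s)) < 0 := by
    rw [e, hsd]; nlinarith
  have e2 : side (α - Real.pi / 4) (γ t - γ (L - s)) < 0 := by
    rw [e, hsd]; nlinarith
  have hs0 : 0 < s := by
    refine lt_of_le_of_ne hs.1 fun hs0 => ?_
    rw [← hs0, sub_zero, hγL] at e1
    rcases ht.1.eq_or_lt with ht0 | ht0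
    · rw [← ht0, sub_self] at e1; simp [side] at e1
    · linarith [hout1 0 t le_rfl ht0 htδ]
  set u := L - s with hu
  have hu0 : u ∈ Ioo 0 L := ⟨by linarith, by linarith⟩
  have huL : ‖γ u - γ L‖ ≤ s := by
    rw [hϑ.integral_eq L l1 u (Ioo_subset_Icc_self hu0)]
    refine (intervalIntegral.norm_integral_le_of_norm_le_const (C := 1) fun x _ => ?_).trans ?_
    · rw [Complex.norm_exp_ofReal_mul_I]
    · rw [one_mul, abs_of_neg (by linarith)]; linarith
  -- points to the left of the incoming branch close to `γ u` lie in the region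
  obtain ⟨r, hr, hr'⟩ : ∃ r > 0, ∀ v ∈ Icc 0 (L - δ), r ≤ ‖γ v - γ u‖ := by
    have hK : IsCompact (γ '' Icc 0 (L - δ)) :=
      isCompact_Icc.image_of_continuousOn (hγc.mono (Icc_subset_Icc le_rfl (by linarith)))
    have hnot : γ u ∉ γ '' Icc 0 (L - δ) := by
      rintro ⟨v, hv, e⟩
      exact h.1.injective (s := v) (t := u) (by linarith [hv.2]) (by linarith [hv.1, hu0.2]) e
    obtain ⟨ρ, hρ, hρ'⟩ := Metric.isOpen_iff.1 hK.isClosed.isOpen_compl _ hnot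
    refine ⟨ρ, hρ, fun v hv => ?_⟩
    by_contra hc
    exact hρ' (show γ v ∈ Metric.ball (γ u) ρ by
      rw [Metric.mem_ball, dist_eq_norm]; exact not_le.1 hc) ⟨v, hv, rfl⟩
  -- The cone above `γ u` avoids the incoming branch, and close to `γ u` it avoids the whole curve.
  -- It contains the normal at `u`, so its tip `W` lies in the region.
  have hcone : ∀ v ∈ Icc (L - δ) L, 0 < side (α + Real.pi / 4) (γ v - γ u) →
      0 < side (α - Real.pi / 4) (γ v - γ u) → False := by
    intro v hv h1 h2
    rcases lt_trichotomy v u with h3 | h3 | h3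
    · have := hin2 v u hv.1 h3 hu0.2.le
      simp only [side_sub] at *
      linarith
    · rw [h3, sub_self] at h1
      simp [side] at h1
    · have := hin1 u v (by linarith) h3 hv.2
      linarith
  set W : Set ℂ := {z | 0 < side (α + Real.pi / 4) (z - γ u)} ∩
    {z | 0 < side (α - Real.pi / 4) (z - γ u)} ∩ Metric.ball (γ u) r with hW
  have hWc : IsPreconnected W :=
    (((convex_side_pos _ _).inter (convex_side_pos _ _)).inter (convex_ball _ _)).isPreconnected
  have hWT : ∀ z ∈ W, z ∉ trace γ L := by
    rintro z ⟨⟨h1, h2⟩, h3⟩ ⟨v, hv, rfl⟩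
    rcases le_total v (L - δ) with h4 | h4
    · have := hr' v ⟨hv.1, h4⟩
      rw [Metric.mem_ball, dist_eq_norm] at h3
      linarith
    · exact hcone v ⟨h4, hv.2⟩ h1 h2
  have hnear : ∀ (w v : ℂ) (r : ℝ), 0 < r →
      ∀ᶠ τ : ℝ in 𝓝[>] 0, (w + τ * v) ∈ Metric.ball w r := by
    intro w v r hr
    have : Tendsto (fun τ : ℝ => w + τ * v) (𝓝[>] 0) (𝓝 (w + (0 : ℝ) * v)) :=
      ((by fun_prop : Continuous fun τ : ℝ => w + τ * v).tendsto 0).mono_left nhdsWithin_le_nhds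
    rw [Complex.ofReal_zero, zero_mul, add_zero] at this
    exact this (Metric.ball_mem_nhds w hr)
  have hpos : ∀ᶠ τ : ℝ in 𝓝[>] 0, 0 < τ := self_mem_nhdsWithin
  have hαu := abs_lt.1 (hin u ⟨by linarith, hu0.2.le⟩)
  have hWmem : ∀ τ φ : ℝ, 0 < τ → |φ - (α + Real.pi / 2)| < Real.pi / 4 →
      γ u + τ * Complex.exp (φ * Complex.I) ∈ Metric.ball (γ u) r →
      γ u + τ * Complex.exp (φ * Complex.I) ∈ W := by
    intro τ φ hτ hφ hb
    have := abs_lt.1 hφ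
    refine ⟨⟨?_, ?_⟩, hb⟩ <;> simp only [mem_ofPred_eq, add_sub_cancel_left, hsd]
    · exact mul_pos hτ (Real.sin_pos_of_pos_of_lt_pi (by linarith) (by linarith))
    · exact mul_pos hτ (Real.sin_pos_of_pos_of_lt_pi (by linarith) (by linarith))
  have hWr : ∀ w ∈ W, w ∈ region γ L := by
    have hd : deriv γ u = Complex.exp (ϑ u * Complex.I) := (hϑ.hasDerivAt hu0).deriv
    have hI : Complex.I * deriv γ u = Complex.exp ((ϑ u + Real.pi / 2 : ℝ) * Complex.I) := by
      rw [hd]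
      push_cast
      rw [add_mul, Complex.exp_add, Complex.exp_pi_div_two_mul_I, mul_comm]
    have h1 := h.1.positively_oriented u hu0
    rw [hI] at h1
    obtain ⟨τ, ⟨h2, h3⟩, h4⟩ := ((h1.and hpos).and
      (hnear (γ u) (Complex.exp ((ϑ u + Real.pi / 2 : ℝ) * Complex.I)) r hr)).exists
    rw [Complex.real_smul] at h2
    exact fun w hw => region_of_isPreconnected hWc hWT (hWmem τ _ h3 (by
      rw [abs_lt]; constructor <;> linarith [hαu.1, hαu.2]) h4) h2 hw
  -- the vertical ray upwards from `γ u`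
  have houts : ∀ v ∈ Icc 0 δ, 0 < side (α + Real.pi / 4) (γ v - γ t) →
      0 < side (α - Real.pi / 4) (γ v - γ t) → False := by
    intro v hv h1 h2
    rcases lt_trichotomy v t with h3 | h3 | h3
    · have := hout1 v t hv.1 h3 htδ
      simp only [side_sub] at *
      linarith
    · rw [h3, sub_self] at h1
      simp [side] at h1
    · have := hout2 t v ht.1 h3 hv.2
      linarith
  set V : Set ℂ := (fun τ : ℝ => γ u + τ * N) '' Ioc 0 (3 * s) with hV
  have hVc : IsPreconnected V :=
    isPreconnected_Ioc.image _ (by fun_prop)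
  have hVT : ∀ z ∈ V, z ∉ trace γ L := by
    rintro z ⟨τ, ⟨hτ0, hτ⟩, rfl⟩ ⟨v, hv, e3⟩
    simp only at e3
    have e4 : γ v - γ u = τ * N := by rw [e3]; ring
    rcases le_total v δ with h4 | h4
    · have e5 : γ v - γ t = (τ + η : ℝ) * N := by
        rw [show γ v - γ t = (γ v - γ u) - (γ t - γ u) by ring, e4, e]
        push_cast; ring
      refine houts v ⟨hv.1, h4⟩ ?_ ?_ <;> rw [e5, hsd]
      · exact mul_pos (by linarith) s1
      · exact mul_pos (by linarith) s2
    rcases le_total v (L - δ) with h5 | h5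
    · have h6 := hρ' v ⟨h4, h5⟩
      have h7 : ‖γ v - γ L‖ ≤ ‖γ v - γ u‖ + ‖γ u - γ L‖ := norm_sub_le_norm_sub_add_norm_sub _ _ _
      rw [e4, norm_mul, hN, Complex.norm_exp_ofReal_mul_I, Complex.norm_real, Real.norm_eq_abs,
        abs_of_pos hτ0] at h7
      linarith
    · refine hcone v ⟨h5, hv.2⟩ ?_ ?_ <;> rw [e4, hsd]
      · exact mul_pos hτ0 s1
      · exact mul_pos hτ0 s2
  have htop : γ u + (3 * s : ℝ) * N ∈ region γ L := by
    obtain ⟨τ, h1, h2, h3⟩ := ((hnear (γ u) N r hr).and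
      (Ioc_mem_nhdsGT (show (0 : ℝ) < 3 * s by linarith) : ∀ᶠ τ : ℝ in 𝓝[>] 0, τ ∈ Ioc 0 (3 * s))).exists
    refine region_of_isPreconnected hVc hVT ⟨τ, ⟨h2, h3⟩, rfl⟩ (hWr _ (hWmem τ _ h2 ?_ h1))
      ⟨3 * s, ⟨by linarith, le_rfl⟩, rfl⟩
    rw [sub_self, abs_zero]; linarith
  -- a half disc around the cusp
  set S : Set ℂ := {z | 0 < side (α - Real.pi / 4) (z - γ L)} ∩ Metric.ball (γ L) ρ with hS
  have hSc : IsPreconnected S := ((convex_side_pos _ _).inter (convex_ball _ _)).isPreconnected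
  have hST : ∀ z ∈ S, z ∉ trace γ L := by
    rintro z ⟨h1, h2⟩ ⟨v, hv, rfl⟩
    simp only [mem_ofPred_eq] at h1
    rcases le_total v δ with h4 | h4
    · rw [hγL] at h1
      rcases hv.1.eq_or_lt with h5 | h5
      · rw [← h5, sub_self] at h1; simp [side] at h1
      · linarith [hout2 0 v le_rfl h5 h4]
    rcases le_total v (L - δ) with h5 | h5
    · have := hρ' v ⟨h4, h5⟩
      rw [Metric.mem_ball, dist_eq_norm] at h2
      linarith
    · rcases hv.2.eq_or_lt with h6 | h6
      · rw [h6, sub_self] at h1; simp [side] at h1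
      · have := hin2 v L h5 h6 le_rfl
        simp only [side_sub] at *
        linarith
  have htopS : γ u + (3 * s : ℝ) * N ∈ S := by
    have e3 : γ u + (3 * s : ℝ) * N - γ L = (γ u - γ L) + (3 * s : ℝ) * N := by ring
    constructor
    · have h1 := neg_norm_le_side (α - Real.pi / 4) (γ u - γ L)
      have h2 : (1 : ℝ) ≤ √2 := Real.one_le_sqrt.2 (by norm_num)
      rw [mem_ofPred_eq, e3, side_add, hsd,
        show α + Real.pi / 2 - (α - Real.pi / 4) = Real.pi / 4 + Real.pi / 2 by ring,
        Real.sin_add_pi_div_two, Real.cos_pi_div_four]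
      nlinarith
    · rw [Metric.mem_ball, dist_eq_norm, e3]
      refine (norm_add_le _ _).trans_lt ?_
      rw [norm_mul, hN, Complex.norm_exp_ofReal_mul_I, Complex.norm_real, Real.norm_eq_abs,
        abs_of_pos (by linarith)]
      linarith
  -- The half disc joins the top of the ray, which is in the region, to the points straight ahead of
  -- the incoming branch, which are not.
  have hcusp := h.2.2
  rw [hϑ.derivWithin_eq hL l1] at hcusp
  obtain ⟨τ, ⟨h1, h2⟩, h3⟩ := ((hcusp.and hpos).and
    (hnear (γ L) (Complex.exp (α * Complex.I)) ρ hρ)).exists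
  rw [Complex.real_smul] at h1
  refine h1 (region_of_isPreconnected hSc hST htopS htop ⟨?_, h3⟩)
  rw [mem_ofPred_eq, add_sub_cancel_left, hsd]
  exact mul_pos h2 (Real.sin_pos_of_pos_of_lt_pi (by linarith) (by linarith))

/-- At an external cusp the tangent turns to the left by `π`. -/
theorem ClassC.cusp_jump {γ : ℝ → ℂ} {L : ℝ} (h : ClassC γ L) {ϑ : ℝ → ℝ} (hϑ : HasAngle γ ϑ 0 L)
    {Θ : ℝ → ℝ → ℝ} (H : SecantLoop γ L Θ) (hl : Tendsto (fun s => Θ s L) (𝓝[<] L) (𝓝 (ϑ L)))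
    {j : ℤ} (hr : Tendsto (fun t => Θ L t) (𝓝[>] L) (𝓝 (ϑ L + Real.pi + 2 * Real.pi * j))) :
    j = 0 := by
  have hpi := Real.pi_pos
  obtain ⟨δ, hδ, hδL, hne⟩ := h.ne_below hϑ
  set α := ϑ L
  set D : Set (ℝ × ℝ) := (Icc (L - δ) L ×ˢ Icc L (L + δ)) ∩ strip L with hD
  have hDc : IsPreconnected D :=
    (((convex_Icc _ _).prod (convex_Icc _ _)).inter (convex_strip L)).isPreconnected
  have hmem : ∀ s t, L - δ ≤ s → s ≤ L → L ≤ t → t ≤ L + δ → s < t → (s, t) ∈ D :=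
    fun s t h1 h2 h3 h4 h5 => ⟨⟨⟨h1, h2⟩, h3, h4⟩, h5, by simp only; linarith⟩
  have hφ : ContinuousOn (fun x : ℝ × ℝ => Θ x.1 x.2 - α + Real.pi / 2) D :=
    ((H.arg_continuousOn.mono inter_subset_right).sub continuousOn_const).add continuousOn_const
  -- By `ClassC.ne_below` no secant from the incoming to the outgoing branch points straight down,
  -- that is, in the direction `α - π / 2`. So its angle cannot pass from near `α` to `α - π`, only
  -- to `α + π`.
  have hav : ∀ x ∈ D, Real.sin (Θ x.1 x.2 - α + Real.pi / 2) = 0 →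
      Real.cos (Θ x.1 x.2 - α + Real.pi / 2) < 0 := by
    rintro ⟨s, t⟩ ⟨⟨hs, ht⟩, hst⟩ h0
    simp only at hs ht h0 ⊢
    have hA := H.isArg s t hst.1 hst.2
    have hz := H.ne_zero hst.1 hst.2
    by_contra hc
    have h1 : Real.cos (Θ s t - α + Real.pi / 2) = 1 := by
      have := Real.sin_sq_add_cos_sq (Θ s t - α + Real.pi / 2)
      rw [h0] at this
      nlinarith
    obtain ⟨n, hn⟩ := (Real.cos_eq_one_iff _).1 h1
    refine hne (L - s) ⟨by linarith [hs.2], by linarith [hs.1]⟩ (t - L)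
      ⟨by linarith [ht.1], by linarith [ht.2]⟩ ‖γ t - γ s‖ (norm_pos_iff.2 hz) ?_
    have e1 : γ (t - L) = γ t := by
      have := H.periodic (t - L)
      rwa [sub_add_cancel, eq_comm] at this
    rw [e1, sub_sub_cancel]
    conv_lhs => rw [hA]
    rw [show (Θ s t : ℝ) = α + Real.pi / 2 + n * (2 * Real.pi) - Real.pi by linarith]
    push_cast
    rw [sub_mul, add_mul _ ((n : ℂ) * _), Complex.exp_sub, Complex.exp_add, mul_assoc (n : ℂ),
      Complex.exp_int_mul_two_pi_mul_I, Complex.exp_pi_mul_I]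
    ring
  have hev : ∀ᶠ s in 𝓝[<] L, Θ s L ∈ Ioo (α - Real.pi / 2) (α + Real.pi / 2) :=
    hl (Ioo_mem_nhds (by linarith) (by linarith))
  obtain ⟨s, hs1, hs2⟩ := (hev.and (Ioo_mem_nhdsLT (show L - δ < L by linarith))).exists
  have hall : ∀ t ∈ Ioo L (L + δ), Θ L t - α + Real.pi / 2 ∈ Ioo 0 (2 * Real.pi) := by
    intro t ht
    have := mem_Ioo_of_cos_neg (k := 1) hDc hφ hav
      (hmem s L hs2.1.le hs2.2.le le_rfl (by linarith) hs2.2) (by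
        simp only [Int.cast_one]; constructor <;> linarith [hs1.1, hs1.2])
      (hmem L t (by linarith) le_rfl ht.1.le ht.2.le ht.1)
    simp only [Int.cast_one] at this
    constructor <;> linarith [this.1, this.2]
  have hev2 : ∀ᶠ t in 𝓝[>] L, Θ L t ∈ Icc (α - Real.pi / 2) (α + 3 * Real.pi / 2) := by
    filter_upwards [Ioo_mem_nhdsGT (show L < L + δ by linarith)] with t ht
    have := hall t ht
    constructor <;> linarith [this.1, this.2]
  have hlim := isClosed_Icc.mem_of_tendsto hr hev2
  have h1 : (-1 : ℝ) < j := by nlinarith [hlim.1]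
  have h2 : (j : ℝ) < 1 := by nlinarith [hlim.2]
  have h3 : -1 < j := by exact_mod_cast h1
  have h4 : j < 1 := by exact_mod_cast h2
  omega

/-! ### The cusped curve as a turning loop -/

theorem SecantLoop.tendsto_left_shift {g : ℝ → ℂ} {L : ℝ} {Θ : ℝ → ℝ → ℝ} (H : SecantLoop g L Θ)
    {D : ℝ} (hD : ∀ s t, s < t → t < s + L → Θ (s + L) (t + L) = Θ s t + D) (c x : ℝ) :
    Tendsto (fun s => Θ s (c + L)) (𝓝[<] (c + L)) (𝓝 (x + D)) ↔
      Tendsto (fun s => Θ s c) (𝓝[<] c) (𝓝 x) := by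
  have h1 : ∀ᶠ s in 𝓝[<] c, Θ (s + L) (c + L) = Θ s c + D := by
    filter_upwards [Ioo_mem_nhdsLT (show c - L < c by linarith [H.length_pos])] with s hs
    exact hD s c hs.2 (by linarith [hs.1])
  have h2 : map (fun s => s + L) (𝓝[<] c) = 𝓝[<] (c + L) := by
    simp
  rw [← h2, tendsto_map'_iff, tendsto_congr' (f₁ := (fun s => Θ s (c + L)) ∘ fun s => s + L)
    (f₂ := fun s => Θ s c + D) h1]
  exact ⟨fun h => by simpa using h.add_const (-D), fun h => h.add_const D⟩

theorem SecantLoop.tendsto_right_shift {g : ℝ → ℂ} {L : ℝ} {Θ : ℝ → ℝ → ℝ} (H : SecantLoop g L Θ)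
    {D : ℝ} (hD : ∀ s t, s < t → t < s + L → Θ (s + L) (t + L) = Θ s t + D) (c x : ℝ) :
    Tendsto (fun t => Θ (c + L) t) (𝓝[>] (c + L)) (𝓝 (x + D)) ↔
      Tendsto (fun t => Θ c t) (𝓝[>] c) (𝓝 x) := by
  have h1 : ∀ᶠ t in 𝓝[>] c, Θ (c + L) (t + L) = Θ c t + D := by
    filter_upwards [Ioo_mem_nhdsGT (show c < c + L by linarith [H.length_pos])] with t ht
    exact hD c t ht.1 ht.2
  have h2 : map (fun s => s + L) (𝓝[>] c) = 𝓝[>] (c + L) := by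
    simp
  rw [← h2, tendsto_map'_iff, tendsto_congr' (f₁ := (fun t => Θ (c + L) t) ∘ fun s => s + L)
    (f₂ := fun t => Θ c t + D) h1]
  exact ⟨fun h => by simpa using h.add_const (-D), fun h => h.add_const D⟩

theorem ClassCPi.exists_turningLoop {γ : ℝ → ℂ} {L : ℝ} (h : ClassCPi γ L) {ϑ : ℝ → ℝ}
    (hϑ : HasCurvatureAngle γ ϑ 0 L) : ∃ (Θ : ℝ → ℝ → ℝ) (θm θp : ℝ → ℝ),
      TurningLoop γ L Θ θm θp ∧ (∀ c ∈ Ioc 0 L, θm c = ϑ c) ∧ ∀ c ∈ Ico 0 L, θp c = ϑ c := by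
  have hpi := Real.pi_pos
  have hL := h.1.1.length_pos
  have l0 : (0 : ℝ) ∈ Icc 0 L := ⟨le_rfl, hL.le⟩
  have l1 : L ∈ Icc 0 L := ⟨hL.le, le_rfl⟩
  obtain ⟨Θ, H, hm, hp⟩ := h.1.1.exists_secantLoop_tendsto hϑ.toHasAngle hL
  obtain ⟨n, hn⟩ := H.exists_antipodal
  set D : ℝ := 2 * (Real.pi + 2 * Real.pi * n) with hD
  have hshift : ∀ s t, s < t → t < s + L → Θ (s + L) (t + L) = Θ s t + D := fun s t h1 h2 => by
    rw [hn t (s + L) h2 (by linarith), hn s t h1 h2]; ring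
  -- Existence of the limit is a periodic property, so one period suffices. The period is `(0, L]`
  -- for left limits and `[0, L)` for right limits, because the two differ at the cusp.
  have hexm : ∀ c, ∃ x, Tendsto (fun s => Θ s c) (𝓝[<] c) (𝓝 x) := by
    have hper : Function.Periodic (fun c => ∃ x, Tendsto (fun s => Θ s c) (𝓝[<] c) (𝓝 x)) L :=
      fun c => propext ⟨fun ⟨x, hx⟩ => ⟨x - D, (H.tendsto_left_shift hshift c _).1 (by
        rwa [sub_add_cancel])⟩, fun ⟨x, hx⟩ => ⟨x + D, (H.tendsto_left_shift hshift c x).2 hx⟩⟩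
    intro c
    obtain ⟨y, hy, e⟩ := hper.exists_mem_Ioc hL c 0
    rw [zero_add] at hy
    rw [e]
    exact ⟨_, hm y hy⟩
  have hexp : ∀ c, ∃ x, Tendsto (fun t => Θ c t) (𝓝[>] c) (𝓝 x) := by
    have hper : Function.Periodic (fun c => ∃ x, Tendsto (fun t => Θ c t) (𝓝[>] c) (𝓝 x)) L :=
      fun c => propext ⟨fun ⟨x, hx⟩ => ⟨x - D, (H.tendsto_right_shift hshift c _).1 (by
        rwa [sub_add_cancel])⟩, fun ⟨x, hx⟩ => ⟨x + D, (H.tendsto_right_shift hshift c x).2 hx⟩⟩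
    intro c
    obtain ⟨y, hy, e⟩ := hper.exists_mem_Ico₀ hL c
    rw [e]
    exact ⟨_, hp y hy⟩
  choose θm hθm using hexm
  choose θp hθp using hexp
  have em : ∀ c ∈ Ioc 0 L, θm c = ϑ c := fun c hc => tendsto_nhds_unique (hθm c) (hm c hc)
  have ep : ∀ c ∈ Ico 0 L, θp c = ϑ c := fun c hc => tendsto_nhds_unique (hθp c) (hp c hc)
  have sm : ∀ c, θm (c + L) = θm c + D := fun c =>
    tendsto_nhds_unique (hθm (c + L)) ((H.tendsto_left_shift hshift c _).2 (hθm c))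
  have sp : ∀ c, θp (c + L) = θp c + D := fun c =>
    tendsto_nhds_unique (hθp (c + L)) ((H.tendsto_right_shift hshift c _).2 (hθp c))
  obtain ⟨m, hm0⟩ := h.1.exists_angle_eq hϑ.toHasAngle
  have hjump : θp L = ϑ L + Real.pi := by
    have e1 : θp L = ϑ L + Real.pi + 2 * Real.pi * (m + 1 + 2 * n : ℤ) := by
      rw [← zero_add L, sp 0, ep 0 ⟨le_rfl, hL⟩, hm0, hD, zero_add]
      push_cast; ring
    have h1 := hθm L
    rw [em L ⟨hL, le_rfl⟩] at h1
    have h2 := hθp L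
    rw [e1] at h2
    rw [e1, h.1.cusp_jump hϑ.toHasAngle H h1 h2]
    simp
  have hjump0 : ϑ 0 + D = ϑ L + Real.pi := by
    rw [← hjump, ← ep 0 ⟨le_rfl, hL⟩, ← sp 0, zero_add]
  refine ⟨Θ, θm, θp, ⟨H, hθm, hθp, fun c => ?_, ?_⟩, em, ep⟩
  · have hper : Function.Periodic (fun c => θp c = θm c ∨ θp c = θm c + Real.pi) L := fun c => by
      simp only [sm, sp, add_right_comm _ D, add_left_inj]
    obtain ⟨y, hy, e⟩ := hper.exists_mem_Ioc hL c 0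
    rw [zero_add] at hy
    rw [e]
    rcases hy.2.eq_or_lt with h1 | h1
    · right; rw [h1, hjump, em L ⟨hL, le_rfl⟩]
    · left; rw [ep y ⟨hy.1.le, h1⟩, em y hy]
  · have hper : Function.Periodic (fun s => ∀ t, s < t → t ≤ s + L → -Real.pi < θm t - θp s) L := by
      intro s
      refine propext ⟨fun hs t h1 h2 => ?_, fun hs t h1 h2 => ?_⟩
      · have := hs (t + L) (by linarith) (by linarith)
        rw [sm, sp] at this
        linarith
      · have := hs (t - L) (by linarith) (by linarith)
        have e1 := sm (t - L)
        rw [sub_add_cancel] at e1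
        rw [e1, sp]
        linarith
    intro s
    obtain ⟨y, hy, e⟩ := hper.exists_mem_Ico₀ hL s
    rw [e]
    intro t h1 h2
    rw [ep y hy]
    rcases le_or_gt t L with h3 | h3
    · rw [em t ⟨by linarith [hy.1], h3⟩]
      exact h.neg_pi_lt hϑ hy.1 h1.le h3
    · have e1 := sm (t - L)
      rw [sub_add_cancel, em (t - L) ⟨by linarith, by linarith [hy.2]⟩] at e1
      -- An arc through the cusp consists of two pieces that each turn by more than `-π`, and the
      -- jump by `+π` makes up for one of them.
      have e2 := h.neg_pi_lt hϑ le_rfl (show 0 ≤ t - L by linarith) (by linarith [hy.2])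
      have e3 := h.neg_pi_lt hϑ hy.1 hy.2.le le_rfl
      linarith

/-! ### Normalization by a rigid motion, and the conclusion -/

/-- Points slightly to the left of a convex arc lie in its cap. -/
theorem CapArc.eventually_mem_cap {g : ℝ → ℂ} {ϑ : ℝ → ℝ} {a b ℓ s : ℝ} (h : CapArc g ϑ a b ℓ)
    (hs : s ∈ Ioo a b) : ∀ᶠ t : ℝ in 𝓝[>] 0,
      g s + t * Complex.exp ((ϑ s + Real.pi / 2 : ℝ) * Complex.I) ∈ cap g ϑ a b := by
  have hs' := Ioo_subset_Icc_self hs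
  have hgc := h.continuous_curve
  have hϑc := h.continuous
  have h1 : ∀ᶠ t : ℝ in 𝓝[>] 0,
      (g s + t * Complex.exp ((ϑ s + Real.pi / 2 : ℝ) * Complex.I)).im < 0 := by
    have hc : Continuous fun t : ℝ =>
      (g s + t * Complex.exp ((ϑ s + Real.pi / 2 : ℝ) * Complex.I)).im := by fun_prop
    refine ((hc.tendsto 0).eventually (gt_mem_nhds ?_)).filter_mono nhdsWithin_le_nhds
    simpa using h.im_neg hs
  -- Moving along the normal at `s` can lower the offset only from tangents at such `u`. By
  -- compactness these offsets are bounded below by some `m > 0`, so small steps are harmless.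
  have hC : IsCompact (Icc a b ∩ {u | Real.cos (ϑ s - ϑ u) ≤ 0}) :=
    isCompact_Icc.inter_right (isClosed_le (by fun_prop) continuous_const)
  obtain ⟨m, hm, hm'⟩ := hC.exists_forall_le' (f := fun u => side (ϑ u) (g s - g u)) (a := 0)
    (continuous_side.comp (f := fun u => (ϑ u, g s - g u)) (by fun_prop)).continuousOn
    fun u hu => h.tangent_pos hs' hu.1 fun e => by
      have := hu.2
      rw [mem_ofPred_eq, e, sub_self, Real.cos_zero] at this
      linarith
  have h2 : ∀ᶠ t : ℝ in 𝓝[>] 0, t ∈ Ioo 0 m := Ioo_mem_nhdsGT hm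
  filter_upwards [h1, h2] with t ht1 ht2
  refine ⟨ht1, fun u hu => ?_⟩
  have e : side (ϑ u) (g s + t * Complex.exp ((ϑ s + Real.pi / 2 : ℝ) * Complex.I) - g u) =
      side (ϑ u) (g s - g u) + t * Real.cos (ϑ s - ϑ u) := by
    rw [add_sub_right_comm, side_add, side_smul, side_exp,
      show ϑ s + Real.pi / 2 - ϑ u = ϑ s - ϑ u + Real.pi / 2 by ring, Real.sin_add_pi_div_two]
  rw [e]
  rcases le_or_gt (Real.cos (ϑ s - ϑ u)) 0 with hc | hc
  · have e1 := hm' u ⟨hu, hc⟩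
    have e2 := Real.neg_one_le_cos (ϑ s - ϑ u)
    nlinarith [ht2.1, ht2.2]
  · have e1 := h.tangent_nonneg hs' hu
    have := mul_pos ht2.1 hc
    linarith

/-- The rigid motion that moves `w` to the origin and turns by the angle `-χ`. -/
noncomputable def motion (w : ℂ) (χ : ℝ) : ℂ →ᵃ[ℝ] ℂ :=
  (LinearMap.mulRight ℝ (Complex.exp ((-χ : ℝ) * Complex.I))).toAffineMap +
    AffineMap.const ℝ ℂ (-w * Complex.exp ((-χ : ℝ) * Complex.I))

theorem motion_apply (w : ℂ) (χ : ℝ) (z : ℂ) :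
    motion w χ z = (z - w) * Complex.exp ((-χ : ℝ) * Complex.I) := by
  simp only [motion, AffineMap.coe_add, Pi.add_apply, AffineMap.const_apply,
    LinearMap.coe_toAffineMap, LinearMap.mulRight_apply]
  ring

theorem motion_sub (w : ℂ) (χ : ℝ) (z z' : ℂ) :
    motion w χ z - motion w χ z' = (z - z') * Complex.exp ((-χ : ℝ) * Complex.I) := by
  rw [motion_apply, motion_apply]; ring

theorem motion_injective (w : ℂ) (χ : ℝ) : Function.Injective (motion w χ) := fun z z' h => by
  have := motion_sub w χ z z'
  rw [h, sub_self, eq_comm, mul_eq_zero, sub_eq_zero] at this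
  exact this.resolve_right (Complex.exp_ne_zero _)

theorem continuous_motion (w : ℂ) (χ : ℝ) : Continuous (motion w χ) := by
  rw [show ⇑(motion w χ) = fun z => (z - w) * Complex.exp ((-χ : ℝ) * Complex.I) from
    funext (motion_apply w χ)]
  fun_prop

theorem preimage_motion_frontier (w : ℂ) (χ : ℝ) (S : Set ℂ) :
    frontier (motion w χ ⁻¹' S) = motion w χ ⁻¹' frontier S := by
  have := ((Homeomorph.addRight (-w)).trans
    (Homeomorph.mulRight₀ (Complex.exp ((-χ : ℝ) * Complex.I)) (Complex.exp_ne_zero _))).preimage_frontier S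
  rw [show ⇑(motion w χ) = ⇑((Homeomorph.addRight (-w)).trans
    (Homeomorph.mulRight₀ (Complex.exp ((-χ : ℝ) * Complex.I)) (Complex.exp_ne_zero _))) from
    funext fun z => by rw [motion_apply]; simp [sub_eq_add_neg]]
  exact this.symm

theorem HasAngle.motion {g : ℝ → ℂ} {ϑ : ℝ → ℝ} {a b : ℝ} (h : HasAngle g ϑ a b) (w : ℂ) (χ : ℝ) :
    HasAngle (fun s => motion w χ (g s)) (fun s => ϑ s - χ) a b := by
  refine ⟨h.continuous.sub continuous_const, fun s hs t ht => ?_⟩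
  rw [motion_sub, h.integral_eq s hs t ht, ← intervalIntegral.integral_mul_const]
  refine intervalIntegral.integral_congr fun u _ => ?_
  rw [← Complex.exp_add]
  congr 1
  push_cast
  ring

theorem TurningLoop.motion {g : ℝ → ℂ} {L : ℝ} {Θ : ℝ → ℝ → ℝ} {θm θp : ℝ → ℝ}
    (H : TurningLoop g L Θ θm θp) (w : ℂ) (χ : ℝ) :
    TurningLoop (fun s => motion w χ (g s)) L (fun s t => Θ s t - χ) (fun s => θm s - χ)
      fun s => θp s - χ where
  length_pos := H.length_pos
  periodic s := by rw [H.periodic]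
  continuous := (continuous_motion w χ).comp H.continuous
  injective s t h1 h2 e := H.injective s t h1 h2 (motion_injective w χ e)
  arg_continuousOn := H.arg_continuousOn.sub continuousOn_const
  isArg s t h1 h2 := by
    rw [motion_sub, sub_eq_add_neg]
    exact (H.isArg s t h1 h2).mul_exp _
  tendsto_left c := (H.tendsto_left c).sub_const χ
  tendsto_right c := (H.tendsto_right c).sub_const χ
  jump c := by
    rcases H.jump c with h | h
    · left; rw [h]
    · right; rw [h]; ring
  turning s t h1 h2 := by
    have := H.turning s t h1 h2
    linarith

/-- In the normalized position the cap of the inner arc does not meet the curve. -/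
theorem NestedArcs.curve_not_mem_cap {g : ℝ → ℂ} {L : ℝ} {Θ : ℝ → ℝ → ℝ} {θm θp ϑ : ℝ → ℝ}
    {p' p q q' ℓ : ℝ} (H : TurningLoop g L Θ θm θp) (h : NestedArcs g ϑ p' p q q' ℓ)
    (hm : ∀ c ∈ Ioc p' q', θm c = ϑ c) (s : ℝ) : g s ∉ cap g ϑ q q' := by
  have hC := h.cap_arc
  have hpi := Real.pi_pos
  obtain ⟨e, he, he1, he2, he3, he4⟩ := h.exists_crossing
  have l2 := h.lt₂
  have l3 := h.lt₃
  obtain ⟨t, ht, hst⟩ := Function.Periodic.exists_mem_Ico (f := g) H.periodic H.length_pos s e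
  rw [hst]
  rcases le_or_gt t q with h1 | h1
  · exact fun hc => absurd (he3 t ⟨ht.1, h1⟩) (not_le.2 hc.1)
  rcases le_or_gt t q' with h2 | h2
  · exact PlaneCurve.curve_not_mem_cap ⟨h1.le, h2⟩
  refine H.not_mem_cap (he.2.trans l2) l3 hC.right_end hC.left_end he1 he2 he3
    (isOpen_cap hC.continuous_curve hC.continuous q q') (fun z hz => hz.1)
    (fun z h1 h2 h3 => hC.chord_subset_closure h1 h2 h3) hC.isOpen_cap_union
    (fun z hz h0 => hC.re_of_mem_closure hz h0) (fun u hu h0 hu' => ?_) ?_ ?_ ⟨h2, ht.2⟩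
  · refine hC.mem_cap_of_not_mem_arc hu' h0 ?_
    rintro ⟨v, hv, e1⟩
    exact H.injective v u (hv.2.trans_lt hu.1) (by linarith [hu.2, hv.1, he.2]) e1
  · rw [hm q' ⟨by linarith [he.1, he.2], le_rfl⟩, hC.turn]
    linarith [hC.angle_left.1]
  · rw [H.left_shift, hm e ⟨he.1, by linarith [he.2]⟩]
    linarith

/-- A nested arc of an admissible curve that nowhere turns right by `π` holds a convex set. -/
theorem exists_holds {A : ℝ → ℝ → Prop} {γ : ℝ → ℂ} {L : ℝ} {Θ : ℝ → ℝ → ℝ} {θm θp ϑ : ℝ → ℝ}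
    {p' p q q' : ℝ} (hγ : IsAdmissible γ L) (hA : ∀ s t, A s t → s < t)
    (H : TurningLoop γ L Θ θm θp) (hϑ : HasCurvatureAngle γ ϑ p' q')
    (hm : ∀ c ∈ Ioc p' q', θm c = ϑ c) (hN : IsNested A γ p' p q q')
    (hconc : totalCurvature γ p q ∈ Ioo (-Real.pi) 0) (hlt : q' < p' + L) :
    ∃ K, Holds γ L q q' K := by
  have hpi := Real.pi_pos
  obtain ⟨⟨hpq, -⟩, hpp, hpp', hqq, hqq', hmeet⟩ := hN
  have l1 : p' < p := hA _ _ hpp.1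
  have l2 : p < q := hA _ _ hpq.1
  have l3 : q < q' := hA _ _ hqq.1
  have mp' : p' ∈ Icc p' q' := ⟨le_rfl, by linarith⟩
  have mp : p ∈ Icc p' q' := ⟨l1.le, by linarith⟩
  have mq : q ∈ Icc p' q' := ⟨by linarith, l3.le⟩
  have mq' : q' ∈ Icc p' q' := ⟨by linarith, le_rfl⟩
  rw [hϑ.total p' mp' p mp] at hpp'
  rw [hϑ.total q mq q' mq'] at hqq'
  rw [hϑ.total p mp q mq] at hconc
  have mono1 : MonotoneOn ϑ (Icc p' p) :=
    (hϑ.mono le_rfl mp.2).monotoneOn countable_empty fun u hu _ => hpp.2.1 u hu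
  have anti : AntitoneOn ϑ (Icc p q) :=
    (hϑ.mono mp.1 mq.2).antitoneOn countable_empty fun u hu _ => hpq.2.1 u hu
  have mono2 : MonotoneOn ϑ (Icc q q') :=
    (hϑ.mono mq.1 le_rfl).monotoneOn countable_empty fun u hu _ => hqq.2.1 u hu
  have hA2 : HasAngle γ ϑ q q' := (hϑ.mono mq.1 le_rfl).toHasAngle
  -- `χ` is the direction of the chord from `q` to `q'`; turning by `-χ` makes the chord horizontal,
  -- and `χ ∈ (ϑ q, ϑ q + π)` puts the arc below it.
  obtain ⟨χ, hχ, hχ'⟩ := exists_arg_of_side_pos (hA2.tangent_pos mono2 (by linarith)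
    (right_mem_Icc.2 l3.le) (left_mem_Icc.2 l3.le) (by linarith))
  have hinj : ∀ s ∈ Icc p' q', ∀ t ∈ Icc p' q', s < t → γ s ≠ γ t := fun s hs t ht hst =>
    H.injective s t hst (by linarith [hs.1, ht.2])
  have hne : γ q' - γ q ≠ 0 := sub_ne_zero.2 (hinj q mq q' mq' l3).symm
  set M := motion (γ q') χ with hM
  have hcap : CapArc (fun s => M (γ s)) (fun s => ϑ s - χ) q q' ‖γ q' - γ q‖ :=
    { hA2.motion (γ q') χ with
      continuous_curve := (continuous_motion _ _).comp H.continuous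
      lt := l3
      mono := fun x hx y hy hxy => sub_le_sub_right (mono2 hx hy hxy) χ
      turn := by linarith
      length_pos := norm_pos_iff.2 hne
      left_end := by
        rw [hM, motion_apply, ← neg_sub, neg_mul]
        conv_lhs => rw [hχ']
        rw [mul_assoc, ← Complex.exp_add]
        simp
      right_end := by rw [hM, motion_apply, sub_self, zero_mul]
      angle_left := ⟨by linarith [hχ.2], by linarith [hχ.1]⟩ }
  have hnest : NestedArcs (fun s => M (γ s)) (fun s => ϑ s - χ) p' p q q' ‖γ q' - γ q‖ :=
    { hϑ.toHasAngle.motion (γ q') χ with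
      cap_arc := hcap
      lt₁ := l1
      lt₂ := l2
      injective := fun s hs t ht hst e => hinj s hs t ht hst (motion_injective _ _ e)
      mono := fun x hx y hy hxy => sub_le_sub_right (mono1 hx hy hxy) χ
      anti := fun x hx y hy hxy => sub_le_sub_right (anti hx hy hxy) χ
      turn := by linarith
      concave := ⟨by linarith [hconc.2], by linarith [hconc.1]⟩
      meets := by
        obtain ⟨z, ⟨s, hs, rfl⟩, hz⟩ := hmeet
        refine ⟨s, hs, ?_⟩
        rw [← image_segment]
        exact mem_image_of_mem _ hz }
  set K₀ := cap (fun s => M (γ s)) (fun s => ϑ s - χ) q q' with hK₀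
  have hnot : ∀ s, M (γ s) ∉ K₀ := fun s =>
    hnest.curve_not_mem_cap (H.motion (γ q') χ) (fun c hc => by rw [hm c hc]) s
  have hconv : Convex ℝ (M ⁻¹' K₀) := (convex_cap _ _ _ _).affine_preimage M
  have hfr : frontier (M ⁻¹' K₀) = segment ℝ (γ q) (γ q') ∪ γ '' Icc q q' := by
    rw [preimage_motion_frontier, hcap.frontier_cap, ← image_segment, preimage_union,
      (motion_injective _ _).preimage_image, ← image_image M γ, (motion_injective _ _).preimage_image]
  have hmeets : ∃ z ∈ M ⁻¹' K₀, z ∈ region γ L := by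
    -- The orientation is known only at parameters inside a period, so `s` must not be a multiple of
    -- `L`.
    obtain ⟨s, hs, hsL⟩ := ((countable_range fun n : ℤ => n • L).dense_compl ℝ).inter_open_nonempty
      (Ioo q q') isOpen_Ioo (nonempty_Ioo.2 l3)
    obtain ⟨n, hn, -⟩ := existsUnique_sub_zsmul_mem_Ico hγ.length_pos s 0
    rw [zero_add] at hn
    have hn0 : s - n • L ≠ 0 := fun e => hsL ⟨n, (sub_eq_zero.1 e).symm⟩
    have hd : deriv γ s = Complex.exp (ϑ s * Complex.I) := (hA2.hasDerivAt hs).deriv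
    have h1 := hγ.positively_oriented (s - n • L) ⟨lt_of_le_of_ne hn.1 hn0.symm, hn.2⟩
    rw [hγ.periodic.sub_zsmul_eq n, (periodic_deriv hγ.periodic).sub_zsmul_eq n, hd] at h1
    obtain ⟨t, h2, h3⟩ := (h1.and (hcap.eventually_mem_cap hs)).exists
    refine ⟨_, ?_, h2⟩
    rw [mem_preimage]
    convert h3 using 1
    rw [← sub_eq_iff_eq_add', motion_sub, Complex.real_smul]
    push_cast
    rw [show ((ϑ s : ℂ) - χ + Real.pi / 2) * Complex.I =
      ϑ s * Complex.I + -χ * Complex.I + Real.pi / 2 * Complex.I by ring, Complex.exp_add,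
      Complex.exp_add, Complex.exp_pi_div_two_mul_I]
    ring
  obtain ⟨z, hz, hzr⟩ := hmeets
  refine ⟨M ⁻¹' K₀, (isOpen_cap hcap.continuous_curve hcap.continuous _ _).preimage
    (continuous_motion _ _), hconv, fun w hw => region_of_isPreconnected hconv.isPreconnected ?_ hz
      hzr hw, hfr, -1, by norm_num, ?_⟩
  · rintro _ hx ⟨s, -, rfl⟩
    exact hnot s hx
  · rw [hA2.derivWithin_eq l3 (right_mem_Icc.2 l3.le), hA2.derivWithin_eq l3 (left_mem_Icc.2 l3.le),
      show ϑ q' = ϑ q + Real.pi by linarith]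
    push_cast
    rw [add_mul, Complex.exp_add, Complex.exp_pi_mul_I]
    simp

theorem segment_subset_closure_of_holds {γ : ℝ → ℂ} {L s t : ℝ} {K : Set ℂ} (h : Holds γ L s t K) :
    segment ℝ (γ s) (γ t) ⊆ closure (region γ L) := fun _ hz =>
  closure_mono h.2.2.1 (frontier_subset_closure (h.2.2.2.1 ▸ Or.inl hz))

/-- The first arc of a nested configuration and the following ones together turn by less than
`2 * π`. -/
theorem IsNested.angle_lt {A : ℝ → ℝ → Prop} {γ : ℝ → ℂ} {ϑ : ℝ → ℝ} {p' p q q' : ℝ}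
    (hA : ∀ s t, A s t → s < t) (hϑ : HasCurvatureAngle γ ϑ p' q') (hN : IsNested A γ p' p q q')
    (hconc : totalCurvature γ p q ∈ Ioo (-Real.pi) 0) :
    (∀ s ∈ Icc p' q', ϑ s < ϑ p' + 2 * Real.pi) ∧ ϑ p' + Real.pi < ϑ q' := by
  have hpi := Real.pi_pos
  obtain ⟨⟨hpq, -⟩, hpp, hpp', hqq, hqq', -⟩ := hN
  have l1 : p' < p := hA _ _ hpp.1
  have l2 : p < q := hA _ _ hpq.1
  have l3 : q < q' := hA _ _ hqq.1
  have mp : p ∈ Icc p' q' := ⟨l1.le, by linarith⟩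
  have mq : q ∈ Icc p' q' := ⟨by linarith, l3.le⟩
  rw [hϑ.total p' ⟨le_rfl, by linarith⟩ p mp] at hpp'
  rw [hϑ.total q mq q' ⟨by linarith, le_rfl⟩] at hqq'
  rw [hϑ.total p mp q mq] at hconc
  refine ⟨fun s hs => ?_, by linarith [hconc.1]⟩
  rcases le_or_gt s p with h1 | h1
  · have := (hϑ.mono le_rfl mp.2).monotoneOn countable_empty (fun u hu _ => hpp.2.1 u hu)
      ⟨hs.1, h1⟩ (right_mem_Icc.2 l1.le) h1
    linarith
  rcases le_or_gt s q with h2 | h2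
  · have := (hϑ.mono mp.1 mq.2).antitoneOn countable_empty (fun u hu _ => hpq.2.1 u hu)
      (left_mem_Icc.2 l2.le) ⟨h1.le, h2⟩ h1.le
    linarith
  · have := (hϑ.mono mq.1 le_rfl).monotoneOn countable_empty (fun u hu _ => hqq.2.1 u hu)
      ⟨h2.le, hs.2⟩ (right_mem_Icc.2 l3.le) hs.2
    linarith [hconc.2]

end PlaneCurve

theorem mainTheorem7 (γ : ℝ → ℂ) (L p' p q q' : ℝ)
    (h : (PlaneCurve.ClassKPi γ L ∧ PlaneCurve.IsNested (PlaneCurve.SmoothArc L) γ p' p q q') ∨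
      (PlaneCurve.ClassCPi γ L ∧ PlaneCurve.IsNested (PlaneCurve.CuspFreeArc L) γ p' p q q')) :
    (∃ K : Set ℂ, PlaneCurve.Holds γ L q q' K) ∧
      segment ℝ (γ q) (γ q') ⊆ closure (PlaneCurve.region γ L) := by
  suffices hK : ∃ K : Set ℂ, PlaneCurve.Holds γ L q q' K from
    ⟨hK, hK.elim fun _ hK => PlaneCurve.segment_subset_closure_of_holds hK⟩
  have hpi := Real.pi_pos
  rcases h with ⟨h, hN⟩ | ⟨h, hN⟩
  · obtain ⟨ϑ, hϑ⟩ := h.1.exists_angle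
    obtain ⟨Θ, H⟩ := h.exists_turningLoop hϑ
    have hA : ∀ s t, PlaneCurve.SmoothArc L s t → s < t := fun s t h => h.1
    have hconc := h.2.2 p q hN.1
    refine PlaneCurve.exists_holds h.1.1 hA H (hϑ p' q') (fun _ _ => rfl) hN hconc ?_
    -- If the arcs overlapped, `p' + L` would be a parameter of the configuration, but a full period
    -- adds `2π` to the angle, which is never reached there.
    by_contra hlt
    have h1 := (hN.angle_lt hA (hϑ p' q') hconc).1 (p' + L)
      ⟨by linarith [h.1.1.length_pos], not_lt.1 hlt⟩
    rw [H.left_shift] at h1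
    linarith
  · obtain ⟨ϑ, hϑ₀⟩ := h.1.1.exists_angle
    obtain ⟨Θ, θm, θp, H, hm, hp⟩ := h.exists_turningLoop hϑ₀
    have hA : ∀ s t, PlaneCurve.CuspFreeArc L s t → s < t := fun s t h => h.2.1
    have hconc := h.2.2 p q hN.1
    have h0 : 0 ≤ p' := hN.2.1.1.1
    have h1 : q' ≤ L := hN.2.2.2.1.1.2.2
    have hϑ := hϑ₀.mono h0 h1
    refine PlaneCurve.exists_holds h.1.1 hA H hϑ
      (fun c hc => hm c ⟨h0.trans_lt hc.1, hc.2.trans h1⟩) hN hconc ?_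
    -- An overlap is only possible if the arcs fill `[0, L]`. The angle would then gain strictly
    -- between `π` and `2π`, whereas by Hopf's theorem it gains `2π` minus the jump at the closing
    -- point, that is, `2π` or `π`.
    by_contra hlt
    have hL := h.1.1.length_pos
    obtain rfl : p' = 0 := by linarith
    obtain rfl : q' = L := by linarith
    obtain ⟨h2, h3⟩ := hN.angle_lt hA hϑ hconc
    have h4 := h2 q' ⟨hL.le, le_rfl⟩
    have h5 := H.right_shift 0
    rw [zero_add, hp 0 ⟨le_rfl, hL⟩] at h5
    have h6 := H.jump q'
    rw [h5, hm q' ⟨hL, le_rfl⟩] at h6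
    rcases h6 with h6 | h6 <;> linarith
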